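/- **Setting.** Let $n\ge 2$ and let $M$ be an $n$-dimensional complete rotationally symmetric Riemannian manifold with pole $\mathcal O$: in polar coordinates around $\mathcal O$ its metric is $$g=dr^2+\psi(r)^2\,d\theta^2,\qquad 0<r<R,\ \theta\in\mathbb S^{n-1},$$ with $0<R\le\infty$, $\psi>0$ on $(0,R)$, where $\psi$ extends to a smooth odd function with $\psi'(0)=1$ and where, if $R<\infty$, the manifold closes up smoothly at $r=R$ as the round sphere does (that is, $\psi$ extends to a smooth function with $\psi(R+s)=-\psi(R-s)$ and $\psi'(R)=-1$). Euclidean space ($\psi(r)=r$, $R=\infty$), the sphere ($\psi(r)=\sin r$, $R=\pi$) and hyperbolic space ($\psi(r)=\sinh r$, $R=\infty$) are included. We work in the polar coordinates around $\mathcal O$, that is, on $\{0\le r<R\}$, and closures and boundaries are taken there (when $R<\infty$ only the antipodal point of $\mathcal O$ is omitted). Let $dV$, $d\sigma$ and $\operatorname{div}$ be the Riemannian volume measure, the Riemannian surface measure on hypersurfaces, and the Riemannian divergence. Let $\Sigma=\{t\theta:\theta\in\omega,\ 0<t<R\}$ be the open cone with vertex $\mathcal O$ over a non-empty connected open set $\omega\subset\mathbb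 S^{n-1}$, where $t\theta$ is the point with polar coordinates $(t,\theta)$. Let $\Omega_1,\Omega_2\subset\Sigma$ be bounded domains (non-empty, open, connected) with $\overline{\Omega}_2\cap\Sigma\subset\Omega_1$ and $\mathcal O\in\partial\Omega_2$, and put $$\Omega=\Omega_1\setminus\overline{\Omega}_2,\quad \Gamma_0=\partial\Omega_1\cap\Sigma,\quad \Gamma_2=\partial\Omega_2\cap\Sigma,\quad \Gamma_1=\partial\Omega\setminus(\overline{\Gamma}_0\cup\overline{\Gamma}_2).$$ For a hypersurface $\Gamma$ write $\partial\Gamma=\overline\Gamma\setminus\Gamma$. Suppose that $\Omega$ is an annular sector-like domain, that is: * $\mathcal H_{n-1}(\Gamma_i)>0$ for $i=0,1,2$; * each $\Gamma_i$ ($i=0,1,2$) is a smooth embedded $(n-1)$-dimensional submanifold that, near each of its points, coincides with $\partial\Omega$ and has $\Omega$ on exactly one side (so that the outward unit normal $\nu$ of $\Omega$ is defined along $\Gamma_0\cup\Gamma_1\cup\Gamma_2$); * $\partial\Gamma_0$ and $\partial\Gamma_2$ are smooth embedded $(n-2)$-dimensional submanifolds, and $\partial\Gamma_1=\partial\Gamma_0\cup\partial\Gamma_2$.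 **Theorem (divergence theorem).** Let $X$ be a vector field with $$X\in C^1(\Omega\cup\Gamma_0\cup\Gamma_1\cup\Gamma_2),\qquad |X|\in L^2(\Omega),\qquad \operatorname{div}X\in L^1(\Omega),$$ and suppose that the integral $\int_{\partial\Omega}\langle X,\nu\rangle\,d\sigma$ exists in $[-\infty,\infty]$, that is, at least one of the positive and the negative part of $\langle X,\nu\rangle$ has finite integral over $\partial\Omega$. Then $\langle X,\nu\rangle$ is integrable on $\partial\Omega$ and $$\int_\Omega\operatorname{div}X\,dV=\int_{\partial\Omega}\langle X,\nu\rangle\,d\sigma=\int_{\Gamma_0}\langle X,\nu\rangle\,d\sigma+\int_{\Gamma_1}\langle X,\nu\rangle\,d\sigma+\int_{\Gamma_2}\langle X,\nu\rangle\,d\sigma .$$ (Here $\partial\Omega$ is the disjoint union of $\Gamma_0,\Gamma_1,\Gamma_2$ and the $\sigma$-null set $\partial\Gamma_0\cup\partial\Gamma_2$, on which $\nu$ need not be defined.) -/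

import Mathlib

open MeasureTheory Set
open scoped ENNReal ContDiff

/-- The warping function of a complete rotationally symmetric Riemannian manifold
`ds² = dr² + ψ(r)² dθ²`, `0 < r < radius`, with pole at `r = 0`.
Smoothness of the metric at the pole means that `ψ` extends smoothly to an odd function with
`ψ'(0) = 1`. Completeness means that either `radius = ∞`, or the manifold closes up smoothly at the
point antipodal to the pole, as the sphere does; then `ψ` is odd about `radius` and has derivative
`-1` there. Only the values of `ψ` on `(0, radius)` enter the geometry. -/
structure ModelSpace where
  /-- the supremum of the distances to the pole -/
  radius : ℝ≥0∞
  /-- the warping function -/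
  ψ : ℝ → ℝ
  radius_pos : 0 < radius
  smooth : ContDiff ℝ ∞ ψ
  pos : ∀ r : ℝ, 0 < r → ENNReal.ofReal r < radius → 0 < ψ r
  odd : ∀ r : ℝ, ψ (-r) = -ψ r
  deriv_zero : deriv ψ 0 = 1
  complete : ∀ R : ℝ, radius = ENNReal.ofReal R →
    (∀ s : ℝ, ψ (R + s) = -ψ (R - s)) ∧ deriv ψ R = -1

namespace ModelSpace

/-- Euclidean space: `ψ(r) = r` on `[0, ∞)`. -/
noncomputable def euclidean : ModelSpace where
  radius := ⊤
  ψ := fun r => r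
  radius_pos := by simp
  smooth := contDiff_id
  pos := fun _ h _ => h
  odd := fun _ => rfl
  deriv_zero := by simp
  complete := fun _ h => absurd h.symm ENNReal.ofReal_ne_top

/-- Elliptic space (the round sphere): `ψ(r) = sin r` on `[0, π)`. -/
noncomputable def elliptic : ModelSpace where
  radius := ENNReal.ofReal Real.pi
  ψ := Real.sin
  radius_pos := ENNReal.ofReal_pos.2 Real.pi_pos
  smooth := Real.contDiff_sin
  pos := fun _ h h' =>
    Real.sin_pos_of_pos_of_lt_pi h ((ENNReal.ofReal_lt_ofReal_iff Real.pi_pos).1 h')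
  odd := Real.sin_neg
  deriv_zero := by simp
  complete := by
    intro R h
    have hR : R = Real.pi := by
      by_contra hne
      rcases le_or_gt R 0 with h0 | h0
      · rw [ENNReal.ofReal_of_nonpos h0] at h
        exact absurd h (ENNReal.ofReal_pos.2 Real.pi_pos).ne'
      · exact hne ((ENNReal.ofReal_eq_ofReal_iff Real.pi_pos.le h0.le).1 h).symm
    subst hR
    refine ⟨fun s => ?_, by simp⟩
    rw [Real.sin_pi_sub, add_comm, Real.sin_add_pi]

/-- Hyperbolic space: `ψ(r) = sinh r` on `[0, ∞)`. -/
noncomputable def hyperbolic : ModelSpace where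
  radius := ⊤
  ψ := Real.sinh
  radius_pos := by simp
  smooth := Real.contDiff_sinh
  pos := fun _ h _ => Real.sinh_pos_iff.2 h
  odd := Real.sinh_neg
  deriv_zero := by simp
  complete := fun _ h => absurd h.symm ENNReal.ofReal_ne_top

variable (M : ModelSpace) {n : ℕ}

/-- The `n`-dimensional model manifold in geodesic polar coordinates: the point `x = rθ` of the ball
`‖x‖ < radius` of `ℝⁿ` stands for the point with polar coordinates `(r, θ)`, and the origin for the
pole. So `‖x‖` is the Riemannian distance of `x` to the pole. (If `radius < ∞`, the single point
antipodal to the pole is not covered.) -/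
def carrier (n : ℕ) : Set (EuclideanSpace ℝ (Fin n)) :=
  {x | ‖x‖ₑ < M.radius}

/-- The stretching factor `ψ(r) / r` of the metric in the directions tangent to the sphere of radius
`r = ‖x‖`, with its limit `1` at the pole. -/
noncomputable def angularFactor (x : EuclideanSpace ℝ (Fin n)) : ℝ :=
  if x = 0 then 1 else M.ψ ‖x‖ / ‖x‖

/-- The Riemannian metric `dr² + ψ(r)² dθ²` at the point `x`, as a bilinear form in the Cartesian
coordinates `x = rθ`. -/
noncomputable def metric (x : EuclideanSpace ℝ (Fin n)) :
    EuclideanSpace ℝ (Fin n) →ₗ[ℝ] EuclideanSpace ℝ (Fin n) →ₗ[ℝ] ℝ :=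
  LinearMap.mk₂ ℝ
    (fun v w =>
      inner ℝ v (‖x‖⁻¹ • x) * inner ℝ w (‖x‖⁻¹ • x) +
        M.angularFactor x ^ 2 *
          (inner ℝ v w - inner ℝ v (‖x‖⁻¹ • x) * inner ℝ w (‖x‖⁻¹ • x)))
    (fun v v' w => by simp only [inner_add_left]; ring)
    (fun c v w => by simp only [real_inner_smul_left, smul_eq_mul]; ring)
    (fun v w w' => by simp only [inner_add_left, inner_add_right]; ring)
    (fun c v w => by
      simp only [real_inner_smul_left, inner_smul_right, smul_eq_mul]; ring)

/-- The Riemannian length of a tangent vector `v` at `x`. -/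
noncomputable def normAt (x v : EuclideanSpace ℝ (Fin n)) : ℝ :=
  Real.sqrt (M.metric x v v)

/-- The volume density `√(det gᵢⱼ)`. -/
noncomputable def volDensity (x : EuclideanSpace ℝ (Fin n)) : ℝ :=
  Real.sqrt (Matrix.det (Matrix.of fun i j : Fin n =>
    M.metric x (EuclideanSpace.single i 1) (EuclideanSpace.single j 1)))

/-- The Riemannian volume measure `dV = √(det gᵢⱼ) dx`. -/
noncomputable def vol (n : ℕ) : Measure (EuclideanSpace ℝ (Fin n)) :=
  (volume.restrict (M.carrier n)).withDensity fun x => ENNReal.ofReal (M.volDensity x)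

/-- The Riemannian divergence `div X = (det g)^(-1/2) ∑ᵢ ∂ᵢ((det g)^(1/2) Xⁱ)`. -/
noncomputable def div (X : EuclideanSpace ℝ (Fin n) → EuclideanSpace ℝ (Fin n))
    (x : EuclideanSpace ℝ (Fin n)) : ℝ :=
  (M.volDensity x)⁻¹ *
    ∑ i : Fin n, fderiv ℝ (fun y => M.volDensity y * X y i) x (EuclideanSpace.single i 1)

/-- The closure in the model manifold. -/
def closureIn (A : Set (EuclideanSpace ℝ (Fin n))) : Set (EuclideanSpace ℝ (Fin n)) :=
  closure A ∩ M.carrier n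

/-- The topological boundary in the model manifold. -/
def boundary (A : Set (EuclideanSpace ℝ (Fin n))) : Set (EuclideanSpace ℝ (Fin n)) :=
  frontier A ∩ M.carrier n

/-- The boundary `∂Γ = Γ̅ \ Γ` of a hypersurface `Γ`. -/
def edge (Γ : Set (EuclideanSpace ℝ (Fin n))) : Set (EuclideanSpace ℝ (Fin n)) :=
  M.closureIn Γ \ Γ

end ModelSpace

/-- In the open set `U`, the set `Ω` is the sublevel set `{φ < 0}` of a smooth function without
critical points. Then, within `U`, the boundary of `Ω` is the smooth hypersurface `{φ = 0}`, and `Ω`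
lies on one side of it. -/
structure IsDefiningFunction {n : ℕ} (Ω U : Set (EuclideanSpace ℝ (Fin n)))
    (φ : EuclideanSpace ℝ (Fin n) → ℝ) : Prop where
  isOpen : IsOpen U
  smooth : ContDiffOn ℝ ∞ φ U
  fderiv_ne_zero : ∀ x ∈ U, fderiv ℝ φ x ≠ 0
  mem_iff : ∀ x ∈ U, x ∈ Ω ↔ φ x < 0

/-- `Γ` is a smooth piece of the boundary of `Ω`: an embedded smooth hypersurface which, near each of
its points, is the boundary of `Ω`, with `Ω` on one side of it. -/
def IsSmoothBoundaryPiece {n : ℕ} (Ω Γ : Set (EuclideanSpace ℝ (Fin n))) : Prop :=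
  ∀ p ∈ Γ, ∃ (U : Set (EuclideanSpace ℝ (Fin n))) (φ : EuclideanSpace ℝ (Fin n) → ℝ),
    p ∈ U ∧ IsDefiningFunction Ω U φ ∧ Γ ∩ U = {x ∈ U | φ x = 0}

/-- `S` is an embedded smooth submanifold (without boundary) of codimension `c`. -/
def IsSmoothSubmanifold {n : ℕ} (c : ℕ) (S : Set (EuclideanSpace ℝ (Fin n))) : Prop :=
  ∀ p ∈ S, ∃ (U : Set (EuclideanSpace ℝ (Fin n)))
    (F : EuclideanSpace ℝ (Fin n) → EuclideanSpace ℝ (Fin c)),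
    p ∈ U ∧ IsOpen U ∧ ContDiffOn ℝ ∞ F U ∧
      (∀ x ∈ U, Function.Surjective (fderiv ℝ F x)) ∧ S ∩ U = {x ∈ U | F x = 0}

namespace ModelSpace

variable (M : ModelSpace) {n : ℕ}

/-- `ν` is the outward unit normal of `Ω` at its boundary point `p`: the normalized Riemannian
gradient at `p` of a function defining `Ω` near `p`. -/
def IsOutwardUnitNormal (Ω : Set (EuclideanSpace ℝ (Fin n)))
    (p ν : EuclideanSpace ℝ (Fin n)) : Prop :=
  ∃ (U : Set (EuclideanSpace ℝ (Fin n))) (φ : EuclideanSpace ℝ (Fin n) → ℝ),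
    p ∈ U ∧ IsDefiningFunction Ω U φ ∧ φ p = 0 ∧ M.metric p ν ν = 1 ∧
      ∃ c : ℝ, 0 < c ∧ ∀ v, M.metric p ν v = c * fderiv ℝ φ p v

open Classical in
/-- The outward unit normal of `Ω` (and `0` where there is none). -/
noncomputable def outwardNormal (Ω : Set (EuclideanSpace ℝ (Fin n)))
    (p : EuclideanSpace ℝ (Fin n)) : EuclideanSpace ℝ (Fin n) :=
  if h : ∃ ν, M.IsOutwardUnitNormal Ω p ν then h.choose else 0

/-- The tangent hyperplane of `∂Ω` at `p`. -/
noncomputable def tangentPlane (Ω : Set (EuclideanSpace ℝ (Fin n)))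
    (p : EuclideanSpace ℝ (Fin n)) : Submodule ℝ (EuclideanSpace ℝ (Fin n)) :=
  LinearMap.ker (M.metric p (M.outwardNormal Ω p))

/-- The ratio of the Riemannian to the Euclidean area element of `∂Ω` at `p`: the square root of the
Gram determinant of the metric in a Euclidean orthonormal basis of the tangent hyperplane. -/
noncomputable def areaDensity (Ω : Set (EuclideanSpace ℝ (Fin n)))
    (p : EuclideanSpace ℝ (Fin n)) : ℝ :=
  Real.sqrt (Matrix.det (Matrix.of fun i j =>
    M.metric p (stdOrthonormalBasis ℝ (M.tangentPlane Ω p) i : EuclideanSpace ℝ (Fin n))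
      (stdOrthonormalBasis ℝ (M.tangentPlane Ω p) j : EuclideanSpace ℝ (Fin n))))

/-- The Riemannian surface measure `dσ` of `∂Ω`. -/
noncomputable def surface (Ω : Set (EuclideanSpace ℝ (Fin n))) :
    Measure (EuclideanSpace ℝ (Fin n)) :=
  (Measure.restrict μHE[n - 1] (M.boundary Ω)).withDensity
    fun p => ENNReal.ofReal (M.areaDensity Ω p)

/-- The normal component `⟨X, ν⟩` of `X` on `∂Ω`. -/
noncomputable def normalComponent (Ω : Set (EuclideanSpace ℝ (Fin n)))
    (X : EuclideanSpace ℝ (Fin n) → EuclideanSpace ℝ (Fin n))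
    (p : EuclideanSpace ℝ (Fin n)) : ℝ :=
  M.metric p (X p) (M.outwardNormal Ω p)

/-- The open cone with vertex at the pole over a set `D` of directions. -/
def cone (D : Set (Metric.sphere (0 : EuclideanSpace ℝ (Fin n)) 1)) :
    Set (EuclideanSpace ℝ (Fin n)) :=
  {x | ∃ θ ∈ D, ∃ t : ℝ, 0 < t ∧ ENNReal.ofReal t < M.radius ∧
    x = t • (θ : EuclideanSpace ℝ (Fin n))}

/-- `Γ₀ = ∂Ω₁ ∩ Σ` -/
def outerPart (D : Set (Metric.sphere (0 : EuclideanSpace ℝ (Fin n)) 1))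
    (Ω₁ : Set (EuclideanSpace ℝ (Fin n))) : Set (EuclideanSpace ℝ (Fin n)) :=
  M.boundary Ω₁ ∩ M.cone D

/-- `Γ₂ = ∂Ω₂ ∩ Σ` -/
def innerPart (D : Set (Metric.sphere (0 : EuclideanSpace ℝ (Fin n)) 1))
    (Ω₂ : Set (EuclideanSpace ℝ (Fin n))) : Set (EuclideanSpace ℝ (Fin n)) :=
  M.boundary Ω₂ ∩ M.cone D

/-- `Ω = Ω₁ \ Ω̅₂` -/
def annulus (Ω₁ Ω₂ : Set (EuclideanSpace ℝ (Fin n))) : Set (EuclideanSpace ℝ (Fin n)) :=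
  Ω₁ \ M.closureIn Ω₂

/-- `Γ₁ = ∂Ω \ (Γ̅₀ ∪ Γ̅₂)` -/
def lateralPart (D : Set (Metric.sphere (0 : EuclideanSpace ℝ (Fin n)) 1))
    (Ω₁ Ω₂ : Set (EuclideanSpace ℝ (Fin n))) : Set (EuclideanSpace ℝ (Fin n)) :=
  M.boundary (M.annulus Ω₁ Ω₂) \
    (M.closureIn (M.outerPart D Ω₁) ∪ M.closureIn (M.innerPart D Ω₂))

/-- `Ω = Ω₁ \ Ω̅₂` is an annular sector-like domain in the cone over `D`. Since `‖x‖` is the distance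
to the pole, boundedness of a set in the Euclidean sense is its boundedness in the model manifold. -/
structure IsAnnularSectorLike (D : Set (Metric.sphere (0 : EuclideanSpace ℝ (Fin n)) 1))
    (Ω₁ Ω₂ : Set (EuclideanSpace ℝ (Fin n))) : Prop where
  isOpen_directions : IsOpen D
  isConnected_directions : IsConnected D
  isOpen₁ : IsOpen Ω₁
  isConnected₁ : IsConnected Ω₁
  isBounded₁ : Bornology.IsBounded Ω₁
  subset₁ : Ω₁ ⊆ M.cone D
  isOpen₂ : IsOpen Ω₂
  isConnected₂ : IsConnected Ω₂
  isBounded₂ : Bornology.IsBounded Ω₂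
  subset₂ : Ω₂ ⊆ M.cone D
  closure_subset : M.closureIn Ω₂ ∩ M.cone D ⊆ Ω₁
  pole_mem : 0 ∈ M.boundary Ω₂
  area_outer_pos : 0 < μHE[n - 1] (M.outerPart D Ω₁)
  area_lateral_pos : 0 < μHE[n - 1] (M.lateralPart D Ω₁ Ω₂)
  area_inner_pos : 0 < μHE[n - 1] (M.innerPart D Ω₂)
  smooth_outer : IsSmoothBoundaryPiece (M.annulus Ω₁ Ω₂) (M.outerPart D Ω₁)
  smooth_lateral : IsSmoothBoundaryPiece (M.annulus Ω₁ Ω₂) (M.lateralPart D Ω₁ Ω₂)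
  smooth_inner : IsSmoothBoundaryPiece (M.annulus Ω₁ Ω₂) (M.innerPart D Ω₂)
  edge_outer : IsSmoothSubmanifold 2 (M.edge (M.outerPart D Ω₁))
  edge_inner : IsSmoothSubmanifold 2 (M.edge (M.innerPart D Ω₂))
  edge_lateral : M.edge (M.lateralPart D Ω₁ Ω₂) =
    M.edge (M.outerPart D Ω₁) ∪ M.edge (M.innerPart D Ω₂)

end ModelSpace

/-! Multiplying `X` by the volume density makes the statement Euclidean. For `Y = √(det g) • X`, the
density times `div X` is the Euclidean divergence of `Y`, and the area density times `⟨X, ν⟩` is the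
Euclidean normal component of `Y`: the dual norm of the Euclidean conormal enters the area element
as a factor and the normalization of `ν` as a divisor, and cancels
(`areaDensity_mul_normalComponent`).

The Euclidean identity is first proved for `ζ • Y`, where the support of the cutoff `ζ` meets the
closure of `Ω` only in `Ω` and its regular boundary (`hasCutoffDivergence_of_isBounded`). A
partition of unity reduces this to interior points, where a compactly supported divergence has
integral zero, and to charts that flatten the boundary. There the field, merely continuous up to the
boundary, is integrated by parts against functions of `φ / ε` vanishing near `{φ = 0}`. The
resulting averages over layers of thickness of order `ε` tend to the flux, by a change of variables
and the area formula (`IsFlatChart.divergence_theorem`).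

It remains to remove the cutoffs at the two edges and, if the radius is finite, at the antipode of
the pole. These sets have capacity zero. If sublevel sets `{s ≤ r}` have volume `O(r)` and `|∇s|² =
O(s)`, the average of `k + 1` steps in `s`, at scales forming a geometric sequence, has Dirichlet
integral `O(1 / (k + 1))`: the gradients of the steps have disjoint supports
(`tendsto_lintegral_sq_fderiv_dyadicCutoff`). Codimension two gives the volume bound at the edges,
and dimension at least two gives it at the antipode. Since `|X|` is in `L²`, Cauchy–Schwarz sends
the terms containing gradients of these cutoffs to zero.

The flux integrals of the cut-off fields therefore converge. One part of `⟨X, ν⟩`, positive or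
negative, is integrable by hypothesis; this bounds the other part through Fatou's lemma, and
dominated convergence gives the identity (`integrable_and_integral_eq_of_tendsto`). The edges are
treated first, with the antipode still cut off, because Euclidean and Riemannian lengths are
comparable only on compact parts of the coordinate ball; the antipode comes last. -/

/-! ### Comparison of measures and the area formula -/

open Filter Topology Module in
/-- A measure that is locally dominated by every multiple `c • ν`, `c > 1`, is dominated by `ν`. -/
theorem measure_le_of_locally_le_mul {α : Type*} [TopologicalSpace α] [SecondCountableTopology α]
    [MeasurableSpace α] [OpensMeasurableSpace α] {μ ν : Measure α}
    (h : ∀ c : NNReal, 1 < c → ∀ x, ∃ U ∈ 𝓝 x, ∀ B ⊆ U, MeasurableSet B → μ B ≤ c * ν B) :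
    μ ≤ ν := by
  refine Measure.le_iff.2 fun B hB => ?_
  have key : ∀ c : NNReal, 1 < c → μ B ≤ c * ν B := by
    intro c hc
    choose U hU hle using h c hc
    -- Second countability leaves countably many neighbourhoods. Made disjoint, they allow the local
    -- estimates to be summed; finally `c` decreases to `1`.
    obtain ⟨t, htc, htU⟩ := TopologicalSpace.countable_cover_nhds (fun x => interior_mem_nhds.2 (hU x))
    rcases t.eq_empty_or_nonempty with rfl | hne
    · have : B = ∅ := by
        have : (univ : Set α) = ∅ := by simpa using htU.symm
        exact eq_empty_of_subset_empty (this ▸ subset_univ B)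
      simp [this]
    obtain ⟨f, rfl⟩ := htc.exists_eq_range hne
    let V : ℕ → Set α := fun i => interior (U (f i))
    have hV : ⋃ i, V i = univ := by simpa [V] using htU
    have hVm : ∀ i, MeasurableSet (disjointed V i) :=
      fun i => MeasurableSet.disjointed (fun i => isOpen_interior.measurableSet) i
    have hB' : B = ⋃ i, B ∩ disjointed V i := by
      rw [← inter_iUnion, iUnion_disjointed, hV, inter_univ]
    have hdis : Pairwise (Function.onFun Disjoint fun i => B ∩ disjointed V i) := fun i j hij =>
      (disjoint_disjointed V hij).mono inter_subset_right inter_subset_right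
    rw [hB', measure_iUnion hdis fun i => hB.inter (hVm i),
      measure_iUnion hdis fun i => hB.inter (hVm i), ← ENNReal.tsum_mul_left]
    exact ENNReal.tsum_le_tsum fun i => hle _ _
      ((inter_subset_right.trans (disjointed_subset V i)).trans interior_subset) (hB.inter (hVm i))
  have hlim : Tendsto (fun c : NNReal => (c : ℝ≥0∞) * ν B) (𝓝[>] 1) (𝓝 (1 * ν B)) := by
    refine ENNReal.Tendsto.mul_const ?_ (Or.inl one_ne_zero)
    exact (ENNReal.continuous_coe.tendsto 1).mono_left nhdsWithin_le_nhds
  rw [one_mul] at hlim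
  exact ge_of_tendsto hlim (by filter_upwards [self_mem_nhdsWithin] with c hc using key c hc)

theorem LipschitzOnWith.euclideanHausdorffMeasure_image_le {X Y : Type*} [MetricSpace X]
    [MetricSpace Y] [MeasurableSpace X] [BorelSpace X] [MeasurableSpace Y] [BorelSpace Y]
    {f : X → Y} {s : Set X} {C : NNReal} (h : LipschitzOnWith C f s) (d : ℕ) :
    μHE[d] (f '' s) ≤ (C : ℝ≥0∞) ^ d * μHE[d] s := by
  simp only [Measure.euclideanHausdorffMeasure_def, Measure.smul_apply, ENNReal.smul_def,
    smul_eq_mul]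
  have := h.hausdorffMeasure_image_le (d := d) (Nat.cast_nonneg d)
  rw [ENNReal.rpow_natCast] at this
  calc _ ≤ _ := mul_le_mul_right this _
    _ = _ := by ring

section AreaFormula

open Filter Topology Module

variable {K E : Type*} [NormedAddCommGroup K] [InnerProductSpace ℝ K] [FiniteDimensional ℝ K]
  [NormedAddCommGroup E] [InnerProductSpace ℝ E]

/-- In an orthonormal basis `normDet` is the square root of a Gram determinant, which is continuous
in the map. -/
theorem continuous_normDet : Continuous fun A : K →L[ℝ] E => (A : K →ₗ[ℝ] E).normDet := by
  have h : (fun A : K →L[ℝ] E => (A : K →ₗ[ℝ] E).normDet) = fun A : K →L[ℝ] E =>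
      Real.sqrt (Matrix.gram ℝ fun i => A (stdOrthonormalBasis ℝ K i)).det := by
    funext A
    have := LinearMap.normDet_sq_eq_det_gram (A : K →ₗ[ℝ] E) (stdOrthonormalBasis ℝ K)
    rw [RCLike.ofReal_real_eq_id, id] at this
    exact (this ▸ Real.sqrt_sq (LinearMap.normDet_nonneg _)).symm
  rw [h]
  refine Real.continuous_sqrt.comp (Continuous.matrix_det ?_)
  refine continuous_matrix fun i j => ?_
  simp only [Matrix.gram_apply]
  fun_prop

variable [MeasurableSpace K] [BorelSpace K] [MeasurableSpace E] [BorelSpace E]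

/-- Since `A` is injective, near `x` the linearization error of `F` is small relative to `‖A y - A
z‖`. Hence `F ∘ A⁻¹` and `A ∘ F⁻¹` have Lipschitz constants close to `1`, which enter the Hausdorff
measure with the power `m`, and the measure of `A '' B` is known exactly. -/
theorem exists_nhds_hausdorffMeasure_image_comparison {F : K → E} {A : K →L[ℝ] E} {x : K}
    (hF : HasStrictFDerivAt F A x) (hA : Function.Injective A) {c : NNReal} (hc : 1 < c) :
    ∃ W ∈ 𝓝 x, ∀ B ⊆ W,
      μHE[finrank ℝ K] (F '' B) ≤ c * (ENNReal.ofReal (A : K →ₗ[ℝ] E).normDet * volume B) ∧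
      ENNReal.ofReal (A : K →ₗ[ℝ] E).normDet * volume B ≤ c * μHE[finrank ℝ K] (F '' B) := by
  obtain ⟨N, hN, hanti⟩ := (A : K →ₗ[ℝ] E).exists_antilipschitzWith (LinearMap.ker_eq_bot.2 hA)
  have hanti' : AntilipschitzWith N A := hanti
  set m := finrank ℝ K
  -- a small relative error
  obtain ⟨ε, hε0, hε1, hεc, hεc'⟩ : ∃ ε : ℝ, 0 < ε ∧ ε < 1 ∧ (1 + ε) ^ m ≤ c ∧
      ((1 - ε)⁻¹) ^ m ≤ (c : ℝ) := by
    have h1 : Tendsto (fun ε : ℝ => (1 + ε) ^ m) (𝓝[>] 0) (𝓝 1) := by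
      have : ContinuousAt (fun ε : ℝ => (1 + ε) ^ m) 0 := by fun_prop
      simpa using this.tendsto.mono_left nhdsWithin_le_nhds
    have h2 : Tendsto (fun ε : ℝ => ((1 - ε)⁻¹) ^ m) (𝓝[>] 0) (𝓝 1) := by
      have : ContinuousAt (fun ε : ℝ => ((1 - ε)⁻¹) ^ m) 0 := by
        fun_prop (disch := norm_num)
      simpa using this.tendsto.mono_left nhdsWithin_le_nhds
    have hc' : (1 : ℝ) < c := by exact_mod_cast hc
    have h3 : ∀ᶠ ε : ℝ in 𝓝[>] 0, ε < 1 := nhdsWithin_le_nhds (eventually_lt_nhds one_pos)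
    obtain ⟨ε, a, b, d, e⟩ := ((h1.eventually_le_const hc').and ((h2.eventually_le_const hc').and
      (h3.and self_mem_nhdsWithin))).exists
    exact ⟨ε, e, d, a, b⟩
  have hNpos : (0 : ℝ) < N := by exact_mod_cast hN
  -- `N` is an antilipschitz constant of `A`, so an error `(ε / N) ‖y - z‖` is at most `ε ‖A y - A
  -- z‖`.
  obtain ⟨W, hW, happ⟩ := hF.approximates_deriv_on_nhds
    (c := (ε / N).toNNReal)
    (Or.inr (Real.toNNReal_pos.2 (div_pos hε0 hNpos)))
  have hbound : ∀ y ∈ W, ∀ z ∈ W, ‖F y - F z - A (y - z)‖ ≤ ε * ‖A y - A z‖ := by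
    intro y hy z hz
    have h1 := happ y hy z hz
    rw [Real.coe_toNNReal _ (div_pos hε0 hNpos).le] at h1
    have h2 := hanti'.le_mul_dist y z
    rw [dist_eq_norm, dist_eq_norm] at h2
    calc _ ≤ ε / N * ‖y - z‖ := h1
      _ ≤ ε / N * (N * ‖A y - A z‖) := by gcongr
      _ = _ := by field_simp
  have hup : ∀ y ∈ W, ∀ z ∈ W, ‖F y - F z‖ ≤ (1 + ε) * ‖A y - A z‖ := by
    intro y hy z hz
    have := hbound y hy z hz
    have h3 := norm_le_norm_add_norm_sub' (F y - F z) (A (y - z))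
    rw [map_sub] at *
    linarith
  have hlow : ∀ y ∈ W, ∀ z ∈ W, ‖A y - A z‖ ≤ (1 - ε)⁻¹ * ‖F y - F z‖ := by
    intro y hy z hz
    have := hbound y hy z hz
    have h3 := norm_le_norm_add_norm_sub (F y - F z) (A (y - z))
    rw [map_sub] at *
    rw [inv_mul_eq_div, le_div_iff₀ (by linarith)]
    linarith
  refine ⟨W, hW, fun B hB => ?_⟩
  have hAB : μHE[m] (A '' B) = ENNReal.ofReal (A : K →ₗ[ℝ] E).normDet * volume B :=
    LinearMap.euclideanHausdorffMeasure_image_eq_normDet_mul_volume (A : K →ₗ[ℝ] E) B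
  have hFW : InjOn F W := by
    intro y hy z hz h
    have := hlow y hy z hz
    rw [h, sub_self, norm_zero, mul_zero] at this
    exact hA (sub_eq_zero.1 (norm_le_zero_iff.1 this))
  rw [← hAB]
  constructor
  · let g : E → E := F ∘ Function.invFunOn A B
    have hg : ∀ y ∈ B, g (A y) = F y := fun y hy => by
      have := hA.injOn.leftInvOn_invFunOn (s := B) hy
      simp [g, this]
    have hgl : LipschitzOnWith (1 + ε).toNNReal g (A '' B) := by
      refine LipschitzOnWith.of_dist_le_mul ?_
      rintro _ ⟨y, hy, rfl⟩ _ ⟨z, hz, rfl⟩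
      rw [hg y hy, hg z hz, dist_eq_norm, dist_eq_norm]
      rw [Real.coe_toNNReal _ (by positivity)]
      exact hup y (hB hy) z (hB hz)
    have him : g '' (A '' B) = F '' B := by
      rw [image_image]; exact image_congr hg
    rw [← him]
    refine (hgl.euclideanHausdorffMeasure_image_le m).trans ?_
    gcongr
    rw [← ENNReal.coe_pow, ENNReal.coe_le_coe, ← NNReal.coe_le_coe, NNReal.coe_pow,
      Real.coe_toNNReal _ (by positivity)]
    exact hεc
  · let g : E → E := A ∘ Function.invFunOn F B
    have hg : ∀ y ∈ B, g (F y) = A y := fun y hy => by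
      have := (hFW.mono hB).leftInvOn_invFunOn hy
      simp [g, this]
    have hpos : 0 ≤ (1 - ε)⁻¹ := inv_nonneg.2 (by linarith)
    have hgl : LipschitzOnWith ((1 - ε)⁻¹).toNNReal g (F '' B) := by
      refine LipschitzOnWith.of_dist_le_mul ?_
      rintro _ ⟨y, hy, rfl⟩ _ ⟨z, hz, rfl⟩
      rw [hg y hy, hg z hz, dist_eq_norm, dist_eq_norm]
      rw [Real.coe_toNNReal _ hpos]
      exact hlow y (hB hy) z (hB hz)
    have him : g '' (F '' B) = A '' B := by
      rw [image_image]; exact image_congr hg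
    rw [← him]
    refine (hgl.euclideanHausdorffMeasure_image_le m).trans ?_
    gcongr
    rw [← ENNReal.coe_pow, ENNReal.coe_le_coe, ← NNReal.coe_le_coe, NNReal.coe_pow,
      Real.coe_toNNReal _ hpos]
    exact hεc'

/-- **Area formula** for an injective immersion of class `C¹`. -/
theorem euclideanHausdorffMeasure_image_eq_lintegral_normDet {F : K → E} {s : Set K}
    (hs : IsOpen s) (hF : ContDiffOn ℝ 1 F s) (hinj : InjOn F s)
    (hF' : ∀ x ∈ s, Function.Injective (fderiv ℝ F x)) {B : Set K} (hB : MeasurableSet B)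
    (hBs : B ⊆ s) :
    μHE[finrank ℝ K] (F '' B) =
      ∫⁻ x in B, ENNReal.ofReal (fderiv ℝ F x : K →ₗ[ℝ] E).normDet := by
  set J : K → ℝ := fun x => (fderiv ℝ F x : K →ₗ[ℝ] E).normDet
  have hJc : ContinuousOn J s :=
    continuous_normDet.comp_continuousOn (hF.continuousOn_fderiv_of_isOpen hs le_rfl)
  have hJpos : ∀ x ∈ s, 0 < J x := fun x hx => by
    refine lt_of_le_of_ne (LinearMap.normDet_nonneg _) (Ne.symm ?_)
    exact fun h => LinearMap.normDet_eq_zero_iff_ker_ne_bot.1 h (LinearMap.ker_eq_bot.2 (hF' x hx))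
  have hsm : MeasurableSet s := hs.measurableSet
  have hemb : MeasurableEmbedding (s.domRestrict F) :=
    hF.continuousOn.measurableEmbedding hsm hinj
  -- Both sides of the formula become measures on the subtype `s`, to be compared locally in both
  -- directions.
  let μ : Measure s := Measure.comap (s.domRestrict F) μHE[finrank ℝ K]
  let ν : Measure s := Measure.comap (↑) ((volume : Measure K).withDensity
    fun x => ENNReal.ofReal (J x))
  have hμ : ∀ C : Set s, MeasurableSet C → μ C = μHE[finrank ℝ K] (F '' ((↑) '' C)) := by
    intro C hC
    rw [hemb.comap_apply, image_image]; rfl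
  have hν : ∀ C : Set s, MeasurableSet C →
      ν C = ∫⁻ x in (↑) '' C, ENNReal.ofReal (J x) := by
    intro C hC
    rw [(MeasurableEmbedding.subtype_coe hsm).comap_apply, withDensity_apply]
    exact (MeasurableEmbedding.subtype_coe hsm).measurableSet_image.2 hC
  have key : ∀ c : NNReal, 1 < c → ∀ x : s, ∃ U ∈ 𝓝 x, ∀ C ⊆ U, MeasurableSet C →
      μ C ≤ c * ν C ∧ ν C ≤ c * μ C := by
    intro c hc x
    -- One factor `b` pays for the linearization of `F`, the other for the oscillation of the
    -- Jacobian.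
    obtain ⟨b, hb1, hbc⟩ : ∃ b : NNReal, 1 < b ∧ b * b ≤ c := by
      refine ⟨NNReal.sqrt c, ?_, (NNReal.mul_self_sqrt c).le⟩
      rw [← NNReal.sqrt_one]; exact NNReal.sqrt_lt_sqrt.2 hc
    have hb1' : (1 : ℝ) < b := by exact_mod_cast hb1
    have hx0 := hJpos x x.2
    obtain ⟨W, hW, hWc⟩ := exists_nhds_hausdorffMeasure_image_comparison
      ((hF.contDiffAt (hs.mem_nhds x.2)).hasStrictFDerivAt one_ne_zero) (hF' x x.2) hb1
    have hJx : ContinuousAt J x := hJc.continuousAt (hs.mem_nhds x.2)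
    have hV : ∀ᶠ y in 𝓝 (x : K), J x ≤ b * J y ∧ J y ≤ b * J x := by
      have h1 : ∀ᶠ y in 𝓝 (x : K), J x < b * J y :=
        (hJx.const_mul (b : ℝ)).eventually_const_lt (by nlinarith)
      have h2 : ∀ᶠ y in 𝓝 (x : K), J y < b * J x := hJx.eventually_lt_const (by nlinarith)
      filter_upwards [h1, h2] with y h1 h2 using ⟨h1.le, h2.le⟩
    refine ⟨(↑) ⁻¹' (W ∩ {y | J x ≤ b * J y ∧ J y ≤ b * J x}),
      preimage_coe_mem_nhds_subtype.2 (mem_nhdsWithin_of_mem_nhds (inter_mem hW hV)),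
      fun C hC hCm => ?_⟩
    set D : Set K := (↑) '' C
    have hDm : MeasurableSet D := (MeasurableEmbedding.subtype_coe hsm).measurableSet_image.2 hCm
    have hD : D ⊆ W ∩ {y | J x ≤ b * J y ∧ J y ≤ b * J x} := by
      rintro _ ⟨y, hy, rfl⟩; exact hC hy
    obtain ⟨h1, h2⟩ := hWc D (hD.trans inter_subset_left)
    have e1 : ENNReal.ofReal (J x) * volume D ≤ b * ∫⁻ y in D, ENNReal.ofReal (J y) := by
      rw [← setLIntegral_const, ← lintegral_const_mul' _ _ ENNReal.coe_ne_top]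
      refine setLIntegral_mono' hDm fun y hy => ?_
      rw [← ENNReal.ofReal_coe_nnreal, ← ENNReal.ofReal_mul b.coe_nonneg]
      exact ENNReal.ofReal_le_ofReal (hD hy).2.1
    have e2 : ∫⁻ y in D, ENNReal.ofReal (J y) ≤ b * (ENNReal.ofReal (J x) * volume D) := by
      rw [← mul_assoc, ← setLIntegral_const]
      refine setLIntegral_mono' hDm fun y hy => ?_
      rw [← ENNReal.ofReal_coe_nnreal, ← ENNReal.ofReal_mul b.coe_nonneg]
      exact ENNReal.ofReal_le_ofReal (hD hy).2.2
    have hbc' : (b : ℝ≥0∞) * b ≤ c := by exact_mod_cast hbc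
    rw [hμ C hCm, hν C hCm]
    constructor
    · calc _ ≤ _ := h1
        _ ≤ b * (b * ∫⁻ y in D, ENNReal.ofReal (J y)) := by gcongr
        _ ≤ _ := by rw [← mul_assoc]; gcongr
    · calc _ ≤ _ := e2
        _ ≤ b * (b * μHE[finrank ℝ K] (F '' D)) := by gcongr
        _ ≤ _ := by rw [← mul_assoc]; gcongr
  have hμν : μ = ν := by
    refine le_antisymm (measure_le_of_locally_le_mul fun c hc x => ?_)
      (measure_le_of_locally_le_mul fun c hc x => ?_)
    · obtain ⟨U, hU, h⟩ := key c hc x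
      exact ⟨U, hU, fun C hC hCm => (h C hC hCm).1⟩
    · obtain ⟨U, hU, h⟩ := key c hc x
      exact ⟨U, hU, fun C hC hCm => (h C hC hCm).2⟩
  have hBm : MeasurableSet ((↑) ⁻¹' B : Set s) := measurable_subtype_coe hB
  have := congrArg (fun m : Measure s => m ((↑) ⁻¹' B)) hμν
  simp only [hμ _ hBm, hν _ hBm] at this
  rwa [Subtype.image_preimage_coe, inter_eq_self_of_subset_right hBs] at this

end AreaFormula

/-! ### Volume distortion of a linear map on a hyperplane -/

section NormDet

open Module

variable {E : Type*} [NormedAddCommGroup E] [InnerProductSpace ℝ E] [FiniteDimensional ℝ E]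

/-- If the functional `ℓ` is pulled back by `T` to the inner product with the unit vector `u`, then
`T` changes the volume of the hyperplane `uᗮ` by the factor `|det T| * ‖ℓ‖`. -/
theorem normDet_comp_subtype_orthogonal {T : E →ₗ[ℝ] E} {u w : E} (hu : ‖u‖ = 1) (hw : w ≠ 0)
    (h : ∀ v, inner ℝ w (T v) = inner ℝ u v) :
    (T ∘ₗ (ℝ ∙ u)ᗮ.subtype).normDet = |LinearMap.det T| * ‖w‖ := by
  have hw0 : 0 < ‖w‖ := norm_pos_iff.2 hw
  set n : E := ‖w‖⁻¹ • w
  have hn : ‖n‖ = ‖u‖ := by rw [hu, norm_smul, norm_inv, norm_norm, inv_mul_cancel₀ hw0.ne']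
  -- The reflection turns the normal of the image hyperplane back to `u`. So `S = R ∘ T` preserves
  -- `uᗮ` and acts on the one-dimensional quotient as `‖w‖⁻¹`; the determinant of `S` is the product
  -- of the two.
  set R : E ≃ₗᵢ[ℝ] E := (ℝ ∙ (n - u))ᗮ.reflection
  have hR : R n = u := Submodule.reflection_sub hn
  have hRinner : ∀ v, inner ℝ u (R v) = ‖w‖⁻¹ * inner ℝ w v := fun v => by
    rw [← hR, R.inner_map_map, real_inner_smul_left]
  set S : E →ₗ[ℝ] E := R.toLinearEquiv.toLinearMap ∘ₗ T
  have hS : ∀ v, inner ℝ u (S v) = ‖w‖⁻¹ * inner ℝ u v := fun v => by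
    rw [← h v]; exact hRinner _
  have hmem : ∀ v, v ∈ (ℝ ∙ u)ᗮ ↔ inner ℝ u v = 0 := fun v =>
    Submodule.mem_orthogonal_singleton_iff_inner_right
  have hinv : (ℝ ∙ u)ᗮ ≤ (ℝ ∙ u)ᗮ.comap S := fun v hv => by
    rw [Submodule.mem_comap, hmem, hS, (hmem v).1 hv, mul_zero]
  have hdet := LinearMap.det_eq_det_mul_det (ℝ ∙ u)ᗮ S hinv
  have hquot : (ℝ ∙ u)ᗮ.mapQ (ℝ ∙ u)ᗮ S hinv = ‖w‖⁻¹ • LinearMap.id := by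
    refine LinearMap.ext fun q => ?_
    obtain ⟨v, rfl⟩ := Submodule.Quotient.mk_surjective _ q
    rw [Submodule.mapQ_apply, LinearMap.smul_apply, LinearMap.id_apply, ← Submodule.Quotient.mk_smul,
      Submodule.Quotient.eq, hmem, inner_sub_right, hS, inner_smul_right, sub_self]
  have hu0 : u ≠ 0 := by rintro rfl; simp at hu
  have hrank : finrank ℝ (E ⧸ (ℝ ∙ u)ᗮ) = 1 := by
    have h1 := Submodule.finrank_quotient_add_finrank (ℝ ∙ u)ᗮ
    have h2 := Submodule.finrank_add_finrank_orthogonal (ℝ ∙ u)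
    rw [finrank_span_singleton hu0] at h2
    omega
  rw [hquot, LinearMap.det_smul, hrank, LinearMap.det_id, pow_one, mul_one] at hdet
  have hdetS : |LinearMap.det S| = |LinearMap.det T| := by
    rw [← LinearMap.normDet_eq_abs_det, ← LinearMap.normDet_eq_abs_det,
      LinearMap.normDet_comp_of_finrank_eq _ _ rfl]
    have : R.toLinearEquiv.toLinearMap.normDet = 1 := R.toLinearIsometry.normDet_eq_one
    rw [this, one_mul]
  have h1 : (T ∘ₗ (ℝ ∙ u)ᗮ.subtype).normDet = (S ∘ₗ (ℝ ∙ u)ᗮ.subtype).normDet := by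
    have : S ∘ₗ (ℝ ∙ u)ᗮ.subtype = R.toLinearEquiv.toLinearMap ∘ₗ (T ∘ₗ (ℝ ∙ u)ᗮ.subtype) := rfl
    rw [this, LinearMap.normDet_comp (T ∘ₗ (ℝ ∙ u)ᗮ.subtype)]
    have : (R.toLinearEquiv.toLinearMap.domRestrict
        (LinearMap.range (T ∘ₗ (ℝ ∙ u)ᗮ.subtype))).normDet = 1 :=
      (R.toLinearIsometry.comp
        (LinearMap.range (T ∘ₗ (ℝ ∙ u)ᗮ.subtype)).subtypeₗᵢ).normDet_eq_one
    rw [this, one_mul]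
  have h3 : (S ∘ₗ (ℝ ∙ u)ᗮ.subtype).normDet = |LinearMap.det (S.restrict hinv)| := by
    rw [← LinearMap.normDet_eq_abs_det]
    exact (LinearMap.normDet_codRestrict (f := S ∘ₗ (ℝ ∙ u)ᗮ.subtype) fun c =>
      Submodule.mem_comap.1 (hinv c.2)).symm
  rw [h1, h3, ← hdetS, hdet, abs_mul, abs_of_pos (inv_pos.2 hw0), inv_mul_cancel_right₀ hw0.ne']

end NormDet

/-! ### Averages over thin layers at a hyperplane -/

section Layer

open Filter Topology Module

variable {E : Type*} [NormedAddCommGroup E] [InnerProductSpace ℝ E] [FiniteDimensional ℝ E]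
  [MeasurableSpace E] [BorelSpace E]

theorem measurePreserving_smul_add_orthogonal {u : E} (hu : ‖u‖ = 1) :
    MeasurePreserving (fun q : ℝ × (ℝ ∙ u)ᗮ => q.1 • u + (q.2 : E)) := by
  have h1 := ((ℝ ∙ u).measurePreserving_measurableEquivProd (0 : E)).symm
  rw [InnerProductSpace.euclideanHausdorffMeasure_eq_volume] at h1
  have h2 : MeasurePreserving (LinearIsometryEquiv.toSpanUnitSingleton u hu : ℝ → ℝ ∙ u) :=
    (LinearIsometryEquiv.toSpanUnitSingleton u hu).measurePreserving
  have h3 := h1.comp (h2.prod (MeasurePreserving.id (volume : Measure (ℝ ∙ u)ᗮ)))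
  convert! h3 using 1
  funext q
  simp

/-- Fubini along `u`, with the depth measured in units of `ε`. The minus sign makes positive depth
point to the negative side of the hyperplane. -/
theorem integral_eq_mul_integral_orthogonal {u : E} (hu : ‖u‖ = 1) {ε : ℝ} (hε : 0 < ε)
    (g : E → ℝ) :
    ∫ y, g y = ε * ∫ q : ℝ × (ℝ ∙ u)ᗮ, g ((q.2 : E) - (ε * q.1) • u) := by
  have h1 := measurePreserving_smul_add_orthogonal hu
  have hemb : MeasurableEmbedding (fun q : ℝ × (ℝ ∙ u)ᗮ => q.1 • u + (q.2 : E)) := by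
    refine Continuous.measurableEmbedding (by fun_prop) ?_
    rintro ⟨t, z⟩ ⟨t', z'⟩ h
    simp only at h
    have hz : ∀ z : (ℝ ∙ u)ᗮ, inner ℝ u (z : E) = 0 := fun z =>
      Submodule.mem_orthogonal_singleton_iff_inner_right.1 z.2
    have ht : t = t' := by
      have := congrArg (inner ℝ u) h
      simpa [inner_add_right, inner_smul_right, hz, hu] using this
    subst ht
    simpa using h
  rw [← h1.integral_comp hemb]
  let s : ℝ ≃ᵐ ℝ := (Homeomorph.mulLeft₀ (-ε) (neg_ne_zero.2 hε.ne')).toMeasurableEquiv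
  have hvol : (volume : Measure (ℝ × (ℝ ∙ u)ᗮ)) =
      ENNReal.ofReal ε • Measure.map (Prod.map s id) volume := by
    have h2 : ENNReal.ofReal ε • Measure.map s volume = volume := by
      have := Real.smul_map_volume_mul_left (a := -ε) (neg_ne_zero.2 hε.ne')
      rwa [abs_neg, abs_of_pos hε] at this
    rw [Measure.volume_eq_prod, ← Measure.map_prod_map _ _ s.measurable measurable_id,
      Measure.map_id, ← Measure.prod_smul_left, h2]
  have h4 := congrArg (fun m : Measure (ℝ × (ℝ ∙ u)ᗮ) => ∫ q, g (q.1 • u + (q.2 : E)) ∂m) hvol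
  refine Eq.trans h4 ?_
  rw [integral_smul_measure, ENNReal.toReal_ofReal hε.le, smul_eq_mul]
  congr 1
  have : MeasurableEmbedding (Prod.map s (id : (ℝ ∙ u)ᗮ → (ℝ ∙ u)ᗮ)) :=
    s.measurableEmbedding.prodMap MeasurableEmbedding.id
  rw [this.integral_map]
  refine integral_congr_ae (ae_of_all _ fun q => ?_)
  change g ((-ε * q.1) • u + (q.2 : E)) = _
  congr 1
  rw [neg_mul, neg_smul]; abel

/-- Averages of `κ` over thin layers on the negative side of a hyperplane converge to the integral
over the hyperplane. -/
theorem tendsto_integral_layer {u : E} (hu : ‖u‖ = 1) {η : ℝ → ℝ} (hη : Continuous η)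
    (hη0 : ∀ τ ∉ Icc (1 : ℝ) 2, η τ = 0) (hη1 : ∫ τ, η τ = 1) {κ : E → ℝ} (hκm : Measurable κ)
    {C ρ : ℝ} (hκC : ∀ y, |κ y| ≤ C) (hκρ : ∀ y, ρ < ‖y‖ → κ y = 0)
    (hκ : ∀ z ∈ (ℝ ∙ u)ᗮ, Tendsto (fun t : ℝ => κ (z - t • u)) (𝓝[>] 0) (𝓝 (κ z))) :
    Tendsto (fun ε : ℝ => ∫ y, ε⁻¹ * η (-(inner ℝ u y) / ε) * κ y) (𝓝[>] 0)
      (𝓝 (∫ z : (ℝ ∙ u)ᗮ, κ z)) := by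
  have hz : ∀ z : (ℝ ∙ u)ᗮ, inner ℝ u (z : E) = 0 := fun z =>
    Submodule.mem_orthogonal_singleton_iff_inner_right.1 z.2
  have hηc : HasCompactSupport η := HasCompactSupport.intro isCompact_Icc hη0
  have hlim : ∫ z : (ℝ ∙ u)ᗮ, κ z = ∫ q : ℝ × (ℝ ∙ u)ᗮ, η q.1 * κ q.2 := by
    rw [Measure.volume_eq_prod, integral_prod_mul η fun z : (ℝ ∙ u)ᗮ => κ z, hη1, one_mul]
  have hC : 0 ≤ C := (abs_nonneg _).trans (hκC 0)
  rw [hlim]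
  -- In the rescaled depth the layer no longer depends on `ε`. The bound is `C` on the ball of
  -- radius `ρ` in the hyperplane: a normal component only increases the norm, so `κ` vanishes when
  -- the tangential part leaves that ball.
  have hmain : Tendsto (fun ε : ℝ => ∫ q : ℝ × (ℝ ∙ u)ᗮ, η q.1 * κ ((q.2 : E) - (ε * q.1) • u))
      (𝓝[>] 0) (𝓝 (∫ q : ℝ × (ℝ ∙ u)ᗮ, η q.1 * κ q.2)) := by
    refine tendsto_integral_filter_of_dominated_convergence
      (fun q => |η q.1| * (Metric.closedBall (0 : (ℝ ∙ u)ᗮ) ρ).indicator (fun _ => C) q.2) ?_ ?_ ?_ ?_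
    · refine Eventually.of_forall fun ε => Measurable.aestronglyMeasurable ?_
      exact (hη.measurable.comp measurable_fst).mul (hκm.comp (by fun_prop))
    · refine Eventually.of_forall fun ε => ae_of_all _ fun q => ?_
      rw [norm_mul, Real.norm_eq_abs, Real.norm_eq_abs]
      gcongr
      by_cases hq : q.2 ∈ Metric.closedBall (0 : (ℝ ∙ u)ᗮ) ρ
      · rw [indicator_of_mem hq]; exact hκC _
      · rw [indicator_of_notMem hq, hκρ, abs_zero]
        rw [mem_closedBall_zero_iff, not_le] at hq
        refine hq.trans_le ?_
        have h1 : ‖(q.2 : E) - (ε * q.1) • u‖ ^ 2 = ‖(q.2 : E)‖ ^ 2 + ‖(ε * q.1) • u‖ ^ 2 := by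
          rw [norm_sub_sq_real, inner_smul_right, real_inner_comm, hz]; ring
        rw [Submodule.coe_norm]
        nlinarith [norm_nonneg ((q.2 : E) - (ε * q.1) • u), norm_nonneg (q.2 : E),
          sq_nonneg ‖(ε * q.1) • u‖]
    · refine Integrable.mul_prod (f := fun τ => |η τ|)
        (g := (Metric.closedBall (0 : (ℝ ∙ u)ᗮ) ρ).indicator fun _ => C) ?_ ?_
      · exact (hη.integrable_of_hasCompactSupport hηc).abs
      · exact (integrable_indicator_iff Metric.isClosed_closedBall.measurableSet).2
          (integrableOn_const (measure_closedBall_lt_top.ne))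
    · refine ae_of_all _ fun q => ?_
      by_cases hq : q.1 ∈ Icc (1 : ℝ) 2
      · refine Tendsto.const_mul _ ((hκ _ q.2.2).comp ?_)
        have hq1 : 0 < q.1 := by linarith [hq.1]
        refine tendsto_nhdsWithin_iff.2 ⟨?_, ?_⟩
        · have : Tendsto (fun ε : ℝ => ε * q.1) (𝓝 0) (𝓝 (0 * q.1)) :=
            (continuous_id.mul continuous_const).tendsto 0
          rw [zero_mul] at this
          exact this.mono_left nhdsWithin_le_nhds
        · filter_upwards [self_mem_nhdsWithin] with ε hε using mul_pos hε hq1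
      · simp [hη0 _ hq]
  refine hmain.congr' ?_
  filter_upwards [self_mem_nhdsWithin] with ε hε
  have hε : 0 < ε := hε
  rw [integral_eq_mul_integral_orthogonal hu hε, ← integral_const_mul]
  refine integral_congr_ae (ae_of_all _ fun q => ?_)
  have : inner ℝ u ((q.2 : E) - (ε * q.1) • u) = -(ε * q.1) := by
    rw [inner_sub_right, hz, inner_smul_right, real_inner_self_eq_norm_sq, hu]; ring
  simp only [this, neg_neg]
  rw [mul_div_cancel_left₀ _ hε.ne']
  field_simp

end Layer

/-! ### The area formula for integrals -/

section AreaIntegral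

open Filter Topology Module

variable {K E : Type*} [NormedAddCommGroup K] [InnerProductSpace ℝ K] [FiniteDimensional ℝ K]
  [NormedAddCommGroup E] [InnerProductSpace ℝ E]
  [MeasurableSpace K] [BorelSpace K] [MeasurableSpace E] [BorelSpace E]

/-- **Area formula** for integrals over the image of an injective immersion of class `C¹`. -/
theorem integrableOn_image_iff_and_integral_image_eq {F : K → E} {s : Set K}
    (hs : IsOpen s) (hF : ContDiffOn ℝ 1 F s) (hinj : InjOn F s)
    (hF' : ∀ x ∈ s, Function.Injective (fderiv ℝ F x)) (g : E → ℝ) :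
    (IntegrableOn g (F '' s) μHE[finrank ℝ K] ↔
      IntegrableOn (fun z => (fderiv ℝ F z : K →ₗ[ℝ] E).normDet * g (F z)) s) ∧
    ∫ x in F '' s, g x ∂μHE[finrank ℝ K] =
      ∫ z in s, (fderiv ℝ F z : K →ₗ[ℝ] E).normDet * g (F z) := by
  set J : K → ℝ := fun x => (fderiv ℝ F x : K →ₗ[ℝ] E).normDet
  have hJc : ContinuousOn J s :=
    continuous_normDet.comp_continuousOn (hF.continuousOn_fderiv_of_isOpen hs le_rfl)
  have hsm : MeasurableSet s := hs.measurableSet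
  have hsub := MeasurableEmbedding.subtype_coe hsm
  have hemb : MeasurableEmbedding (s.domRestrict F) :=
    hF.continuousOn.measurableEmbedding hsm hinj
  let j : s → NNReal := fun z => (J z).toNNReal
  have hj : Measurable j := (continuous_real_toNNReal.comp hJc.domRestrict).measurable
  let ν : Measure s := (Measure.comap (↑) (volume : Measure K)).withDensity fun z => (j z : ℝ≥0∞)
  -- Surface measure on the image is the push-forward of Lebesgue measure weighted by the Jacobian,
  -- so both claims reduce to change of variables for measures.
  have hν : μHE[finrank ℝ K].restrict (F '' s) = Measure.map (s.domRestrict F) ν := by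
    ext B hB
    have hB' : MeasurableSet (s.domRestrict F ⁻¹' B) := hemb.measurable hB
    rw [Measure.restrict_apply hB, Measure.map_apply hemb.measurable hB, withDensity_apply _ hB']
    have h1 : B ∩ F '' s = F '' ((↑) '' (s.domRestrict F ⁻¹' B)) := by
      ext y; constructor
      · rintro ⟨hy, x, hx, rfl⟩; exact ⟨x, ⟨⟨x, hx⟩, hy, rfl⟩, rfl⟩
      · rintro ⟨_, ⟨x, hx, rfl⟩, rfl⟩; exact ⟨hx, x, x.2, rfl⟩
    rw [h1, euclideanHausdorffMeasure_image_eq_lintegral_normDet hs hF hinj hF'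
      (hsub.measurableSet_image.2 hB') (by rintro _ ⟨x, -, rfl⟩; exact x.2)]
    have h2 : ((↑) '' (s.domRestrict F ⁻¹' B) : Set K) ⊆ s := by rintro _ ⟨x, -, rfl⟩; exact x.2
    rw [← Measure.restrict_restrict_of_subset h2, ← map_comap_subtype_coe hsm, hsub.restrict_map,
      hsub.lintegral_map, preimage_image_eq _ Subtype.val_injective]
    rfl
  have hsmul : ∀ z : s, j z • g (F z) = J z * g (F z) := fun z => by
    simp [j, NNReal.smul_def, Real.coe_toNNReal _ (LinearMap.normDet_nonneg _), J]
  constructor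
  · rw [IntegrableOn, hν, hemb.integrable_map_iff, integrable_withDensity_iff_integrable_smul hj,
      IntegrableOn, ← map_comap_subtype_coe hsm, hsub.integrable_map_iff]
    exact integrable_congr (ae_of_all _ hsmul)
  · rw [hν, hemb.integral_map, integral_withDensity_eq_integral_smul hj]
    rw [← integral_subtype_comap hsm]
    exact integral_congr_ae (ae_of_all _ hsmul)

end AreaIntegral

/-! ### Charts that flatten a level set -/

section FlatChart

open Filter Topology Module

variable {E : Type*} [NormedAddCommGroup E] [InnerProductSpace ℝ E]

/-- `e` straightens the function `φ`: in the chart `e` it is the inner product with the unit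
vector `u`. -/
structure IsFlatChart (φ : E → ℝ) (u : E) (e : OpenPartialHomeomorph E E) : Prop where
  norm_eq_one : ‖u‖ = 1
  inner_eq : ∀ x ∈ e.source, inner ℝ u (e x) = φ x
  contDiffOn : ContDiffOn ℝ 1 φ e.source
  contDiffOn_symm : ContDiffOn ℝ 1 e.symm e.target
  injective_fderiv : ∀ y ∈ e.target, Function.Injective (fderiv ℝ e.symm y)

/-- With `u` the normalized gradient at `p`, the map `x ↦ x + (φ x - ⟨u, x⟩) • u` replaces the
`u`-coordinate by `φ`. Its derivative is a rank-one perturbation of the identity, injective wherever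
the derivative of `φ` along `u` is nonzero. Restricting the source to points where this derivative
is positive makes the inverse `C¹` on the whole target. -/
theorem exists_isFlatChart [FiniteDimensional ℝ E] {φ : E → ℝ} {U : Set E} (hU : IsOpen U)
    (hφ : ContDiffOn ℝ 1 φ U)
    {p : E} (hp : p ∈ U) (hφ' : fderiv ℝ φ p ≠ 0) :
    ∃ (u : E) (e : OpenPartialHomeomorph E E), IsFlatChart φ u e ∧ p ∈ e.source ∧ e.source ⊆ U := by
  set g : E := (InnerProductSpace.toDual ℝ E).symm (fderiv ℝ φ p)
  have hg : ∀ v, inner ℝ g v = fderiv ℝ φ p v := fun v => by simp [g]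
  have hg0 : g ≠ 0 := by simpa [g] using hφ'
  have hgpos : 0 < ‖g‖ := norm_pos_iff.2 hg0
  set u : E := ‖g‖⁻¹ • g
  have hu : ‖u‖ = 1 := by rw [norm_smul, norm_inv, norm_norm, inv_mul_cancel₀ hgpos.ne']
  have hpu : 0 < fderiv ℝ φ p u := by
    rw [← hg, inner_smul_right, real_inner_self_eq_norm_sq]; positivity
  set Ψ : E → E := fun x => x + (φ x - inner ℝ u x) • u
  have hΨ : ContDiffOn ℝ 1 Ψ U := by
    refine contDiffOn_id.add ((hφ.sub ?_).smul contDiffOn_const)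
    exact (contDiff_const.inner ℝ contDiff_id).contDiffOn
  set T : E → E →L[ℝ] E := fun x =>
    ContinuousLinearMap.id ℝ E + (fderiv ℝ φ x - innerSL ℝ u).smulRight u
  have hT : ∀ x ∈ U, HasFDerivAt Ψ (T x) x := fun x hx => by
    have h1 := ((hφ.contDiffAt (hU.mem_nhds hx)).differentiableAt one_ne_zero).hasFDerivAt
    exact (hasFDerivAt_id x).add ((h1.sub (innerSL ℝ u).hasFDerivAt).smul_const u)
  have hTinj : ∀ x, fderiv ℝ φ x u ≠ 0 → Function.Injective (T x) := by
    intro x hx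
    refine (injective_iff_map_eq_zero _).2 fun v hv => ?_
    have h1 : v + (fderiv ℝ φ x v - inner ℝ u v) • u = 0 := by simpa [T] using hv
    have h2 : v = (-(fderiv ℝ φ x v - inner ℝ u v)) • u := by
      rw [neg_smul]; exact eq_neg_of_add_eq_zero_left h1
    set c := -(fderiv ℝ φ x v - inner ℝ u v)
    have h3 : inner ℝ u v = c := by
      rw [h2, inner_smul_right, real_inner_self_eq_norm_sq, hu]; ring
    have h4 : fderiv ℝ φ x v = c * fderiv ℝ φ x u := by rw [h2, map_smul, smul_eq_mul]
    have h5 : c * fderiv ℝ φ x u = 0 := by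
      have : c = -(fderiv ℝ φ x v - inner ℝ u v) := rfl
      rw [h3, h4] at this; linarith
    rw [h2, (mul_eq_zero.1 h5).resolve_right hx, zero_smul]
  set Te : ∀ x, fderiv ℝ φ x u ≠ 0 → E ≃L[ℝ] E := fun x hx =>
    (LinearEquiv.ofInjectiveEndo (T x : E →ₗ[ℝ] E) (hTinj x hx)).toContinuousLinearEquiv
  have hTe : ∀ x hx, ((Te x hx : E ≃L[ℝ] E) : E →L[ℝ] E) = T x := fun x hx => by
    ext v; rfl
  have hΨp : ContDiffAt ℝ 1 Ψ p := hΨ.contDiffAt (hU.mem_nhds hp)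
  have hTp : HasFDerivAt Ψ ((Te p hpu.ne' : E ≃L[ℝ] E) : E →L[ℝ] E) p := by
    rw [hTe _ hpu.ne']; exact hT p hp
  set e₀ := hΨp.toOpenPartialHomeomorph Ψ hTp one_ne_zero
  set W : Set E := U ∩ {x | 0 < fderiv ℝ φ x u}
  have hW : IsOpen W := by
    have : ContinuousOn (fun x => fderiv ℝ φ x u) U :=
      (hφ.continuousOn_fderiv_of_isOpen hU le_rfl).clm_apply continuousOn_const
    exact this.isOpen_inter_preimage hU isOpen_Ioi
  set e := e₀.restrOpen W hW
  have hesrc : e.source = e₀.source ∩ W := rfl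
  have hecoe : ∀ x, e x = Ψ x := fun x => rfl
  have hsymm : ∀ y ∈ e.target, ∃ hx : fderiv ℝ φ (e.symm y) u ≠ 0, HasFDerivAt e.symm
      (((Te _ hx).symm : E ≃L[ℝ] E) : E →L[ℝ] E) y ∧ ContDiffAt ℝ 1 e.symm y := by
    intro y hy
    have hx : e.symm y ∈ W := (e.map_target hy).2
    have hd : HasFDerivAt e ((Te _ hx.2.ne' : E ≃L[ℝ] E) : E →L[ℝ] E) (e.symm y) := by
      rw [hTe _ hx.2.ne']; exact hT _ hx.1
    exact ⟨hx.2.ne', e.hasFDerivAt_symm hy hd,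
      e.contDiffAt_symm hy hd (hΨ.contDiffAt (hU.mem_nhds hx.1))⟩
  refine ⟨u, e, ⟨hu, fun x hx => ?_, hφ.mono fun x hx => hx.2.1, fun y hy => ?_, fun y hy => ?_⟩,
    ⟨hΨp.mem_toOpenPartialHomeomorph_source hTp one_ne_zero, hp, hpu⟩, fun x hx => hx.2.1⟩
  · rw [hecoe, inner_add_right, inner_smul_right, real_inner_self_eq_norm_sq, hu]; ring
  · exact (hsymm y hy).choose_spec.2.contDiffWithinAt
  · rw [(hsymm y hy).choose_spec.1.fderiv]
    exact (Te _ (hsymm y hy).choose).symm.injective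

namespace IsFlatChart

variable {φ : E → ℝ} {u : E} {e : OpenPartialHomeomorph E E} (h : IsFlatChart φ u e)
include h

theorem fderiv_comp {y : E} (hy : y ∈ e.target) (v : E) :
    fderiv ℝ φ (e.symm y) (fderiv ℝ e.symm y v) = inner ℝ u v := by
  have hx := e.map_target hy
  have h1 := ((h.contDiffOn.contDiffAt (e.open_source.mem_nhds hx)).differentiableAt
    one_ne_zero).hasFDerivAt
  have h2 := ((h.contDiffOn_symm.contDiffAt (e.open_target.mem_nhds hy)).differentiableAt
    one_ne_zero).hasFDerivAt
  have h3 : HasFDerivAt (φ ∘ e.symm) (innerSL ℝ u) y := by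
    refine (innerSL ℝ u).hasFDerivAt.congr_of_eventuallyEq ?_
    filter_upwards [e.open_target.mem_nhds hy] with y' hy'
    rw [Function.comp_apply, ← h.inner_eq _ (e.map_target hy'), e.right_inv hy']; rfl
  have := congrArg (fun A : E →L[ℝ] ℝ => A v) ((h1.comp y h2).unique h3)
  simpa using this

theorem fderiv_ne_zero {x : E} (hx : x ∈ e.source) : fderiv ℝ φ x ≠ 0 := by
  intro h0
  have := h.fderiv_comp (e.map_source hx) u
  rw [e.left_inv hx, h0, real_inner_self_eq_norm_sq, h.norm_eq_one] at this
  simp at this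

variable [FiniteDimensional ℝ E] [MeasurableSpace E] [BorelSpace E]

/-- The inverse chart on `uᗮ` parametrizes the level set. It pulls the covector `fderiv ℝ φ` back to
the inner product with `u`, so `normDet_comp_subtype_orthogonal`, applied with the gradient of `φ`
as `w`, gives the area factor. -/
theorem surface_integral {d : ℕ} (hd : finrank ℝ E = d + 1) (g : E → ℝ) :
    (IntegrableOn g {x ∈ e.source | φ x = 0} μHE[d] ↔
      IntegrableOn (fun z : (ℝ ∙ u)ᗮ => |(fderiv ℝ e.symm z).det| * ‖fderiv ℝ φ (e.symm z)‖ *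
        g (e.symm z)) ((↑) ⁻¹' e.target)) ∧
    ∫ x in {x ∈ e.source | φ x = 0}, g x ∂μHE[d] =
      ∫ z : (ℝ ∙ u)ᗮ in (↑) ⁻¹' e.target, |(fderiv ℝ e.symm z).det| *
        ‖fderiv ℝ φ (e.symm z)‖ * g (e.symm z) := by
  set F : (ℝ ∙ u)ᗮ → E := fun z => e.symm z
  set s : Set (ℝ ∙ u)ᗮ := (↑) ⁻¹' e.target
  have hs : IsOpen s := e.open_target.preimage continuous_subtype_val
  have hu0 : u ≠ 0 := by intro h0; have := h.norm_eq_one; simp [h0] at this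
  have hrank : finrank ℝ (ℝ ∙ u)ᗮ = d := by
    have h2 := Submodule.finrank_add_finrank_orthogonal (ℝ ∙ u)
    rw [finrank_span_singleton hu0] at h2
    omega
  have hF : ContDiffOn ℝ 1 F s :=
    h.contDiffOn_symm.comp (ℝ ∙ u)ᗮ.subtypeL.contDiff.contDiffOn fun z hz => hz
  have hFd : ∀ z ∈ s, fderiv ℝ F z = (fderiv ℝ e.symm z).comp (ℝ ∙ u)ᗮ.subtypeL := fun z hz => by
    have h2 := ((h.contDiffOn_symm.contDiffAt (e.open_target.mem_nhds hz)).differentiableAt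
      one_ne_zero).hasFDerivAt
    exact (h2.comp z (ℝ ∙ u)ᗮ.subtypeL.hasFDerivAt).fderiv
  have hinj : InjOn F s := fun z hz z' hz' hzz => Subtype.ext (e.symm.injOn hz hz' hzz)
  have hF' : ∀ z ∈ s, Function.Injective (fderiv ℝ F z) := fun z hz => by
    rw [hFd z hz]
    exact (h.injective_fderiv z hz).comp Subtype.val_injective
  have himg : F '' s = {x ∈ e.source | φ x = 0} := by
    ext x; constructor
    · rintro ⟨z, hz, rfl⟩
      refine ⟨e.map_target hz, ?_⟩
      rw [← h.inner_eq _ (e.map_target hz), e.right_inv hz]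
      exact Submodule.mem_orthogonal_singleton_iff_inner_right.1 z.2
    · rintro ⟨hx, hx0⟩
      refine ⟨⟨e x, Submodule.mem_orthogonal_singleton_iff_inner_right.2 ?_⟩, e.map_source hx,
        e.left_inv hx⟩
      rw [h.inner_eq x hx, hx0]
  have hJ : ∀ z ∈ s, (fderiv ℝ F z : (ℝ ∙ u)ᗮ →ₗ[ℝ] E).normDet =
      |(fderiv ℝ e.symm z).det| * ‖fderiv ℝ φ (e.symm z)‖ := fun z hz => by
    rw [hFd z hz]
    have hw : (InnerProductSpace.toDual ℝ E).symm (fderiv ℝ φ (e.symm z)) ≠ 0 := by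
      simpa using h.fderiv_ne_zero (e.map_target hz)
    have := normDet_comp_subtype_orthogonal (T := (fderiv ℝ e.symm z : E →ₗ[ℝ] E)) h.norm_eq_one
      hw fun v => by simpa using h.fderiv_comp hz v
    rw [LinearIsometryEquiv.norm_map] at this
    exact this
  have key := integrableOn_image_iff_and_integral_image_eq hs hF hinj hF' g
  rw [hrank, himg] at key
  rw [key.1, key.2]
  refine ⟨integrableOn_congr_fun (fun z hz => ?_) hs.measurableSet,
    setIntegral_congr_fun hs.measurableSet fun z hz => ?_⟩
  · simp only [hJ z hz]; rfl
  · simp only [hJ z hz]; rfl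

end IsFlatChart

end FlatChart

/-! ### The Euclidean divergence -/

section EuclideanDivergence

open Filter Topology Module

variable {n : ℕ}

/-- The divergence of a vector field on Euclidean space. -/
noncomputable def euclDiv (Y : EuclideanSpace ℝ (Fin n) → EuclideanSpace ℝ (Fin n))
    (x : EuclideanSpace ℝ (Fin n)) : ℝ :=
  ∑ i : Fin n, fderiv ℝ (fun y => Y y i) x (EuclideanSpace.single i 1)

variable {Y Z : EuclideanSpace ℝ (Fin n) → EuclideanSpace ℝ (Fin n)} {x : EuclideanSpace ℝ (Fin n)}

theorem Filter.EventuallyEq.euclDiv_eq (h : Y =ᶠ[𝓝 x] Z) : euclDiv Y x = euclDiv Z x := by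
  refine Finset.sum_congr rfl fun i _ => ?_
  rw [Filter.EventuallyEq.fderiv_eq]
  filter_upwards [h] with y hy
  rw [hy]

theorem euclDiv_eq_zero_of_eventuallyEq (h : Y =ᶠ[𝓝 x] 0) : euclDiv Y x = 0 := by
  rw [h.euclDiv_eq]
  simp [euclDiv]

theorem euclDiv_smul {g : EuclideanSpace ℝ (Fin n) → ℝ} (hg : DifferentiableAt ℝ g x)
    (hY : DifferentiableAt ℝ Y x) :
    euclDiv (fun y => g y • Y y) x = g x * euclDiv Y x + fderiv ℝ g x (Y x) := by
  have hYi : ∀ i, DifferentiableAt ℝ (fun y => Y y i) x := fun i =>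
    (EuclideanSpace.proj (𝕜 := ℝ) i).differentiableAt.comp x hY
  have h1 : ∀ i, fderiv ℝ (fun y => (g y • Y y) i) x (EuclideanSpace.single i 1) =
      g x * fderiv ℝ (fun y => Y y i) x (EuclideanSpace.single i 1) +
        Y x i * fderiv ℝ g x (EuclideanSpace.single i 1) := fun i => by
    simp only [PiLp.smul_apply, smul_eq_mul]
    rw [fderiv_fun_mul hg (hYi i)]
    simp
  have h2 : Y x = ∑ i, Y x i • EuclideanSpace.single i (1 : ℝ) := by
    have := (EuclideanSpace.basisFun (Fin n) ℝ).sum_repr (Y x)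
    simpa using this.symm
  conv_rhs => rw [h2]
  simp only [euclDiv, h1, Finset.sum_add_distrib, ← Finset.mul_sum, map_sum, map_smul, smul_eq_mul]

theorem continuous_euclDiv (hY : ContDiff ℝ 1 Y) : Continuous (euclDiv Y) := by
  refine continuous_finsetSum _ fun i _ => ?_
  have : ContDiff ℝ 1 fun y => Y y i := (EuclideanSpace.proj (𝕜 := ℝ) i).contDiff.comp hY
  exact (this.continuous_fderiv one_ne_zero).clm_apply continuous_const

theorem hasCompactSupport_euclDiv (hY : HasCompactSupport Y) : HasCompactSupport (euclDiv Y) := by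
  refine HasCompactSupport.intro hY fun x hx => euclDiv_eq_zero_of_eventuallyEq ?_
  exact notMem_tsupport_iff_eventuallyEq.1 hx

theorem integral_euclDiv_eq_zero (hY : ContDiff ℝ 1 Y) (hc : HasCompactSupport Y) :
    ∫ x, euclDiv Y x = 0 := by
  have hYi : ∀ i, ContDiff ℝ 1 fun y => Y y i :=
    fun i => (EuclideanSpace.proj (𝕜 := ℝ) i).contDiff.comp hY
  have hci : ∀ i, HasCompactSupport fun y => Y y i := fun i => 
    hc.comp_left (g := fun v : EuclideanSpace ℝ (Fin n) => v i) rfl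
  have hint : ∀ i, Integrable fun x => fderiv ℝ (fun y => Y y i) x (EuclideanSpace.single i 1) :=
    fun i => Continuous.integrable_of_hasCompactSupport
      (((hYi i).continuous_fderiv one_ne_zero).clm_apply continuous_const)
      ((hci i).fderiv_apply ℝ _)
  simp only [euclDiv]
  rw [integral_finsetSum _ fun i _ => hint i]
  refine Finset.sum_eq_zero fun i _ => ?_
  have := integral_mul_fderiv_eq_neg_fderiv_mul_of_integrable (μ := volume)
    (f := fun _ : EuclideanSpace ℝ (Fin n) => (1 : ℝ)) (g := fun y => Y y i)
    (v := EuclideanSpace.single i 1) (by simp) (by simpa using hint i)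
    (by simpa using (hYi i).continuous.integrable_of_hasCompactSupport (hci i))
    (fun x _ => differentiableAt_const _) (fun x _ => (hYi i).differentiable one_ne_zero x)
  simpa using this

end EuclideanDivergence

/-! ### Cutoffs of a boundary layer -/

section LayerCutoff

open Filter Topology Real

/-- The derivative of `Real.smoothTransition`, translated so that it lives on `[1, 2]`. -/
noncomputable def transitionBump (τ : ℝ) : ℝ := deriv smoothTransition (τ - 1)

theorem continuous_transitionBump : Continuous transitionBump :=
  (Real.smoothTransition.contDiff.continuous_deriv (n := 1) le_rfl).comp (by fun_prop)

theorem transitionBump_eq_zero {τ : ℝ} (hτ : τ ∉ Icc (1 : ℝ) 2) : transitionBump τ = 0 := by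
  rw [mem_Icc, not_and_or, not_le, not_le] at hτ
  rcases hτ with h | h
  · have : smoothTransition =ᶠ[𝓝 (τ - 1)] fun _ => 0 := by
      filter_upwards [eventually_lt_nhds (show τ - 1 < 0 by linarith)] with t ht
      exact smoothTransition.zero_of_nonpos ht.le
    rw [transitionBump, this.deriv_eq, deriv_const]
  · have : smoothTransition =ᶠ[𝓝 (τ - 1)] fun _ => 1 := by
      filter_upwards [eventually_gt_nhds (show 1 < τ - 1 by linarith)] with t ht
      exact smoothTransition.one_of_one_le ht.le
    rw [transitionBump, this.deriv_eq, deriv_const]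

theorem hasDerivAt_smoothTransition (t : ℝ) :
    HasDerivAt smoothTransition (deriv smoothTransition t) t :=
  ((smoothTransition.contDiffAt (n := 1)).differentiableAt one_ne_zero).hasDerivAt

theorem integral_transitionBump : ∫ τ, transitionBump τ = 1 := by
  have h1 : ∫ τ, transitionBump τ = ∫ τ in (1 : ℝ)..2, transitionBump τ := by
    rw [intervalIntegral.integral_of_le (by norm_num), ← integral_Icc_eq_integral_Ioc,
      setIntegral_eq_integral_of_forall_compl_eq_zero fun τ hτ => transitionBump_eq_zero hτ]
  have h2 : ∀ τ : ℝ, HasDerivAt (fun τ => smoothTransition (τ - 1)) (transitionBump τ) τ :=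
    fun τ => (hasDerivAt_smoothTransition (τ - 1)).comp_sub_const τ 1
  rw [h1, intervalIntegral.integral_eq_sub_of_hasDerivAt (fun τ _ => h2 τ)
    (continuous_transitionBump.intervalIntegrable _ _)]
  norm_num [smoothTransition.one, smoothTransition.zero]

/-- The cutoff is `0` for `t ≥ -ε` and `1` for `t ≤ -2 * ε` when `ε > 0`; its derivative is minus
the layer kernel whose averages are known to converge. -/
theorem hasDerivAt_layerCutoff (ε t : ℝ) :
    HasDerivAt (fun t => smoothTransition (-t / ε - 1)) (-(ε⁻¹ * transitionBump (-t / ε))) t := by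
  have h1 : HasDerivAt (fun t : ℝ => -t / ε - 1) (-1 / ε) t :=
    ((hasDerivAt_neg t).div_const ε).sub_const 1
  refine ((hasDerivAt_smoothTransition (-t / ε - 1)).comp t h1).congr_deriv ?_
  rw [transitionBump]; ring

end LayerCutoff

/-! ### Layer averages at a curved hypersurface -/

namespace IsFlatChart

open Filter Topology Module

variable {E : Type*} [NormedAddCommGroup E] [InnerProductSpace ℝ E] [FiniteDimensional ℝ E]
  [MeasurableSpace E] [BorelSpace E]
  {φ : E → ℝ} {u : E} {e : OpenPartialHomeomorph E E} (h : IsFlatChart φ u e)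
include h

/-- Averages over thin layers below the hypersurface `{φ = 0}`. -/
theorem tendsto_integral_layer {k : E → ℝ} {C : Set E} (hC : IsCompact C) (hCe : C ⊆ e.source)
    (hk0 : ∀ x ∉ C, k x = 0) (hk : ContinuousOn k (e.source ∩ {x | φ x ≤ 0})) {η : ℝ → ℝ}
    (hη : Continuous η) (hη0 : ∀ τ ∉ Icc (1 : ℝ) 2, η τ = 0) (hη1 : ∫ τ, η τ = 1) :
    IntegrableOn (fun z : (ℝ ∙ u)ᗮ => |(fderiv ℝ e.symm z).det| * k (e.symm z))
      ((↑) ⁻¹' e.target) ∧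
    Tendsto (fun ε : ℝ => ∫ x in e.source ∩ {x | φ x < 0}, ε⁻¹ * η (-φ x / ε) * k x) (𝓝[>] 0)
      (𝓝 (∫ z : (ℝ ∙ u)ᗮ in (↑) ⁻¹' e.target, |(fderiv ℝ e.symm z).det| * k (e.symm z))) := by
  classical
  have hz : ∀ z : (ℝ ∙ u)ᗮ, inner ℝ u (z : E) = 0 := fun z =>
    Submodule.mem_orthogonal_singleton_iff_inner_right.1 z.2
  have hφ : ∀ y ∈ e.target, φ (e.symm y) = inner ℝ u y := fun y hy => by
    rw [← h.inner_eq _ (e.map_target hy), e.right_inv hy]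
  have hinner : Continuous fun y : E => inner ℝ u y := by fun_prop
  set H : Set E := e.target ∩ {y | inner ℝ u y ≤ 0}
  have hHm : MeasurableSet H :=
    e.open_target.measurableSet.inter (isClosed_le hinner continuous_const).measurableSet
  set κ₀ : E → ℝ := fun y => |(fderiv ℝ e.symm y).det| * k (e.symm y)
  have hdet : ContinuousOn (fun y => |(fderiv ℝ e.symm y).det|) e.target :=
    (ContinuousLinearMap.continuous_det.comp_continuousOn
      (h.contDiffOn_symm.continuousOn_fderiv_of_isOpen e.open_target le_rfl)).abs
  have hκ₀ : ContinuousOn κ₀ H := by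
    refine (hdet.mono inter_subset_left).mul (hk.comp (e.symm.continuousOn.mono inter_subset_left) ?_)
    exact fun y hy => ⟨e.map_target hy.1, by simpa [hφ y hy.1] using hy.2⟩
  -- Extension by zero may create a jump across the hyperplane. It is harmless, since limits are
  -- taken only along `z - t • u` with `t > 0`, inside `H`.
  set κ : E → ℝ := H.piecewise κ₀ 0
  have hκm : Measurable κ := hκ₀.measurable_piecewise continuousOn_const hHm
  have hκH : ∀ y ∈ H, κ y = κ₀ y := fun y hy => piecewise_eq_of_mem _ _ _ hy
  set C' : Set E := e '' C
  have hC' : IsCompact C' := hC.image_of_continuousOn (e.continuousOn.mono hCe)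
  have hC'e : C' ⊆ e.target := by rintro _ ⟨x, hx, rfl⟩; exact e.map_source (hCe hx)
  have hκC' : ∀ y ∉ C', κ y = 0 := fun y hy => by
    by_cases hyH : y ∈ H
    · rw [hκH y hyH]
      have : e.symm y ∉ C := fun hc => hy ⟨_, hc, e.right_inv hyH.1⟩
      simp [κ₀, hk0 _ this]
    · exact piecewise_eq_of_notMem _ _ _ hyH
  obtain ⟨B, hB⟩ : ∃ B, ∀ y ∈ C' ∩ {y | inner ℝ u y ≤ 0}, ‖κ₀ y‖ ≤ B :=
    (hC'.inter_right (isClosed_le hinner continuous_const)).exists_bound_of_continuousOn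
      (hκ₀.mono fun y hy => ⟨hC'e hy.1, hy.2⟩)
  have hκB : ∀ y, |κ y| ≤ max B 0 := fun y => by
    by_cases hy : y ∈ C'
    · by_cases hy' : inner ℝ u y ≤ 0
      · rw [hκH y ⟨hC'e hy, hy'⟩]; exact (hB y ⟨hy, hy'⟩).trans (le_max_left _ _)
      · rw [show κ y = 0 from piecewise_eq_of_notMem _ _ _ fun hyH => hy' hyH.2]; simp
    · rw [hκC' y hy]; simp
  obtain ⟨ρ, hρ⟩ := hC'.isBounded.subset_closedBall 0
  have hκρ : ∀ y, ρ < ‖y‖ → κ y = 0 := fun y hy => hκC' y fun hy' => by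
    have := mem_closedBall_zero_iff.1 (hρ hy'); linarith
  have hκlim : ∀ z ∈ (ℝ ∙ u)ᗮ, Tendsto (fun t : ℝ => κ (z - t • u)) (𝓝[>] 0) (𝓝 (κ z)) := by
    intro z hzK
    have hz0 : inner ℝ u z = 0 := hz ⟨z, hzK⟩
    have hcont : Tendsto (fun t : ℝ => z - t • u) (𝓝[>] 0) (𝓝 z) := by
      have : Tendsto (fun t : ℝ => z - t • u) (𝓝 0) (𝓝 (z - (0 : ℝ) • u)) :=
        Continuous.tendsto (by fun_prop) 0
      rw [zero_smul, sub_zero] at this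
      exact this.mono_left nhdsWithin_le_nhds
    have hin : ∀ t : ℝ, inner ℝ u (z - t • u) = -t := fun t => by
      rw [inner_sub_right, hz0, inner_smul_right, real_inner_self_eq_norm_sq, h.norm_eq_one]; ring
    by_cases hzt : z ∈ e.target
    · have hzH : z ∈ H := ⟨hzt, hz0.le⟩
      have hev : ∀ᶠ t : ℝ in 𝓝[>] 0, z - t • u ∈ H := by
        filter_upwards [hcont.eventually (e.open_target.mem_nhds hzt), self_mem_nhdsWithin]
          with t ht ht0
        refine ⟨ht, ?_⟩
        rw [mem_ofPred_eq, hin]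
        have : (0 : ℝ) < t := ht0
        linarith
      rw [hκH z hzH]
      refine Tendsto.congr' (f₁ := fun t => κ₀ (z - t • u)) ?_ ?_
      · filter_upwards [hev] with t ht using (hκH _ ht).symm
      · exact (hκ₀ z hzH).tendsto.comp (tendsto_nhdsWithin_iff.2 ⟨hcont, hev⟩)
    · have hzC : z ∉ C' := fun hc => hzt (hC'e hc)
      rw [hκC' z hzC]
      refine tendsto_const_nhds.congr' ?_
      filter_upwards [hcont.eventually (hC'.isClosed.isOpen_compl.mem_nhds hzC)] with t ht
      exact (hκC' _ ht).symm
  have hsm : MeasurableSet ((↑) ⁻¹' e.target : Set (ℝ ∙ u)ᗮ) :=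
    (e.open_target.preimage continuous_subtype_val).measurableSet
  have hκK : (fun z : (ℝ ∙ u)ᗮ => κ z) =
      ((↑) ⁻¹' e.target : Set (ℝ ∙ u)ᗮ).indicator fun z => κ₀ z := by
    funext z
    by_cases hzt : (z : E) ∈ e.target
    · rw [indicator_of_mem (show z ∈ _ from hzt)]
      exact hκH _ ⟨hzt, (hz z).le⟩
    · rw [indicator_of_notMem (show z ∉ _ from hzt)]
      exact piecewise_eq_of_notMem _ _ _ fun hyH => hzt hyH.1
  constructor
  · have : Integrable fun z : (ℝ ∙ u)ᗮ => κ z := by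
      have h1 : IntegrableOn (fun z : (ℝ ∙ u)ᗮ => κ z) (Metric.closedBall 0 ρ) := by
        refine Measure.integrableOn_of_bounded (M := max B 0) measure_closedBall_lt_top.ne
          (hκm.comp measurable_subtype_coe).aestronglyMeasurable (ae_of_all _ fun z => hκB z)
      refine (integrableOn_iff_integrable_of_support_subset fun z hz' => ?_).1 h1
      by_contra hcon
      rw [mem_closedBall_zero_iff, not_le] at hcon
      exact hz' (hκρ _ hcon)
    rw [hκK, integrable_indicator_iff hsm] at this
    exact this
  · have hmain := _root_.tendsto_integral_layer h.norm_eq_one hη hη0 hη1 hκm hκB hκρ hκlim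
    rw [hκK, integral_indicator hsm] at hmain
    refine hmain.congr fun ε => ?_
    set S : Set E := e.target ∩ {y | inner ℝ u y < 0}
    have hSm : MeasurableSet S :=
      e.open_target.measurableSet.inter (isOpen_lt hinner continuous_const).measurableSet
    have himg : e.symm '' S = e.source ∩ {x | φ x < 0} := by
      ext x; constructor
      · rintro ⟨y, hy, rfl⟩
        exact ⟨e.map_target hy.1, by simpa [hφ y hy.1] using hy.2⟩
      · rintro ⟨hx, hx0⟩
        exact ⟨e x, ⟨e.map_source hx, by simpa [h.inner_eq x hx] using hx0⟩, e.left_inv hx⟩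
    have hcv := integral_image_eq_integral_abs_det_fderiv_smul (volume : Measure E) hSm
      (f := e.symm) (f' := fderiv ℝ e.symm)
      (fun y hy => ((h.contDiffOn_symm.contDiffAt (e.open_target.mem_nhds hy.1)).differentiableAt
        one_ne_zero).hasFDerivAt.hasFDerivWithinAt) (e.symm.injOn.mono fun y hy => hy.1)
      (fun x => ε⁻¹ * η (-φ x / ε) * k x)
    rw [himg] at hcv
    -- Outside `S` the integrand vanishes: on the hyperplane because the kernel is zero at `0`,
    -- above it or off the chart because `κ` is zero.
    rw [hcv, ← setIntegral_eq_integral_of_forall_compl_eq_zero (s := S)]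
    · refine setIntegral_congr_fun hSm fun y hy => ?_
      have hyH : y ∈ H := ⟨hy.1, (le_of_lt (hy.2 : inner ℝ u y < 0) : inner ℝ u y ≤ 0)⟩
      simp only [hκH y hyH, κ₀, hφ y hy.1, smul_eq_mul]
      ring
    · intro y hy
      by_cases hyt : y ∈ e.target
      · have hy0 : 0 ≤ inner ℝ u y := not_lt.1 fun hlt => hy ⟨hyt, hlt⟩
        rcases hy0.eq_or_lt with h0 | h0
        · rw [← h0, neg_zero, zero_div, hη0 0 (by norm_num)]; simp
        · rw [show κ y = 0 from piecewise_eq_of_notMem _ _ _ fun hyH => not_lt.2 hyH.2 h0, mul_zero]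
      · rw [show κ y = 0 from piecewise_eq_of_notMem _ _ _ fun hyH => hyt hyH.1, mul_zero]

end IsFlatChart

/-! ### The divergence theorem in one chart -/

section LocalDivergence

open Filter Topology Module

variable {d : ℕ} {φ : EuclideanSpace ℝ (Fin (d + 1)) → ℝ} {u : EuclideanSpace ℝ (Fin (d + 1))}
  {e : OpenPartialHomeomorph (EuclideanSpace ℝ (Fin (d + 1))) (EuclideanSpace ℝ (Fin (d + 1)))}

/-- The divergence theorem in a flat chart. -/
theorem IsFlatChart.divergence_theorem (h : IsFlatChart φ u e)
    {Z : EuclideanSpace ℝ (Fin (d + 1)) → EuclideanSpace ℝ (Fin (d + 1))}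
    {C : Set (EuclideanSpace ℝ (Fin (d + 1)))} (hC : IsCompact C) (hCe : C ⊆ e.source)
    (hZ0 : ∀ x ∉ C, Z x = 0) (hZc : ContinuousOn Z (e.source ∩ {x | φ x ≤ 0}))
    (hZ : ContDiffOn ℝ 1 Z (e.source ∩ {x | φ x < 0}))
    (hdiv : IntegrableOn (euclDiv Z) (e.source ∩ {x | φ x < 0})) :
    IntegrableOn (fun x => ‖fderiv ℝ φ x‖⁻¹ * fderiv ℝ φ x (Z x)) {x ∈ e.source | φ x = 0}
      μHE[d] ∧
    ∫ x in e.source ∩ {x | φ x < 0}, euclDiv Z x =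
      ∫ x in {x ∈ e.source | φ x = 0}, ‖fderiv ℝ φ x‖⁻¹ * fderiv ℝ φ x (Z x) ∂μHE[d] := by
  classical
  set V := e.source ∩ {x | φ x < 0}
  have hφc : ContinuousOn φ e.source := h.contDiffOn.continuousOn
  have hV : IsOpen V := hφc.isOpen_inter_preimage e.open_source isOpen_Iio
  have hφd : ∀ x ∈ e.source, DifferentiableAt ℝ φ x := fun x hx =>
    (h.contDiffOn.contDiffAt (e.open_source.mem_nhds hx)).differentiableAt one_ne_zero
  set k : EuclideanSpace ℝ (Fin (d + 1)) → ℝ := fun x => fderiv ℝ φ x (Z x)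
  have hk : ContinuousOn k (e.source ∩ {x | φ x ≤ 0}) :=
    ((h.contDiffOn.continuousOn_fderiv_of_isOpen e.open_source le_rfl).mono
      inter_subset_left).clm_apply hZc
  obtain ⟨hint, hlim⟩ := h.tendsto_integral_layer (k := k) hC hCe (fun x hx => by simp [k, hZ0 x hx])
    hk continuous_transitionBump (fun τ => transitionBump_eq_zero) integral_transitionBump
  obtain ⟨hsurf1, hsurf2⟩ := h.surface_integral (d := d) (by simp)
    (fun x => ‖fderiv ℝ φ x‖⁻¹ * fderiv ℝ φ x (Z x))
  have hsm : MeasurableSet ((↑) ⁻¹' e.target : Set (ℝ ∙ u)ᗮ) :=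
    (e.open_target.preimage continuous_subtype_val).measurableSet
  -- The length of the gradient in the area element cancels against the normalization of the normal.
  have hcancel : EqOn (fun z : (ℝ ∙ u)ᗮ => |(fderiv ℝ e.symm z).det| * ‖fderiv ℝ φ (e.symm z)‖ *
      (‖fderiv ℝ φ (e.symm z)‖⁻¹ * fderiv ℝ φ (e.symm z) (Z (e.symm z))))
      (fun z : (ℝ ∙ u)ᗮ => |(fderiv ℝ e.symm z).det| * k (e.symm z)) ((↑) ⁻¹' e.target) := by
    intro z hz
    have : ‖fderiv ℝ φ (e.symm z)‖ ≠ 0 :=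
      norm_ne_zero_iff.2 (h.fderiv_ne_zero (e.map_target hz))
    simp only [k]
    field_simp
  refine ⟨hsurf1.2 ((integrableOn_congr_fun hcancel hsm).2 hint), ?_⟩
  rw [hsurf2, setIntegral_congr_fun hsm hcancel]
  -- integration by parts against the cutoffs of the layer
  have hparts : ∀ ε : ℝ, 0 < ε → ∫ x in V, Real.smoothTransition (-φ x / ε - 1) * euclDiv Z x =
      ∫ x in V, ε⁻¹ * transitionBump (-φ x / ε) * k x := by
    intro ε hε
    set χ : ℝ → ℝ := fun t => Real.smoothTransition (-t / ε - 1)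
    have hχ : ContDiff ℝ 1 χ := Real.smoothTransition.contDiff.comp (by fun_prop)
    have hχ0 : ∀ t, -ε < t → χ t = 0 := fun t ht => by
      refine Real.smoothTransition.zero_of_nonpos ?_
      rw [sub_nonpos, div_le_one hε]; linarith
    -- The truncated field has compact support inside `V`, hence is `C¹` on the whole space although
    -- `Z` is only continuous up to the hypersurface.
    set G := V.piecewise (fun x => χ (φ x) • Z x) 0
    set Cε := C ∩ φ ⁻¹' Iic (-ε)
    have hCε : IsCompact Cε :=
      hC.of_isClosed_subset ((hφc.mono hCe).preimage_isClosed_of_isClosed hC.isClosed isClosed_Iic)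
        inter_subset_left
    have hCεV : Cε ⊆ V := fun x hx => ⟨hCe hx.1, by
      have : φ x ≤ -ε := hx.2
      exact (by linarith : φ x < 0)⟩
    have hG0 : ∀ x ∉ Cε, G x = 0 := fun x hx => by
      by_cases hxV : x ∈ V
      · rw [show G x = χ (φ x) • Z x from piecewise_eq_of_mem _ _ _ hxV]
        by_cases hxC : x ∈ C
        · rw [hχ0 _ (not_le.1 fun hle => hx ⟨hxC, hle⟩), zero_smul]
        · rw [hZ0 x hxC, smul_zero]
      · exact piecewise_eq_of_notMem _ _ _ hxV
    have hGev : ∀ x ∈ V, G =ᶠ[𝓝 x] fun x => χ (φ x) • Z x := fun x hx => by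
      filter_upwards [hV.mem_nhds hx] with y hy using piecewise_eq_of_mem _ _ _ hy
    have hGev0 : ∀ x ∉ V, G =ᶠ[𝓝 x] 0 := fun x hx => by
      filter_upwards [hCε.isClosed.isOpen_compl.mem_nhds fun hc => hx (hCεV hc)] with y hy
        using hG0 y hy
    have hGC : ContDiff ℝ 1 G := by
      refine contDiff_iff_contDiffAt.2 fun x => ?_
      by_cases hx : x ∈ V
      · refine ContDiffAt.congr_of_eventuallyEq ?_ (hGev x hx)
        exact (hχ.contDiffAt.comp x (h.contDiffOn.contDiffAt (e.open_source.mem_nhds hx.1))).smul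
          (hZ.contDiffAt (hV.mem_nhds hx))
      · exact contDiffAt_const.congr_of_eventuallyEq (hGev0 x hx)
    have hGc : HasCompactSupport G := HasCompactSupport.intro hCε hG0
    have hGint : Integrable (euclDiv G) :=
      (continuous_euclDiv hGC).integrable_of_hasCompactSupport (hasCompactSupport_euclDiv hGc)
    have hzero := integral_euclDiv_eq_zero hGC hGc
    rw [← setIntegral_eq_integral_of_forall_compl_eq_zero (s := V)
      fun x hx => euclDiv_eq_zero_of_eventuallyEq (hGev0 x hx)] at hzero
    have hform : ∀ x ∈ V, euclDiv G x =
        χ (φ x) * euclDiv Z x - ε⁻¹ * transitionBump (-φ x / ε) * k x := fun x hx => by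
      have hd : HasFDerivAt (fun x => χ (φ x))
          ((-(ε⁻¹ * transitionBump (-φ x / ε))) • fderiv ℝ φ x) x :=
        (hasDerivAt_layerCutoff ε (φ x)).comp_hasFDerivAt x (hφd x hx.1).hasFDerivAt
      rw [(hGev x hx).euclDiv_eq, euclDiv_smul hd.differentiableAt
        ((hZ.contDiffAt (hV.mem_nhds hx)).differentiableAt one_ne_zero), hd.fderiv]
      simp only [k, _root_.smul_apply, smul_eq_mul]
      ring
    have hI1 : IntegrableOn (fun x => χ (φ x) * euclDiv Z x) V := by
      refine hdiv.bdd_mul (c := 1) ?_ (ae_of_all _ fun x => ?_)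
      · exact (hχ.continuous.comp_continuousOn (hφc.mono inter_subset_left)).aestronglyMeasurable
          hV.measurableSet
      · rw [Real.norm_eq_abs, abs_of_nonneg (Real.smoothTransition.nonneg _)]
        exact Real.smoothTransition.le_one _
    -- The layer term is integrable as a difference of two integrable functions.
    have hI2 : IntegrableOn (fun x => ε⁻¹ * transitionBump (-φ x / ε) * k x) V := by
      refine (hI1.sub hGint.integrableOn).congr_fun (fun x hx => ?_) hV.measurableSet
      simp only [Pi.sub_apply, hform x hx]; ring
    rw [setIntegral_congr_fun hV.measurableSet hform, integral_sub hI1 hI2, sub_eq_zero] at hzero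
    exact hzero
  have hlim2 : Tendsto (fun ε : ℝ => ∫ x in V, Real.smoothTransition (-φ x / ε - 1) * euclDiv Z x)
      (𝓝[>] 0) (𝓝 (∫ x in V, euclDiv Z x)) := by
    refine tendsto_integral_filter_of_dominated_convergence (fun x => ‖euclDiv Z x‖) ?_ ?_
      hdiv.norm ?_
    · refine Eventually.of_forall fun ε => AEStronglyMeasurable.mul ?_ hdiv.aestronglyMeasurable
      refine ContinuousOn.aestronglyMeasurable ?_ hV.measurableSet
      exact Real.smoothTransition.continuous.comp_continuousOn
        (((hφc.mono inter_subset_left).neg.div_const ε).sub continuousOn_const)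
    · refine Eventually.of_forall fun ε => ae_of_all _ fun x => ?_
      rw [norm_mul, Real.norm_eq_abs, abs_of_nonneg (Real.smoothTransition.nonneg _)]
      exact mul_le_of_le_one_left (norm_nonneg _) (Real.smoothTransition.le_one _)
    · refine (ae_restrict_iff' hV.measurableSet).2 (ae_of_all _ fun x hx => ?_)
      have hx0 : φ x < 0 := hx.2
      refine tendsto_const_nhds.congr' ?_
      -- Once `2 * ε` is below the depth `-φ x`, the point lies beneath the layer and the cutoff
      -- equals `1`.
      have : ∀ᶠ ε : ℝ in 𝓝[>] 0, ε < -φ x / 2 :=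
        nhdsWithin_le_nhds (eventually_lt_nhds (by linarith))
      filter_upwards [this, self_mem_nhdsWithin] with ε hε hε0
      have hε0 : 0 < ε := hε0
      rw [Real.smoothTransition.one_of_one_le, one_mul]
      rw [le_sub_iff_add_le, le_div_iff₀ hε0]; linarith
  refine tendsto_nhds_unique hlim2 (hlim.congr' ?_)
  filter_upwards [self_mem_nhdsWithin] with ε hε using (hparts ε hε).symm

end LocalDivergence

/-! ### Euclidean normals and regular boundary pieces -/

section EuclideanNormal

open Filter Topology Module

variable {n : ℕ} {Ω U V : Set (EuclideanSpace ℝ (Fin n))} {φ ψ : EuclideanSpace ℝ (Fin n) → ℝ}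
  {x : EuclideanSpace ℝ (Fin n)}

theorem HasDerivAt.eventually_neg_right {f : ℝ → ℝ} {c : ℝ} (hf : HasDerivAt f c 0) (h0 : f 0 = 0)
    (hc : c < 0) : ∀ᶠ t in 𝓝[>] 0, f t < 0 := by
  have h1 := (hasDerivAt_iff_tendsto_slope.1 hf).mono_left
    (nhdsWithin_mono 0 fun t (ht : (0 : ℝ) < t) => ht.ne')
  filter_upwards [h1.eventually_lt_const hc, self_mem_nhdsWithin] with t ht ht0
  have ht0 : 0 < t := ht0
  rw [slope_def_field, h0, sub_zero, sub_zero] at ht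
  exact neg_of_div_neg_left ht ht0.le

namespace IsDefiningFunction

theorem differentiableAt (h : IsDefiningFunction Ω U φ) (hx : x ∈ U) : DifferentiableAt ℝ φ x :=
  (h.smooth.contDiffAt (h.isOpen.mem_nhds hx)).differentiableAt (by simp)

theorem eventually_mem (h : IsDefiningFunction Ω U φ) (hx : x ∈ U) (hφx : φ x = 0)
    {v : EuclideanSpace ℝ (Fin n)} (hv : fderiv ℝ φ x v < 0) :
    ∀ᶠ t : ℝ in 𝓝[>] 0, x + t • v ∈ Ω := by
  have hline : HasDerivAt (fun t : ℝ => x + t • v) v 0 := by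
    simpa using ((hasDerivAt_id (0 : ℝ)).smul_const v).const_add x
  have hφ : HasDerivAt (fun t : ℝ => φ (x + t • v)) (fderiv ℝ φ x v) 0 := by
    refine HasFDerivAt.comp_hasDerivAt_of_eq 0 (h.differentiableAt hx).hasFDerivAt hline ?_
    simp
  have hU : ∀ᶠ t : ℝ in 𝓝[>] 0, x + t • v ∈ U := by
    refine nhdsWithin_le_nhds (hline.continuousAt.eventually_mem (h.isOpen.mem_nhds ?_))
    simpa using hx
  filter_upwards [hU, hφ.eventually_neg_right (by simpa using hφx) hv] with t ht ht'
  exact (h.mem_iff _ ht).2 ht'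

/-- Along a descent direction of `φ` one enters `Ω`, where the other defining function is negative
as well; since that function is zero at `x`, its derivative cannot be positive. -/
theorem fderiv_nonpos (h : IsDefiningFunction Ω U φ) (h' : IsDefiningFunction Ω V ψ)
    (hxU : x ∈ U) (hxV : x ∈ V) (hφ : φ x = 0) (hψ : ψ x = 0)
    {v : EuclideanSpace ℝ (Fin n)} (hv : fderiv ℝ φ x v < 0) : fderiv ℝ ψ x v ≤ 0 := by
  by_contra hpos
  rw [not_le] at hpos
  have hline : HasDerivAt (fun t : ℝ => x + t • v) v 0 := by
    simpa using ((hasDerivAt_id (0 : ℝ)).smul_const v).const_add x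
  have hd : HasDerivAt (fun t : ℝ => -ψ (x + t • v)) (-fderiv ℝ ψ x v) 0 := by
    refine HasDerivAt.fun_neg
      (HasFDerivAt.comp_hasDerivAt_of_eq 0 (h'.differentiableAt hxV).hasFDerivAt hline ?_)
    simp
  have hV : ∀ᶠ t : ℝ in 𝓝[>] 0, x + t • v ∈ V := by
    refine nhdsWithin_le_nhds (hline.continuousAt.eventually_mem (h'.isOpen.mem_nhds ?_))
    simpa using hxV
  obtain ⟨t, h1, h2, h3⟩ := ((h.eventually_mem hxU hφ hv).and (hV.and
    (hd.eventually_neg_right (by simpa using hψ) (by linarith)))).exists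
  have := (h'.mem_iff _ h2).1 h1
  linarith

/-- A sign of `φ` persists nearby and excludes a frontier point. At a zero, the derivative does not
vanish, so some direction leads into `Ω`. -/
theorem mem_frontier_iff (h : IsDefiningFunction Ω U φ) (hx : x ∈ U) :
    x ∈ frontier Ω ↔ φ x = 0 := by
  have hcont : ContinuousAt φ x := (h.differentiableAt hx).continuousAt
  constructor
  · intro hf
    rcases lt_trichotomy (φ x) 0 with h0 | h0 | h0
    · refine absurd (mem_interior_iff_mem_nhds.2 ?_) hf.2
      filter_upwards [hcont.eventually_lt_const h0, h.isOpen.mem_nhds hx] with y hy hyU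
      exact (h.mem_iff y hyU).2 hy
    · exact h0
    · exfalso
      have : ∀ᶠ y in 𝓝 x, y ∉ Ω := by
        filter_upwards [hcont.eventually_const_lt h0, h.isOpen.mem_nhds hx] with y hy hyU hyΩ
        exact absurd ((h.mem_iff y hyU).1 hyΩ) (not_lt.2 (le_of_lt hy))
      exact (mem_closure_iff_frequently.1 hf.1) this
  · intro h0
    have hxΩ : x ∉ Ω := fun hc => by have := (h.mem_iff x hx).1 hc; linarith
    obtain ⟨v, hv⟩ : ∃ v, fderiv ℝ φ x v < 0 := by
      obtain ⟨w, hw⟩ := DFunLike.exists_ne (h.fderiv_ne_zero x hx)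
      rcases lt_or_gt_of_ne hw with hw | hw
      · exact ⟨w, hw⟩
      · refine ⟨-w, ?_⟩
        rw [map_neg]
        have : 0 < fderiv ℝ φ x w := hw
        linarith
    refine ⟨?_, fun hi => hxΩ (interior_subset hi)⟩
    have hline : Tendsto (fun t : ℝ => x + t • v) (𝓝[>] 0) (𝓝 x) := by
      have : Tendsto (fun t : ℝ => x + t • v) (𝓝 0) (𝓝 (x + (0 : ℝ) • v)) :=
        Continuous.tendsto (by fun_prop) 0
      rw [zero_smul, add_zero] at this
      exact this.mono_left nhdsWithin_le_nhds
    exact mem_closure_of_tendsto hline (h.eventually_mem hx h0 hv)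

end IsDefiningFunction

open Classical in
/-- The Euclidean outward unit normal of `Ω` (and `0` where there is none). -/
noncomputable def euclNormal (Ω : Set (EuclideanSpace ℝ (Fin n)))
    (x : EuclideanSpace ℝ (Fin n)) : EuclideanSpace ℝ (Fin n) :=
  if h : ∃ φ : EuclideanSpace ℝ (Fin n) → ℝ, ∃ U, x ∈ U ∧ IsDefiningFunction Ω U φ ∧ φ x = 0 then
    ‖fderiv ℝ h.choose x‖⁻¹ • (InnerProductSpace.toDual ℝ _).symm (fderiv ℝ h.choose x)
  else 0

/-- The normalized gradient does not depend on the defining function. If two unit gradients `a` and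
`b` differed, moving along `a - b` would increase one function and decrease the other, against
`fderiv_nonpos`. -/
theorem euclNormal_eq (h : IsDefiningFunction Ω U φ) (hx : x ∈ U) (h0 : φ x = 0) :
    euclNormal Ω x =
      ‖fderiv ℝ φ x‖⁻¹ • (InnerProductSpace.toDual ℝ _).symm (fderiv ℝ φ x) := by
  have hex : ∃ φ : EuclideanSpace ℝ (Fin n) → ℝ, ∃ U, x ∈ U ∧ IsDefiningFunction Ω U φ ∧ φ x = 0 :=
    ⟨φ, U, hx, h, h0⟩
  rw [euclNormal, dif_pos hex]
  obtain ⟨V, hxV, h', h0'⟩ := hex.choose_spec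
  set ψ := hex.choose
  have hφ := h.fderiv_ne_zero x hx
  have hψ := h'.fderiv_ne_zero x hxV
  set a := ‖fderiv ℝ ψ x‖⁻¹ • (InnerProductSpace.toDual ℝ _).symm (fderiv ℝ ψ x)
  set b := ‖fderiv ℝ φ x‖⁻¹ • (InnerProductSpace.toDual ℝ _).symm (fderiv ℝ φ x)
  have hφ0 : 0 < ‖fderiv ℝ φ x‖ := norm_pos_iff.2 hφ
  have hψ0 : 0 < ‖fderiv ℝ ψ x‖ := norm_pos_iff.2 hψ
  have ha : ‖a‖ = 1 := by
    rw [norm_smul, norm_inv, norm_norm, LinearIsometryEquiv.norm_map, inv_mul_cancel₀ hψ0.ne']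
  have hb : ‖b‖ = 1 := by
    rw [norm_smul, norm_inv, norm_norm, LinearIsometryEquiv.norm_map, inv_mul_cancel₀ hφ0.ne']
  have hai : ∀ v, inner ℝ a v = ‖fderiv ℝ ψ x‖⁻¹ * fderiv ℝ ψ x v := fun v => by
    simp [a, real_inner_smul_left]
  have hbi : ∀ v, inner ℝ b v = ‖fderiv ℝ φ x‖⁻¹ * fderiv ℝ φ x v := fun v => by
    simp [b, real_inner_smul_left]
  by_contra hne
  have hlt : inner ℝ b a < 1 := by
    refine lt_of_le_of_ne ?_ fun hc => hne ((inner_eq_one_iff_of_norm_eq_one hb ha).1 hc).symm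
    simpa [ha, hb] using real_inner_le_norm b a
  have h1 : inner ℝ b (a - b) < 0 := by
    rw [inner_sub_right, real_inner_self_eq_norm_sq, hb]; linarith
  have h2 : 0 < inner ℝ a (a - b) := by
    rw [inner_sub_right, real_inner_self_eq_norm_sq, ha, real_inner_comm]; linarith
  rw [hbi] at h1
  rw [hai] at h2
  have h3 : fderiv ℝ φ x (a - b) < 0 := by
    by_contra hc
    exact absurd h1 (not_lt.2 (mul_nonneg (inv_nonneg.2 hφ0.le) (not_lt.1 hc)))
  have h4 := h.fderiv_nonpos h' hx hxV h0 h0' h3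
  exact absurd h2 (not_lt.2 (mul_nonpos_of_nonneg_of_nonpos (inv_nonneg.2 hψ0.le) h4))

theorem inner_euclNormal (h : IsDefiningFunction Ω U φ) (hx : x ∈ U) (h0 : φ x = 0)
    (v : EuclideanSpace ℝ (Fin n)) :
    inner ℝ (euclNormal Ω x) v = ‖fderiv ℝ φ x‖⁻¹ * fderiv ℝ φ x v := by
  simp [euclNormal_eq h hx h0, real_inner_smul_left]

theorem norm_euclNormal (h : IsDefiningFunction Ω U φ) (hx : x ∈ U) (h0 : φ x = 0) :
    ‖euclNormal Ω x‖ = 1 := by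
  rw [euclNormal_eq h hx h0, norm_smul, norm_inv, norm_norm, LinearIsometryEquiv.norm_map,
    inv_mul_cancel₀ (norm_ne_zero_iff.2 (h.fderiv_ne_zero x hx))]

/-- `Γ` is a relatively open subset of the boundary of `Ω` near which `Ω` is smooth. -/
def IsRegularBoundary (Ω Γ : Set (EuclideanSpace ℝ (Fin n))) : Prop :=
  ∀ p ∈ Γ, ∃ (U : Set (EuclideanSpace ℝ (Fin n))) (φ : EuclideanSpace ℝ (Fin n) → ℝ),
    p ∈ U ∧ IsDefiningFunction Ω U φ ∧ φ p = 0 ∧ ∀ x ∈ U, φ x = 0 → x ∈ Γ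

theorem IsSmoothBoundaryPiece.isRegularBoundary {Γ : Set (EuclideanSpace ℝ (Fin n))}
    (h : IsSmoothBoundaryPiece Ω Γ) : IsRegularBoundary Ω Γ := by
  intro p hp
  obtain ⟨U, φ, hpU, hφ, hΓ⟩ := h p hp
  have hp' : p ∈ {x ∈ U | φ x = 0} := hΓ ▸ ⟨hp, hpU⟩
  refine ⟨U, φ, hpU, hφ, hp'.2, fun x hx h0 => ?_⟩
  have : x ∈ Γ ∩ U := by rw [hΓ]; exact ⟨hx, h0⟩
  exact this.1

theorem IsRegularBoundary.union {Γ Γ' : Set (EuclideanSpace ℝ (Fin n))}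
    (h : IsRegularBoundary Ω Γ) (h' : IsRegularBoundary Ω Γ') : IsRegularBoundary Ω (Γ ∪ Γ') := by
  rintro p (hp | hp)
  · obtain ⟨U, φ, h1, h2, h3, h4⟩ := h p hp
    exact ⟨U, φ, h1, h2, h3, fun x hx h0 => Or.inl (h4 x hx h0)⟩
  · obtain ⟨U, φ, h1, h2, h3, h4⟩ := h' p hp
    exact ⟨U, φ, h1, h2, h3, fun x hx h0 => Or.inr (h4 x hx h0)⟩

theorem IsRegularBoundary.subset_frontier {Γ : Set (EuclideanSpace ℝ (Fin n))}
    (h : IsRegularBoundary Ω Γ) : Γ ⊆ frontier Ω := by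
  intro p hp
  obtain ⟨U, φ, h1, h2, h3, -⟩ := h p hp
  exact (h2.mem_frontier_iff h1).2 h3

theorem IsRegularBoundary.continuousOn_euclNormal {Γ : Set (EuclideanSpace ℝ (Fin n))}
    (h : IsRegularBoundary Ω Γ) : ContinuousOn (euclNormal Ω) Γ := by
  intro p hp
  obtain ⟨U, φ, hpU, hφ, h0, -⟩ := h p hp
  have hd : ContinuousAt (fun x => fderiv ℝ φ x) p :=
    (hφ.smooth.continuousOn_fderiv_of_isOpen hφ.isOpen (by simp)).continuousAt
      (hφ.isOpen.mem_nhds hpU)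
  have hc : ContinuousAt (fun x => ‖fderiv ℝ φ x‖⁻¹ •
      (InnerProductSpace.toDual ℝ _).symm (fderiv ℝ φ x)) p :=
    (hd.norm.inv₀ (norm_ne_zero_iff.2 (hφ.fderiv_ne_zero p hpU))).smul
      ((LinearIsometryEquiv.continuous _).continuousAt.comp hd)
  refine hc.continuousWithinAt.congr_of_eventuallyEq ?_ (euclNormal_eq hφ hpU h0)
  filter_upwards [self_mem_nhdsWithin, mem_nhdsWithin_of_mem_nhds (hφ.isOpen.mem_nhds hpU)]
    with x hx hxU
  exact euclNormal_eq hφ hxU ((hφ.mem_frontier_iff hxU).1 (h.subset_frontier hx))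

end EuclideanNormal

/-! ### The Euclidean divergence theorem with a cutoff -/

section EuclideanDivergenceTheorem

open Filter Topology Module

variable {d : ℕ} {Ω Γ : Set (EuclideanSpace ℝ (Fin (d + 1)))}
  {Y : EuclideanSpace ℝ (Fin (d + 1)) → EuclideanSpace ℝ (Fin (d + 1))}
  {ζ : EuclideanSpace ℝ (Fin (d + 1)) → ℝ}

/-- The integrand is continuous on the compact set where the support of `ζ` meets the closure of
`Ω`, and it vanishes on the rest of `Ω`. -/
theorem integrableOn_fderiv_apply (hΩ : IsOpen Ω) (hYc : ContinuousOn Y (Ω ∪ Γ))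
    (hζ : ContDiff ℝ 1 ζ) (hK : IsCompact (tsupport ζ ∩ closure Ω))
    (hsupp : tsupport ζ ∩ closure Ω ⊆ Ω ∪ Γ) :
    IntegrableOn (fun x => fderiv ℝ ζ x (Y x)) Ω := by
  have hcont : ContinuousOn (fun x => fderiv ℝ ζ x (Y x)) (tsupport ζ ∩ closure Ω) :=
    (hζ.continuous_fderiv one_ne_zero).continuousOn.clm_apply (hYc.mono hsupp)
  refine ((hcont.integrableOn_compact hK).of_forall_sdiff_eq_zero hΩ.measurableSet fun x hx => ?_)
  have hx' : x ∉ tsupport ζ := fun hc => hx.2 ⟨hc, subset_closure hx.1⟩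
  rw [(notMem_tsupport_iff_eventuallyEq.1 hx').fderiv_eq]
  simp

/-- The divergence theorem for the product of `Y` with a cutoff function `ζ`. -/
def HasCutoffDivergence (Ω : Set (EuclideanSpace ℝ (Fin (d + 1))))
    (Y : EuclideanSpace ℝ (Fin (d + 1)) → EuclideanSpace ℝ (Fin (d + 1)))
    (ζ : EuclideanSpace ℝ (Fin (d + 1)) → ℝ) : Prop :=
  IntegrableOn (fun x => ζ x * inner ℝ (euclNormal Ω x) (Y x)) (frontier Ω) μHE[d] ∧
    ∫ x in Ω, (ζ x * euclDiv Y x + fderiv ℝ ζ x (Y x)) =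
      ∫ x in frontier Ω, ζ x * inner ℝ (euclNormal Ω x) (Y x) ∂μHE[d]

theorem integrableOn_cutoff_mul_euclDiv (hdiv : IntegrableOn (euclDiv Y) Ω)
    (hζ : ContDiff ℝ 1 ζ) (hζc : HasCompactSupport ζ) :
    IntegrableOn (fun x => ζ x * euclDiv Y x) Ω := by
  obtain ⟨B, hB⟩ := hζc.exists_bound_of_continuous hζ.continuous
  exact hdiv.bdd_mul hζ.continuous.aestronglyMeasurable (ae_of_all _ hB)

theorem hasCutoffDivergence_interior (hΩ : IsOpen Ω) (hY : ContDiffOn ℝ 1 Y Ω)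
    (hζ : ContDiff ℝ 1 ζ) (hζc : HasCompactSupport ζ) (hsupp : tsupport ζ ⊆ Ω) :
    HasCutoffDivergence Ω Y ζ := by
  have hbd : EqOn (fun x => ζ x * inner ℝ (euclNormal Ω x) (Y x)) 0 (frontier Ω) := fun x hx => by
    have : x ∉ tsupport ζ := fun hc => hx.2 (hΩ.interior_eq.symm ▸ hsupp hc)
    simp [image_eq_zero_of_notMem_tsupport this]
  have hfm : MeasurableSet (frontier Ω) := isClosed_frontier.measurableSet
  refine ⟨(integrableOn_congr_fun hbd hfm).2 integrableOn_zero, ?_⟩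
  rw [setIntegral_congr_fun hfm hbd]
  have hG : ContDiff ℝ 1 fun x => ζ x • Y x := by
    refine contDiff_iff_contDiffAt.2 fun x => ?_
    by_cases hx : x ∈ Ω
    · exact hζ.contDiffAt.smul (hY.contDiffAt (hΩ.mem_nhds hx))
    · refine contDiffAt_const (c := 0) |>.congr_of_eventuallyEq ?_
      filter_upwards [notMem_tsupport_iff_eventuallyEq.1 fun hc => hx (hsupp hc)] with y hy
      simp [hy]
  have hGc : HasCompactSupport fun x => ζ x • Y x := hζc.smul_right
  have hzero := integral_euclDiv_eq_zero hG hGc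
  rw [← setIntegral_eq_integral_of_forall_compl_eq_zero (s := Ω)] at hzero
  · rw [setIntegral_congr_fun hΩ.measurableSet (g := euclDiv fun x => ζ x • Y x), hzero]
    · simp
    · intro x hx
      exact (euclDiv_smul (hζ.differentiable one_ne_zero x)
        ((hY.contDiffAt (hΩ.mem_nhds hx)).differentiableAt one_ne_zero)).symm
  · intro x hx
    refine euclDiv_eq_zero_of_eventuallyEq ?_
    filter_upwards [notMem_tsupport_iff_eventuallyEq.1 fun hc => hx (hsupp hc)] with y hy
    simp [hy]

theorem hasCutoffDivergence_exterior (hΩ : IsOpen Ω) (hsupp : tsupport ζ ⊆ (closure Ω)ᶜ) :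
    HasCutoffDivergence Ω Y ζ := by
  have h0 : ∀ x ∈ closure Ω, ζ =ᶠ[𝓝 x] 0 := fun x hx =>
    notMem_tsupport_iff_eventuallyEq.1 fun hc => hsupp hc hx
  have hbd : EqOn (fun x => ζ x * inner ℝ (euclNormal Ω x) (Y x)) 0 (frontier Ω) := fun x hx => by
    simp [(h0 x hx.1).eq_of_nhds]
  have hin : EqOn (fun x => ζ x * euclDiv Y x + fderiv ℝ ζ x (Y x)) 0 Ω := fun x hx => by
    simp [(h0 x (subset_closure hx)).eq_of_nhds, (h0 x (subset_closure hx)).fderiv_eq]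
  have hfm : MeasurableSet (frontier Ω) := isClosed_frontier.measurableSet
  refine ⟨(integrableOn_congr_fun hbd hfm).2 integrableOn_zero, ?_⟩
  rw [setIntegral_congr_fun hfm hbd, setIntegral_congr_fun hΩ.measurableSet hin]
  simp

/-- The neighbourhood is the source of a flat chart of a defining function, in which `ζ • Y`
satisfies the local divergence theorem. The condition on the support of `ζ` makes the gradient term
integrable. -/
theorem exists_nhds_hasCutoffDivergence_boundary (hΩ : IsOpen Ω) (hΓ : IsRegularBoundary Ω Γ)
    (hYc : ContinuousOn Y (Ω ∪ Γ)) (hY : ContDiffOn ℝ 1 Y Ω) (hdiv : IntegrableOn (euclDiv Y) Ω)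
    {p : EuclideanSpace ℝ (Fin (d + 1))} (hp : p ∈ Γ) :
    ∃ V, IsOpen V ∧ p ∈ V ∧ ∀ ζ : EuclideanSpace ℝ (Fin (d + 1)) → ℝ, ContDiff ℝ 1 ζ →
      HasCompactSupport ζ → tsupport ζ ⊆ V → tsupport ζ ∩ closure Ω ⊆ Ω ∪ Γ →
      HasCutoffDivergence Ω Y ζ := by
  obtain ⟨U, φ, hpU, hφ, h0, hUΓ⟩ := hΓ p hp
  obtain ⟨u, e, he, hpe, heU⟩ := exists_isFlatChart hφ.isOpen
    (hφ.smooth.of_le (by simp)) hpU (hφ.fderiv_ne_zero p hpU)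
  refine ⟨e.source, e.open_source, hpe, fun ζ hζ hζc hsupp hsupp' => ?_⟩
  have hset : e.source ∩ {x | φ x < 0} = e.source ∩ Ω := by
    ext x
    exact and_congr_right fun hx => (hφ.mem_iff x (heU hx)).symm
  have hset' : {x ∈ e.source | φ x = 0} = e.source ∩ frontier Ω := by
    ext x
    exact and_congr_right fun hx => (hφ.mem_frontier_iff (heU hx)).symm
  have hYc' : ContinuousOn Y (e.source ∩ {x | φ x ≤ 0}) := by
    refine hYc.mono fun x hx => ?_
    rcases lt_or_eq_of_le (show φ x ≤ 0 from hx.2) with hlt | heq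
    · exact Or.inl ((hφ.mem_iff x (heU hx.1)).2 hlt)
    · exact Or.inr (hUΓ x (heU hx.1) heq)
  have hopen : IsOpen (e.source ∩ Ω) := e.open_source.inter hΩ
  have hform : ∀ x ∈ e.source ∩ Ω, euclDiv (fun x => ζ x • Y x) x =
      ζ x * euclDiv Y x + fderiv ℝ ζ x (Y x) := fun x hx =>
    euclDiv_smul (hζ.differentiable one_ne_zero x)
      ((hY.contDiffAt (hΩ.mem_nhds hx.2)).differentiableAt one_ne_zero)
  have hint : IntegrableOn (fun x => ζ x * euclDiv Y x + fderiv ℝ ζ x (Y x)) Ω :=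
    (integrableOn_cutoff_mul_euclDiv hdiv hζ hζc).add
      (integrableOn_fderiv_apply hΩ hYc hζ (hζc.isCompact.inter_right isClosed_closure) hsupp')
  have hloc := he.divergence_theorem (Z := fun x => ζ x • Y x) hζc.isCompact hsupp
    (fun x hx => by simp [image_eq_zero_of_notMem_tsupport hx])
    (hζ.continuous.continuousOn.smul hYc')
    (hset ▸ (hζ.contDiffOn.smul (hY.mono inter_subset_right)))
    (hset ▸ (integrableOn_congr_fun hform hopen.measurableSet).2 (hint.mono_set inter_subset_right))
  rw [hset, hset'] at hloc
  have hfm : MeasurableSet (e.source ∩ frontier Ω) :=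
    e.open_source.measurableSet.inter isClosed_frontier.measurableSet
  have hbd : EqOn (fun x => ‖fderiv ℝ φ x‖⁻¹ * fderiv ℝ φ x (ζ x • Y x))
      (fun x => ζ x * inner ℝ (euclNormal Ω x) (Y x)) (e.source ∩ frontier Ω) := fun x hx => by
    simp only [inner_euclNormal hφ (heU hx.1) ((hφ.mem_frontier_iff (heU hx.1)).1 hx.2), map_smul,
      smul_eq_mul]
    ring
  have hzero : ∀ x ∉ e.source, ζ =ᶠ[𝓝 x] 0 := fun x hx =>
    notMem_tsupport_iff_eventuallyEq.1 fun hc => hx (hsupp hc)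
  rw [integrableOn_congr_fun hbd hfm, setIntegral_congr_fun hfm hbd,
    setIntegral_congr_fun hopen.measurableSet hform] at hloc
  refine ⟨hloc.1.of_forall_sdiff_eq_zero isClosed_frontier.measurableSet fun x hx => ?_, ?_⟩
  · rw [(hzero x fun hc => hx.2 ⟨hc, hx.1⟩).eq_of_nhds]; simp
  · rw [setIntegral_eq_of_subset_of_forall_sdiff_eq_zero hΩ.measurableSet inter_subset_right
        fun x hx => ?_, hloc.2,
      setIntegral_eq_of_subset_of_forall_sdiff_eq_zero isClosed_frontier.measurableSet
        inter_subset_right fun x hx => ?_]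
    · rw [(hzero x fun hc => hx.2 ⟨hc, hx.1⟩).eq_of_nhds]; simp
    · have := hzero x fun hc => hx.2 ⟨hc, hx.1⟩
      rw [this.fderiv_eq, this.eq_of_nhds]; simp

/-- The divergence theorem on a domain with a partially regular boundary, for vector fields cut off
near the irregular part of the boundary. -/
theorem hasCutoffDivergence_of_hasCompactSupport (hΩ : IsOpen Ω) (hΓ : IsRegularBoundary Ω Γ)
    (hYc : ContinuousOn Y (Ω ∪ Γ)) (hY : ContDiffOn ℝ 1 Y Ω) (hdiv : IntegrableOn (euclDiv Y) Ω)
    (hζ : ContDiff ℝ 1 ζ) (hζc : HasCompactSupport ζ)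
    (hsupp : tsupport ζ ∩ closure Ω ⊆ Ω ∪ Γ) : HasCutoffDivergence Ω Y ζ := by
  have hloc : ∀ p ∈ tsupport ζ, ∃ V, IsOpen V ∧ p ∈ V ∧
      ∀ ξ : EuclideanSpace ℝ (Fin (d + 1)) → ℝ, ContDiff ℝ 1 ξ →
      HasCompactSupport ξ → tsupport ξ ⊆ V → tsupport ξ ∩ closure Ω ⊆ Ω ∪ Γ →
      HasCutoffDivergence Ω Y ξ := by
    intro p hp
    by_cases hpc : p ∈ closure Ω
    · rcases hsupp ⟨hp, hpc⟩ with hpΩ | hpΓ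
      · exact ⟨Ω, hΩ, hpΩ, fun ξ h1 h2 h3 _ => hasCutoffDivergence_interior hΩ hY h1 h2 h3⟩
      · exact exists_nhds_hasCutoffDivergence_boundary hΩ hΓ hYc hY hdiv hpΓ
    · exact ⟨(closure Ω)ᶜ, isClosed_closure.isOpen_compl, hpc,
        fun ξ _ _ h3 _ => hasCutoffDivergence_exterior hΩ h3⟩
  choose! V hVo hpV hV using hloc
  obtain ⟨t, htK, htV⟩ := hζc.isCompact.elim_nhds_subcover V fun p hp => (hVo p hp).mem_nhds (hpV p hp)
  -- The identity is additive in the cutoff, so it suffices to have it for each `f i * ζ`. The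
  -- support of this product lies in one neighbourhood and still avoids the irregular boundary.
  obtain ⟨f, hf⟩ := SmoothPartitionOfUnity.exists_isSubordinate
    (modelWithCornersSelf ℝ (EuclideanSpace ℝ (Fin (d + 1)))) (isClosed_tsupport ζ)
    (fun i : t => V i) (fun i => hVo _ (htK i i.2)) (fun x hx => by
      obtain ⟨i, hi, hxi⟩ := mem_iUnion₂.1 (htV hx)
      exact mem_iUnion.2 ⟨⟨i, hi⟩, hxi⟩)
  have hfd : ∀ i, ContDiff ℝ 1 (f i) := fun i => (f i).contMDiff.contDiff.of_le (by simp)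
  have hfζ : ∀ i, ContDiff ℝ 1 fun x => f i x * ζ x := fun i => (hfd i).mul hζ
  have hfζc : ∀ i, HasCompactSupport fun x => f i x * ζ x := fun i => hζc.mul_left
  have hts : ∀ i, tsupport (fun x => f i x * ζ x) ⊆ tsupport ζ := fun i =>
    tsupport_mul_subset_right
  have hP : ∀ i : t, HasCutoffDivergence Ω Y fun x => f i x * ζ x := fun i =>
    hV i (htK i i.2) _ (hfζ i) (hfζc i) (tsupport_mul_subset_left.trans (hf i))
      fun x hx => hsupp ⟨hts i hx.1, hx.2⟩
  have hsum : ∀ x, ζ x = ∑ i, f i x * ζ x := fun x => by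
    rw [← Finset.sum_mul]
    by_cases hx : x ∈ tsupport ζ
    · have := f.sum_eq_one hx
      rw [finsum_eq_sum_of_fintype] at this
      rw [this, one_mul]
    · rw [image_eq_zero_of_notMem_tsupport hx, mul_zero]
  have hsum' : ζ = fun x => ∑ i, f i x * ζ x := funext hsum
  have hsumd : ∀ x, fderiv ℝ ζ x = ∑ i, fderiv ℝ (fun x => f i x * ζ x) x := fun x => by
    conv_lhs => rw [hsum']
    rw [fderiv_fun_sum fun i _ => (hfζ i).differentiable one_ne_zero x]
  have e1 : (fun x => ζ x * inner ℝ (euclNormal Ω x) (Y x)) =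
      fun x => ∑ i, f i x * ζ x * inner ℝ (euclNormal Ω x) (Y x) := funext fun x => by
    rw [← Finset.sum_mul, ← hsum x]
  have e2 : (fun x => ζ x * euclDiv Y x + fderiv ℝ ζ x (Y x)) =
      fun x => ∑ i, (f i x * ζ x * euclDiv Y x + fderiv ℝ (fun x => f i x * ζ x) x (Y x)) :=
    funext fun x => by
      rw [Finset.sum_add_distrib, ← Finset.sum_mul, ← hsum x, hsumd x]
      simp
  constructor
  · rw [e1]
    exact integrable_finsetSum _ fun i _ => (hP i).1
  · rw [e1, e2, integral_finsetSum _ fun i _ => (hP i).1, integral_finsetSum]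
    · exact Finset.sum_congr rfl fun i _ => (hP i).2
    · exact fun i _ => (integrableOn_cutoff_mul_euclDiv hdiv (hfζ i) (hfζc i)).add
        (integrableOn_fderiv_apply hΩ hYc (hfζ i) ((hfζc i).isCompact.inter_right isClosed_closure)
          fun x hx => hsupp ⟨hts i hx.1, hx.2⟩)

/-- A bump function equal to `1` near the bounded set `closure Ω` makes the cutoff compactly
supported without changing any integral. -/
theorem hasCutoffDivergence_of_isBounded (hΩ : IsOpen Ω) (hΩb : Bornology.IsBounded Ω)
    (hΓ : IsRegularBoundary Ω Γ) (hYc : ContinuousOn Y (Ω ∪ Γ)) (hY : ContDiffOn ℝ 1 Y Ω)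
    (hdiv : IntegrableOn (euclDiv Y) Ω) (hζ : ContDiff ℝ 1 ζ)
    (hsupp : tsupport ζ ∩ closure Ω ⊆ Ω ∪ Γ) : HasCutoffDivergence Ω Y ζ := by
  obtain ⟨R, hR0, hR⟩ := hΩb.closure.subset_ball_lt 0 0
  let b : ContDiffBump (0 : EuclideanSpace ℝ (Fin (d + 1))) := ⟨R, R + 1, hR0, by linarith⟩
  have hb1 : ∀ x ∈ closure Ω, (fun x => b x * ζ x) =ᶠ[𝓝 x] ζ := fun x hx => by
    filter_upwards [Metric.isOpen_ball.mem_nhds (hR hx)] with y hy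
    rw [b.one_of_mem_closedBall (Metric.ball_subset_closedBall hy), one_mul]
  have hmain := hasCutoffDivergence_of_hasCompactSupport (ζ := fun x => b x * ζ x) hΩ hΓ hYc hY hdiv
    (b.contDiff.mul hζ) b.hasCompactSupport.mul_right
    fun x hx => hsupp ⟨tsupport_mul_subset_right hx.1, hx.2⟩
  have hfm : MeasurableSet (frontier Ω) := isClosed_frontier.measurableSet
  have e1 : EqOn (fun x => b x * ζ x * inner ℝ (euclNormal Ω x) (Y x))
      (fun x => ζ x * inner ℝ (euclNormal Ω x) (Y x)) (frontier Ω) := fun x hx => by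
    simp only [(hb1 x hx.1).eq_of_nhds]
  have e2 : EqOn (fun x => b x * ζ x * euclDiv Y x + fderiv ℝ (fun x => b x * ζ x) x (Y x))
      (fun x => ζ x * euclDiv Y x + fderiv ℝ ζ x (Y x)) Ω := fun x hx => by
    simp only [(hb1 x (subset_closure hx)).eq_of_nhds, (hb1 x (subset_closure hx)).fderiv_eq]
  exact ⟨(integrableOn_congr_fun e1 hfm).1 hmain.1, by
    rw [← setIntegral_congr_fun hfm e1, ← setIntegral_congr_fun hΩ.measurableSet e2]
    exact hmain.2⟩

end EuclideanDivergenceTheorem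

/-! ### Logarithmic cutoffs and capacity -/

section DyadicCutoff

open Filter Topology

/-- A smooth step: `0` for `s ≤ 1 / 2` and `1` for `1 ≤ s`. -/
noncomputable def smoothStep (s : ℝ) : ℝ := Real.smoothTransition (2 * s - 1)

theorem contDiff_smoothStep : ContDiff ℝ ∞ smoothStep :=
  Real.smoothTransition.contDiff.comp (by fun_prop)

theorem smoothStep_eq_zero {s : ℝ} (hs : s ≤ 1 / 2) : smoothStep s = 0 :=
  Real.smoothTransition.zero_of_nonpos (by linarith)

theorem smoothStep_eq_one {s : ℝ} (hs : 1 ≤ s) : smoothStep s = 1 :=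
  Real.smoothTransition.one_of_one_le (by linarith)

theorem deriv_smoothStep_eq_zero {s : ℝ} (hs : s ∉ Icc (1 / 2 : ℝ) 1) : deriv smoothStep s = 0 := by
  rw [mem_Icc, not_and_or, not_le, not_le] at hs
  rcases hs with h | h
  · have : smoothStep =ᶠ[𝓝 s] fun _ => 0 := by
      filter_upwards [eventually_lt_nhds h] with t ht using smoothStep_eq_zero ht.le
    rw [this.deriv_eq, deriv_const]
  · have : smoothStep =ᶠ[𝓝 s] fun _ => 1 := by
      filter_upwards [eventually_gt_nhds h] with t ht using smoothStep_eq_one ht.le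
    rw [this.deriv_eq, deriv_const]

theorem exists_bound_deriv_smoothStep : ∃ G : ℝ, ∀ s, |deriv smoothStep s| ≤ G := by
  have hc : HasCompactSupport (deriv smoothStep) :=
    HasCompactSupport.intro isCompact_Icc fun s => deriv_smoothStep_eq_zero
  exact hc.exists_bound_of_continuous (contDiff_smoothStep.continuous_deriv (by simp))

/-- A cutoff function at `0`, the average of the steps at the scales `4 ^ (-j)`,
`k ≤ j ≤ 2 * k`. -/
noncomputable def dyadicCutoff (k : ℕ) (s : ℝ) : ℝ :=
  ((k : ℝ) + 1)⁻¹ * ∑ j ∈ Finset.range (k + 1), smoothStep (4 ^ (k + j) * s)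

theorem contDiff_dyadicCutoff (k : ℕ) : ContDiff ℝ ∞ (dyadicCutoff k) :=
  contDiff_const.mul (ContDiff.sum fun _ _ => contDiff_smoothStep.comp (by fun_prop))

theorem dyadicCutoff_mem_Icc (k : ℕ) (s : ℝ) : dyadicCutoff k s ∈ Icc (0 : ℝ) 1 := by
  have hk : (0 : ℝ) < k + 1 := by positivity
  refine ⟨mul_nonneg (inv_nonneg.2 hk.le)
    (Finset.sum_nonneg fun j _ => Real.smoothTransition.nonneg _), ?_⟩
  rw [dyadicCutoff, inv_mul_le_one₀ hk]
  refine (Finset.sum_le_card_nsmul _ _ 1 fun j _ => Real.smoothTransition.le_one _).trans ?_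
  simp

theorem dyadicCutoff_eq_zero {k : ℕ} {s : ℝ} (hs : 4 ^ (2 * k) * s ≤ 1 / 2) :
    dyadicCutoff k s = 0 := by
  rw [dyadicCutoff, Finset.sum_eq_zero, mul_zero]
  intro j hj
  refine smoothStep_eq_zero ?_
  have hjk : k + j ≤ 2 * k := by have := Finset.mem_range.1 hj; omega
  rcases le_total s 0 with h0 | h0
  · exact (mul_nonpos_of_nonneg_of_nonpos (by positivity) h0).trans (by norm_num)
  · refine le_trans ?_ hs
    gcongr
    norm_num

theorem dyadicCutoff_eq_one {k : ℕ} {s : ℝ} (hs : 1 ≤ 4 ^ k * s) : dyadicCutoff k s = 1 := by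
  have h0 : 0 ≤ s := by
    by_contra hneg
    have : (4 : ℝ) ^ k * s ≤ 0 := mul_nonpos_of_nonneg_of_nonpos (by positivity) (not_le.1 hneg).le
    linarith
  rw [dyadicCutoff, Finset.sum_congr rfl (g := fun _ => (1 : ℝ))]
  · have hk : (0 : ℝ) < k + 1 := by positivity
    simp only [Finset.sum_const, Finset.card_range, nsmul_eq_mul, mul_one]
    push_cast
    exact inv_mul_cancel₀ hk.ne'
  · intro j _
    refine smoothStep_eq_one (hs.trans ?_)
    gcongr
    · norm_num
    · omega

/-- Each step varies only over a factor `2`, while consecutive scales differ by a factor `4`. At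
most one derivative is nonzero at a given `s`, so squaring the sum produces no cross terms; this
gains a power of `k + 1` over the triangle inequality. -/
theorem sq_deriv_dyadicCutoff_le {G : ℝ} (hG : ∀ s, |deriv smoothStep s| ≤ G) (k : ℕ) (s : ℝ) :
    deriv (dyadicCutoff k) s ^ 2 ≤ (((k : ℝ) + 1)⁻¹) ^ 2 * ∑ j ∈ Finset.range (k + 1),
      (if 4 ^ (k + j) * s ≤ 1 then (4 ^ (k + j) * G) ^ 2 else 0) := by
  have hd : HasDerivAt (dyadicCutoff k) (((k : ℝ) + 1)⁻¹ * ∑ j ∈ Finset.range (k + 1),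
      deriv smoothStep (4 ^ (k + j) * s) * 4 ^ (k + j)) s := by
    refine HasDerivAt.const_mul _ (HasDerivAt.fun_sum fun j _ => ?_)
    have h1 : HasDerivAt (fun s : ℝ => (4 : ℝ) ^ (k + j) * s) (4 ^ (k + j)) s := by
      simpa using (hasDerivAt_id s).const_mul ((4 : ℝ) ^ (k + j))
    exact ((contDiff_smoothStep.differentiable (by simp)) _).hasDerivAt.comp s h1
  rw [hd.deriv, mul_pow]
  gcongr
  set a : ℕ → ℝ := fun j => deriv smoothStep (4 ^ (k + j) * s) * 4 ^ (k + j)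
  have ha : ∀ j, a j ^ 2 ≤ if 4 ^ (k + j) * s ≤ 1 then (4 ^ (k + j) * G) ^ 2 else 0 := fun j => by
    split_ifs with h
    · rw [← sq_abs, abs_mul, abs_of_pos (show (0 : ℝ) < 4 ^ (k + j) by positivity), mul_comm]
      gcongr
      exact hG _
    · simp only [a]
      rw [deriv_smoothStep_eq_zero fun hc => h hc.2]; simp
  by_cases hex : ∃ i ∈ Finset.range (k + 1), a i ≠ 0
  · obtain ⟨i, hi, hai⟩ := hex
    have hscale : ∀ j, a j ≠ 0 → 4 ^ (k + j) * s ∈ Icc (1 / 2 : ℝ) 1 := fun j hj => by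
      by_contra hc
      exact hj (by simp only [a]; rw [deriv_smoothStep_eq_zero hc, zero_mul])
    have hs0 : 0 < s := by
      by_contra hneg
      have h1 : (4 : ℝ) ^ (k + i) * s ≤ 0 :=
        mul_nonpos_of_nonneg_of_nonpos (by positivity) (not_lt.1 hneg)
      linarith [(hscale i hai).1]
    have hlt : ∀ j l, j < l → a j ≠ 0 → a l ≠ 0 → False := fun j l hjl hj hl => by
      have h1 := (hscale j hj).1
      have h2 := (hscale l hl).2
      have h3 : (4 : ℝ) ^ (k + j + 1) ≤ 4 ^ (k + l) := pow_le_pow_right₀ (by norm_num) (by omega)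
      rw [pow_succ] at h3
      nlinarith
    have hsum : ∑ j ∈ Finset.range (k + 1), a j = a i := by
      refine Finset.sum_eq_single_of_mem i hi fun j _ hji => ?_
      by_contra hj
      rcases lt_or_gt_of_ne hji with h | h
      · exact hlt j i h hj hai
      · exact hlt i j h hai hj
    change (∑ j ∈ Finset.range (k + 1), a j) ^ 2 ≤ _
    rw [hsum]
    refine (ha i).trans (Finset.single_le_sum (f := fun j =>
      if 4 ^ (k + j) * s ≤ 1 then ((4 : ℝ) ^ (k + j) * G) ^ 2 else 0) (fun j _ => ?_) hi)
    split_ifs <;> positivity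
  · push Not at hex
    change (∑ j ∈ Finset.range (k + 1), a j) ^ 2 ≤ _
    rw [Finset.sum_eq_zero hex]
    refine le_of_eq_of_le (by norm_num) (Finset.sum_nonneg fun j _ => ?_)
    split_ifs <;> positivity

/-- If the sublevel sets `{s ≤ r}` have measure at most `C * r` and `‖∇s‖² ≤ C * s`, as for the
squared distance to a set of codimension two, then the set `{s = 0}` has capacity zero. -/
theorem tendsto_lintegral_sq_fderiv_dyadicCutoff {E : Type*} [NormedAddCommGroup E]
    [NormedSpace ℝ E] [MeasurableSpace E] [BorelSpace E] {μ : Measure E} {A : Set E}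
    (hA : MeasurableSet A) {s : E → ℝ} {C : ℝ}
    (hC : ∀ r : ℝ, 0 < r → μ (A ∩ {x | s x ≤ r}) ≤ ENNReal.ofReal (C * r))
    (h0 : ∀ x ∈ A, 0 ≤ s x) (hd : ∀ x ∈ A, DifferentiableAt ℝ s x)
    (hgrad : ∀ x ∈ A, ‖fderiv ℝ s x‖ ^ 2 ≤ C * s x) :
    Tendsto (fun k : ℕ => ∫⁻ x in A, ‖fderiv ℝ (fun y => dyadicCutoff k (s y)) x‖ₑ ^ 2 ∂μ) atTop
      (𝓝 0) := by
  obtain ⟨G, hG⟩ := exists_bound_deriv_smoothStep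
  have hsc : ContinuousOn s A := fun x hx => (hd x hx).continuousAt.continuousWithinAt
  have hm : ∀ r, MeasurableSet (A ∩ {x | s x ≤ r}) := fun r => by
    obtain ⟨u, hu, hus⟩ := continuousOn_iff_isClosed.1 hsc (Iic r) isClosed_Iic
    have : A ∩ {x | s x ≤ r} = u ∩ A := by rw [← hus, inter_comm]; rfl
    rw [this]
    exact hu.measurableSet.inter hA
  set C' := max C 0
  have hC0 : 0 ≤ C' := le_max_right _ _
  -- the pointwise bound
  have hpt : ∀ k : ℕ, ∀ x ∈ A, ‖fderiv ℝ (fun y => dyadicCutoff k (s y)) x‖ₑ ^ 2 ≤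
      ∑ j ∈ Finset.range (k + 1), (A ∩ {x | s x ≤ ((4 : ℝ) ^ (k + j))⁻¹}).indicator
        (fun _ => ENNReal.ofReal ((((k : ℝ) + 1)⁻¹) ^ 2 * (4 ^ (k + j) * G ^ 2 * C'))) x := by
    intro k x hx
    have hfd : fderiv ℝ (fun y => dyadicCutoff k (s y)) x =
        deriv (dyadicCutoff k) (s x) • fderiv ℝ s x :=
      (((contDiff_dyadicCutoff k).differentiable (by simp) (s x)).hasDerivAt.comp_hasFDerivAt x
        (hd x hx).hasFDerivAt).fderiv
    have h1 : ‖fderiv ℝ (fun y => dyadicCutoff k (s y)) x‖ ^ 2 ≤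
        ∑ j ∈ Finset.range (k + 1), (A ∩ {x | s x ≤ ((4 : ℝ) ^ (k + j))⁻¹}).indicator
        (fun _ => (((k : ℝ) + 1)⁻¹) ^ 2 * (4 ^ (k + j) * G ^ 2 * C')) x := by
      rw [hfd, norm_smul, mul_pow, Real.norm_eq_abs, sq_abs]
      calc _ ≤ ((((k : ℝ) + 1)⁻¹) ^ 2 * ∑ j ∈ Finset.range (k + 1),
            (if 4 ^ (k + j) * s x ≤ 1 then (4 ^ (k + j) * G) ^ 2 else 0)) * ‖fderiv ℝ s x‖ ^ 2 := by
            gcongr; exact sq_deriv_dyadicCutoff_le hG k (s x)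
        _ = ∑ j ∈ Finset.range (k + 1), (((k : ℝ) + 1)⁻¹) ^ 2 *
            ((if 4 ^ (k + j) * s x ≤ 1 then (4 ^ (k + j) * G) ^ 2 else 0) *
              ‖fderiv ℝ s x‖ ^ 2) := by
            rw [Finset.mul_sum, Finset.sum_mul]
            exact Finset.sum_congr rfl fun j _ => by ring
        _ ≤ _ := by
            refine Finset.sum_le_sum fun j _ => ?_
            have h4 : (0 : ℝ) < 4 ^ (k + j) := by positivity
            by_cases hle : 4 ^ (k + j) * s x ≤ 1
            · have hmem : x ∈ A ∩ {x | s x ≤ ((4 : ℝ) ^ (k + j))⁻¹} :=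
                ⟨hx, by rw [mem_ofPred_eq, ← one_div, le_div_iff₀ h4]; linarith⟩
              rw [if_pos hle, indicator_of_mem hmem]
              refine mul_le_mul_of_nonneg_left ?_ (by positivity)
              calc (4 ^ (k + j) * G) ^ 2 * ‖fderiv ℝ s x‖ ^ 2
                  ≤ (4 ^ (k + j) * G) ^ 2 * (C' * ((4 : ℝ) ^ (k + j))⁻¹) := by
                    refine mul_le_mul_of_nonneg_left ((hgrad x hx).trans ?_) (by positivity)
                    exact (mul_le_mul_of_nonneg_right (le_max_left C 0) (h0 x hx)).trans
                      (mul_le_mul_of_nonneg_left hmem.2 hC0)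
                _ = _ := by field_simp
            · rw [if_neg hle, zero_mul, mul_zero]
              refine indicator_nonneg (fun _ _ => by positivity) _
    have h2 : ‖fderiv ℝ (fun y => dyadicCutoff k (s y)) x‖ₑ ^ 2 =
        ENNReal.ofReal (‖fderiv ℝ (fun y => dyadicCutoff k (s y)) x‖ ^ 2) := by
      rw [← ofReal_norm, ENNReal.ofReal_pow (norm_nonneg _)]
    rw [h2]
    refine (ENNReal.ofReal_le_ofReal h1).trans ?_
    rw [ENNReal.ofReal_sum_of_nonneg fun j _ => indicator_nonneg (fun _ _ => by positivity) _]
    refine Finset.sum_le_sum fun j _ => ?_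
    by_cases hmem : x ∈ A ∩ {x | s x ≤ ((4 : ℝ) ^ (k + j))⁻¹}
    · rw [indicator_of_mem hmem, indicator_of_mem hmem]
    · rw [indicator_of_notMem hmem, indicator_of_notMem hmem, ENNReal.ofReal_zero]
  -- At scale `4 ^ (-(k + j))` the squared gradient is of order `4 ^ (k + j)` on a set of measure of
  -- order `4 ^ (-(k + j))`. With the prefactor, every scale contributes the same multiple of `(k +
  -- 1)⁻²`, and there are `k + 1` scales.
  have hbound : ∀ k : ℕ, ∫⁻ x in A, ‖fderiv ℝ (fun y => dyadicCutoff k (s y)) x‖ₑ ^ 2 ∂μ ≤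
      ENNReal.ofReal (((k : ℝ) + 1)⁻¹ * (G ^ 2 * C' ^ 2)) := by
    intro k
    have hk : (0 : ℝ) < k + 1 := by positivity
    calc _ ≤ ∫⁻ x in A, ∑ j ∈ Finset.range (k + 1),
          (A ∩ {x | s x ≤ ((4 : ℝ) ^ (k + j))⁻¹}).indicator
          (fun _ => ENNReal.ofReal ((((k : ℝ) + 1)⁻¹) ^ 2 * (4 ^ (k + j) * G ^ 2 * C'))) x ∂μ :=
          setLIntegral_mono' hA (hpt k)
      _ ≤ ∫⁻ x, ∑ j ∈ Finset.range (k + 1),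
          (A ∩ {x | s x ≤ ((4 : ℝ) ^ (k + j))⁻¹}).indicator
          (fun _ => ENNReal.ofReal ((((k : ℝ) + 1)⁻¹) ^ 2 * (4 ^ (k + j) * G ^ 2 * C'))) x ∂μ :=
          setLIntegral_le_lintegral _ _
      _ = ∑ j ∈ Finset.range (k + 1),
          ENNReal.ofReal ((((k : ℝ) + 1)⁻¹) ^ 2 * (4 ^ (k + j) * G ^ 2 * C')) *
            μ (A ∩ {x | s x ≤ ((4 : ℝ) ^ (k + j))⁻¹}) := by
          rw [lintegral_finsetSum _ fun j _ => measurable_const.indicator (hm _)]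
          exact Finset.sum_congr rfl fun j _ => lintegral_indicator_const (hm _) _
      _ ≤ ∑ j ∈ Finset.range (k + 1),
          ENNReal.ofReal ((((k : ℝ) + 1)⁻¹) ^ 2 * (4 ^ (k + j) * G ^ 2 * C')) *
            ENNReal.ofReal (C' * ((4 : ℝ) ^ (k + j))⁻¹) := by
          gcongr with j _
          refine (hC _ (by positivity)).trans (ENNReal.ofReal_le_ofReal ?_)
          gcongr
          exact le_max_left _ _
      _ = ∑ j ∈ Finset.range (k + 1),
          ENNReal.ofReal ((((k : ℝ) + 1)⁻¹) ^ 2 * (G ^ 2 * C' ^ 2)) := by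
          refine Finset.sum_congr rfl fun j _ => ?_
          rw [← ENNReal.ofReal_mul (by positivity)]
          congr 1
          have h4 : (4 : ℝ) ^ (k + j) ≠ 0 := by positivity
          field_simp
      _ = _ := by
          rw [Finset.sum_const, Finset.card_range, ← ENNReal.ofReal_nsmul, nsmul_eq_mul]
          congr 1
          push_cast
          field_simp
  refine tendsto_of_tendsto_of_tendsto_of_le_of_le tendsto_const_nhds ?_ (fun k => zero_le) hbound
  have : Tendsto (fun k : ℕ => ((k : ℝ) + 1)⁻¹ * (G ^ 2 * C' ^ 2)) atTop (𝓝 (0 * (G ^ 2 * C' ^ 2))) :=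
    (tendsto_inv_atTop_zero.comp
      (tendsto_natCast_atTop_atTop.atTop_add tendsto_const_nhds)).mul_const _
  rw [zero_mul] at this
  simpa [Function.comp_def] using (ENNReal.continuous_ofReal.tendsto 0).comp this

end DyadicCutoff

/-! ### Tubes around sets of codimension two -/

section Tube

open Filter Topology Module

/-- Near a regular point, the `r`-tube around a level set of codimension two has volume `O(r ^ 2)`,
and the level set has Hausdorff dimension two less than the space. -/
theorem exists_isOpen_volume_tube_le {E G : Type*} [NormedAddCommGroup E] [InnerProductSpace ℝ E]
    [FiniteDimensional ℝ E] [MeasurableSpace E] [BorelSpace E] [NormedAddCommGroup G]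
    [InnerProductSpace ℝ G] [FiniteDimensional ℝ G] (hG : finrank ℝ G = 2) {F : E → G} {p : E}
    (hF : ContDiffAt ℝ 1 F p) (hs : Function.Surjective (fderiv ℝ F p)) :
    ∃ V, IsOpen V ∧ p ∈ V ∧ ∃ C : ℝ,
      (∀ r : ℝ, 0 < r → volume (V ∩ {x | ‖F x‖ ^ 2 ≤ r}) ≤ ENNReal.ofReal (C * r)) ∧
      (∀ x ∈ V, DifferentiableAt ℝ F x ∧ ‖fderiv ℝ F x‖ ≤ C) ∧
      ∀ m : ℕ, finrank ℝ E < m + 2 → μHE[m] (V ∩ {x | F x = 0}) = 0 := by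
  let : MeasurableSpace G := borel G
  have : BorelSpace G := ⟨rfl⟩
  set L := fderiv ℝ F p
  set K := L.ker
  -- The orthogonal projection to the kernel of the derivative completes `F` to a map `Φ` with
  -- invertible derivative. It is antilipschitz near `p`, so measures of sets are controlled by
  -- those of their images.
  let P : E →L[ℝ] K := K.orthogonalProjectionOnto
  let A : E ≃L[ℝ] G × K := ContinuousLinearMap.equivProdOfSurjectiveOfIsCompl L P
    (LinearMap.range_eq_top.2 hs)
    (LinearMap.range_eq_top.2 fun z => ⟨z, K.orthogonalProjectionOnto_mem_subspace_eq_self z⟩)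
    (by rw [show P.ker = Kᗮ from K.ker_orthogonalProjectionOnto]
        exact K.isCompl_orthogonal)
  let Φ : E → G × K := fun x => (F x, P x)
  have hΦ : HasStrictFDerivAt Φ (A : E →L[ℝ] G × K) p :=
    (hF.hasStrictFDerivAt one_ne_zero).prodMk P.hasStrictFDerivAt
  obtain ⟨W, hpW, hW, hWA⟩ := hΦ.approximates_deriv_on_open_nhds
  have hEv : ∀ᶠ x in 𝓝 p, x ∈ W ∧ x ∈ Metric.ball p 1 ∧ DifferentiableAt ℝ F x ∧
      ‖fderiv ℝ F x‖ < ‖L‖ + 1 := by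
    refine Eventually.and (hW.mem_nhds hpW) (Eventually.and (Metric.ball_mem_nhds p one_pos)
      (Eventually.and ?_ ?_))
    · exact (hF.eventually (by simp)).mono fun x hx => hx.differentiableAt one_ne_zero
    · exact (hF.fderiv_right (m := 0) (by simp)).continuousAt.norm.eventually_lt_const
        (lt_add_one _)
  obtain ⟨V, hV, hVo, hpV⟩ := eventually_nhds_iff.1 hEv
  have hanti : ∃ k : NNReal, AntilipschitzWith k (V.domRestrict Φ) := by
    refine ⟨_, (hWA.mono_set fun x hx => (hV x hx).1).antilipschitz ?_⟩
    exact A.subsingleton_or_nnnorm_symm_pos.imp id fun h =>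
      NNReal.half_lt_self (ne_of_gt (inv_pos.2 h))
  obtain ⟨k, hk⟩ := hanti
  have hinj : InjOn Φ V := injOn_iff_injective.2 hk.injective
  -- comparison of the measures of a set and of its image
  have himage : ∀ (m : ℕ) (B : Set E), B ⊆ V →
      μHE[m] B ≤ (k : ℝ≥0∞) ^ m * μHE[m] (Φ '' B) := fun m B hB => by
    have hlip : LipschitzOnWith k (Function.invFunOn Φ V) (Φ '' B) := by
      refine LipschitzOnWith.of_dist_le_mul ?_
      rintro _ ⟨x, hx, rfl⟩ _ ⟨y, hy, rfl⟩
      rw [hinj.leftInvOn_invFunOn (hB hx), hinj.leftInvOn_invFunOn (hB hy)]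
      exact hk.le_mul_dist ⟨x, hB hx⟩ ⟨y, hB hy⟩
    have := hlip.euclideanHausdorffMeasure_image_le m
    rwa [(hinj.leftInvOn_invFunOn.mono hB).image_image] at this
  have hdim : finrank ℝ E = finrank ℝ (G × K) := A.toLinearEquiv.finrank_eq
  -- The product carries the maximum norm, so its Hausdorff measure is only a multiple of the
  -- product volume, by uniqueness of Haar measure.
  obtain ⟨c, hc⟩ : ∃ c : NNReal, (μHE[finrank ℝ E] : Measure (G × K)) =
      c • (volume : Measure G).prod (volume : Measure K) := by
    rw [hdim]
    exact ⟨_, Measure.isAddLeftInvariant_eq_smul _ _⟩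
  set b := k ^ finrank ℝ E * (c * ((volume (Metric.ball (0 : G) 1)).toNNReal *
    (volume (Metric.closedBall (P p) 1)).toNNReal))
  refine ⟨V, hVo, hpV, max b (‖L‖ + 1), fun r hr => ?_, fun x hx => ⟨(hV x hx).2.2.1, ?_⟩,
    fun m hm => ?_⟩
  · have hsub : Φ '' (V ∩ {x | ‖F x‖ ^ 2 ≤ r}) ⊆
        Metric.closedBall (0 : G) (√r) ×ˢ Metric.closedBall (P p) 1 := by
      rintro _ ⟨x, ⟨hxV, hx⟩, rfl⟩
      refine ⟨?_, ?_⟩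
      · rw [mem_closedBall_zero_iff]
        exact Real.le_sqrt_of_sq_le hx
      · rw [Metric.mem_closedBall, dist_eq_norm]
        change ‖P x - P p‖ ≤ 1
        rw [← map_sub]
        refine (P.le_of_opNorm_le K.orthogonalProjectionOnto_norm_le _).trans ?_
        rw [one_mul, ← dist_eq_norm]
        exact (hV x hxV).2.1.le
    -- Here codimension two enters: a disc of radius `√r` in `G` has area proportional to `r`.
    have hball : volume (Metric.closedBall (0 : G) (√r)) =
        ENNReal.ofReal r * volume (Metric.ball (0 : G) 1) := by
      rw [Measure.addHaar_closedBall _ _ (Real.sqrt_nonneg r), hG, Real.sq_sqrt hr.le]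
    calc volume (V ∩ {x | ‖F x‖ ^ 2 ≤ r}) = μHE[finrank ℝ E] (V ∩ {x | ‖F x‖ ^ 2 ≤ r}) := by
          rw [InnerProductSpace.euclideanHausdorffMeasure_eq_volume]
      _ ≤ (k : ℝ≥0∞) ^ finrank ℝ E *
          μHE[finrank ℝ E] (Metric.closedBall (0 : G) (√r) ×ˢ Metric.closedBall (P p) 1) :=
          (himage _ _ inter_subset_left).trans (by gcongr)
      _ = ENNReal.ofReal (b * r) := by
          have h1 : volume (Metric.ball (0 : G) 1) ≠ ⊤ := measure_ball_lt_top.ne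
          have h2 : volume (Metric.closedBall (P p) 1) ≠ ⊤ := measure_closedBall_lt_top.ne
          rw [hc, Measure.smul_apply, Measure.prod_prod, hball,
            ENNReal.ofReal_mul (NNReal.coe_nonneg _), ENNReal.ofReal_coe_nnreal]
          simp only [b, ENNReal.coe_mul, ENNReal.coe_pow, ENNReal.coe_toNNReal h1,
            ENNReal.coe_toNNReal h2, ENNReal.smul_def, smul_eq_mul]
          ring
      _ ≤ _ := by
          gcongr
          exact le_max_left _ _
  · exact (hV x hx).2.2.2.le.trans (le_max_right _ _)
  · refine le_antisymm ((himage m _ inter_subset_left).trans ?_) zero_le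
    have hsub : Φ '' (V ∩ {x | F x = 0}) ⊆ (fun z : K => ((0 : G), z)) '' univ := by
      rintro _ ⟨x, ⟨-, hx⟩, rfl⟩
      exact ⟨P x, mem_univ _, Prod.ext (Eq.symm hx) rfl⟩
    have hiso : Isometry fun z : K => ((0 : G), z) := Isometry.of_dist_eq fun x y => by
      simp [Prod.dist_eq]
    -- The zero set is mapped into a copy of `K`, whose dimension is that of `E` minus two.
    have hK : finrank ℝ K < m := by
      rw [finrank_prod, hG] at hdim
      omega
    have hz : (μHE[m] : Measure K) univ = 0 := by
      have : (μH[(m : ℝ)] : Measure K) univ = 0 := by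
        refine hausdorffMeasure_of_dimH_lt (d := m) ?_
        rw [Real.dimH_univ_eq_finrank]
        exact_mod_cast hK
      rw [Measure.euclideanHausdorffMeasure_def, Measure.smul_apply, this, smul_zero]
    calc _ ≤ (k : ℝ≥0∞) ^ m * μHE[m] ((fun z : K => ((0 : G), z)) '' univ) := by gcongr
      _ = 0 := by rw [hiso.euclideanHausdorffMeasure_image, hz, mul_zero]
      _ ≤ 0 := le_rfl

end Tube

/-! ### Codimension-two submanifolds have capacity zero -/

section ZeroCapacity

open Filter Topology Module

theorem enorm_sq_add_le {E : Type*} [NormedAddCommGroup E] [NormedSpace ℝ E] (a b : E →L[ℝ] ℝ) :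
    ‖a + b‖ₑ ^ 2 ≤ 2 * ‖a‖ₑ ^ 2 + 2 * ‖b‖ₑ ^ 2 := by
  have h : ‖a + b‖ ^ 2 ≤ 2 * ‖a‖ ^ 2 + 2 * ‖b‖ ^ 2 := by
    nlinarith [norm_add_le a b, norm_nonneg (a + b), sq_nonneg (‖a‖ - ‖b‖), norm_nonneg a,
      norm_nonneg b]
  have := ENNReal.ofReal_le_ofReal h
  rwa [ENNReal.ofReal_add (by positivity) (by positivity), ENNReal.ofReal_mul zero_le_two,
    ENNReal.ofReal_mul zero_le_two, ENNReal.ofReal_pow (norm_nonneg _),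
    ENNReal.ofReal_pow (norm_nonneg _), ENNReal.ofReal_pow (norm_nonneg _), ofReal_norm, ofReal_norm,
    ofReal_norm, ENNReal.ofReal_ofNat] at this

theorem enorm_smul_sq_le {E : Type*} [NormedAddCommGroup E] [NormedSpace ℝ E] {c : ℝ}
    (hc : c ∈ Icc (0 : ℝ) 1) (a : E →L[ℝ] ℝ) : ‖c • a‖ₑ ^ 2 ≤ ‖a‖ₑ ^ 2 := by
  gcongr
  rw [enorm_le_iff_norm_le, norm_smul, Real.norm_of_nonneg hc.1]
  exact mul_le_of_le_one_left (norm_nonneg a) hc.2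

theorem enorm_zero_sq {E : Type*} [NormedAddCommGroup E] [NormedSpace ℝ E] :
    ‖(0 : E →L[ℝ] ℝ)‖ₑ ^ 2 = 0 := by
  rw [← ofReal_norm, norm_zero, ENNReal.ofReal_zero, zero_pow two_ne_zero]

/-- There are cutoff functions which vanish near `K`, tend to `1` off `S`, and whose Dirichlet
integrals tend to `0`. -/
def HasCutoffs {E : Type*} [NormedAddCommGroup E] [NormedSpace ℝ E] [MeasureSpace E]
    (K S : Set E) : Prop :=
  ∃ ζ : ℕ → E → ℝ, (∀ k, ContDiff ℝ 1 (ζ k)) ∧ (∀ k x, ζ k x ∈ Icc (0 : ℝ) 1) ∧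
    (∀ k, ∀ x ∈ K, ζ k =ᶠ[𝓝 x] 0) ∧ (∀ x ∉ S, ∀ᶠ k in atTop, ζ k x = 1) ∧
    Tendsto (fun k => ∫⁻ x, ‖fderiv ℝ (ζ k) x‖ₑ ^ 2) atTop (𝓝 0)

namespace HasCutoffs

variable {E : Type*} [NormedAddCommGroup E] [NormedSpace ℝ E] [MeasureSpace E] {K K' S S' : Set E}

theorem mono (h : HasCutoffs K S) (hK : K' ⊆ K) (hS : S ⊆ S') : HasCutoffs K' S' := by
  obtain ⟨ζ, h1, h2, h3, h4, h5⟩ := h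
  exact ⟨ζ, h1, h2, fun k x hx => h3 k x (hK hx), fun x hx => h4 x fun hc => hx (hS hc), h5⟩

theorem empty : HasCutoffs (∅ : Set E) S :=
  ⟨fun _ _ => 1, fun _ => contDiff_const, fun _ _ => by simp, fun _ x hx => hx.elim,
    fun _ _ => by simp, by
      have h : ∀ x : E, ‖fderiv ℝ (fun _ : E => (1 : ℝ)) x‖ₑ ^ 2 = 0 := fun x => by
        rw [fderiv_fun_const, Pi.zero_apply, enorm_zero_sq]
      simp only [h, lintegral_zero, tendsto_const_nhds]⟩

/-- Products of the cutoffs serve for the union: since both factors lie in `[0, 1]`, the Dirichlet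
integral of the product is at most twice the sum of the two. -/
theorem union [BorelSpace E] (h : HasCutoffs K S) (h' : HasCutoffs K' S') :
    HasCutoffs (K ∪ K') (S ∪ S') := by
  obtain ⟨ζ, h1, h2, h3, h4, h5⟩ := h
  obtain ⟨ξ, g1, g2, g3, g4, g5⟩ := h'
  refine ⟨fun k x => ζ k x * ξ k x, fun k => (h1 k).mul (g1 k), fun k x =>
    ⟨mul_nonneg (h2 k x).1 (g2 k x).1, mul_le_one₀ (h2 k x).2 (g2 k x).1 (g2 k x).2⟩, ?_, ?_, ?_⟩
  · rintro k x (hx | hx)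
    · filter_upwards [h3 k x hx] with y hy; simp [hy]
    · filter_upwards [g3 k x hx] with y hy; simp [hy]
  · intro x hx
    filter_upwards [h4 x fun hc => hx (Or.inl hc), g4 x fun hc => hx (Or.inr hc)] with k hk hk'
    rw [hk, hk', one_mul]
  · have hb : ∀ k, ∫⁻ x, ‖fderiv ℝ (fun x => ζ k x * ξ k x) x‖ₑ ^ 2 ≤
        2 * (∫⁻ x, ‖fderiv ℝ (ξ k) x‖ₑ ^ 2) + 2 * ∫⁻ x, ‖fderiv ℝ (ζ k) x‖ₑ ^ 2 := fun k => by
      have hm : Continuous fun x => fderiv ℝ (ξ k) x := (g1 k).continuous_fderiv one_ne_zero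
      rw [← lintegral_const_mul' _ _ (by simp), ← lintegral_const_mul' _ _ (by simp),
        ← lintegral_add_left (by fun_prop)]
      refine lintegral_mono fun x => ?_
      rw [fderiv_fun_mul ((h1 k).differentiable one_ne_zero x)
        ((g1 k).differentiable one_ne_zero x)]
      refine (enorm_sq_add_le _ _).trans ?_
      exact add_le_add (mul_le_mul' le_rfl (enorm_smul_sq_le (h2 k x) _))
        (mul_le_mul' le_rfl (enorm_smul_sq_le (g2 k x) _))
    refine tendsto_of_tendsto_of_tendsto_of_le_of_le tendsto_const_nhds ?_ (fun k => zero_le) hb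
    have := (ENNReal.Tendsto.const_mul g5 (Or.inr (by simp : (2 : ℝ≥0∞) ≠ ⊤))).add
      (ENNReal.Tendsto.const_mul h5 (Or.inr (by simp : (2 : ℝ≥0∞) ≠ ⊤)))
    simpa using this

end HasCutoffs

theorem fderiv_norm_sq_comp_le {E G : Type*} [NormedAddCommGroup E] [NormedSpace ℝ E]
    [NormedAddCommGroup G] [InnerProductSpace ℝ G] {F : E → G} {x : E}
    (hF : DifferentiableAt ℝ F x) {C : ℝ} (hC : ‖fderiv ℝ F x‖ ≤ C) :
    ‖fderiv ℝ (fun y => ‖F y‖ ^ 2) x‖ ^ 2 ≤ 4 * C ^ 2 * ‖F x‖ ^ 2 := by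
  have hb : ‖fderiv ℝ (fun y => ‖F y‖ ^ 2) x‖ ≤ 2 * C * ‖F x‖ := by
    refine ContinuousLinearMap.opNorm_le_bound _
      (by have := (norm_nonneg _).trans hC; positivity) fun v => ?_
    rw [hF.hasFDerivAt.norm_sq.fderiv]
    have h1 : ‖inner ℝ (F x) (fderiv ℝ F x v)‖ ≤ ‖F x‖ * (C * ‖v‖) :=
      (norm_inner_le_norm _ _).trans (by gcongr; exact (fderiv ℝ F x).le_of_opNorm_le hC v)
    simp only [smul_apply, ContinuousLinearMap.comp_apply, innerSL_apply_apply,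
      nsmul_eq_mul, norm_mul]
    norm_num at h1 ⊢
    linarith
  calc _ ≤ (2 * C * ‖F x‖) ^ 2 := by gcongr
    _ = _ := by ring

/-- For a local defining map `F`, the function `s = ‖F‖²` satisfies the hypotheses of the capacity
estimate: tubes have volume `O(r)`, and `|∇s|² ≤ 4 C² s`. The cutoffs `D k` in `s` are glued to `1`
by a bump function `χ`, as `1 - χ * (1 - D k)`. The gluing costs the gradient of `χ` on `{s ≤ 4 ^
(-k)}`, whose volume tends to zero. -/
theorem IsSmoothSubmanifold.exists_nhds_hasCutoffs {n : ℕ} {S : Set (EuclideanSpace ℝ (Fin n))}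
    (hS : IsSmoothSubmanifold 2 S) {p : EuclideanSpace ℝ (Fin n)} (hp : p ∈ S) :
    ∃ t ∈ 𝓝 p, HasCutoffs (t ∩ S) S := by
  obtain ⟨U, F, hpU, hU, hF, hsurj, hSU⟩ := hS p hp
  have hFd : ∀ x ∈ U, ContDiffAt ℝ 1 F x := fun x hx =>
    (hF.contDiffAt (hU.mem_nhds hx)).of_le (by simp)
  obtain ⟨V', hV'o, hpV', C, hvol', hder', -⟩ := exists_isOpen_volume_tube_le (by simp)
    (hFd p hpU) (hsurj p hpU)
  set V := V' ∩ U
  have hVo : IsOpen V := hV'o.inter hU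
  obtain ⟨r, hr, hrV⟩ := Metric.nhds_basis_closedBall.mem_iff.1 (hVo.mem_nhds ⟨hpV', hpU⟩)
  let χ : ContDiffBump p := ⟨r / 2, r, by positivity, by linarith⟩
  have hχs : tsupport χ ⊆ V := by rw [χ.tsupport_eq]; exact hrV
  have hχd : ContDiff ℝ 1 χ := χ.contDiff
  obtain ⟨G, hG⟩ : ∃ G, ∀ x, ‖fderiv ℝ χ x‖ ≤ G :=
    (χ.hasCompactSupport.fderiv (𝕜 := ℝ)).exists_bound_of_continuous
      (hχd.continuous_fderiv one_ne_zero)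
  set s : EuclideanSpace ℝ (Fin n) → ℝ := fun x => ‖F x‖ ^ 2
  set C' := max C (4 * C ^ 2)
  have hsd : ∀ x ∈ V, ContDiffAt ℝ 1 s x := fun x hx => (hFd x hx.2).norm_sq ℝ
  have hvol : ∀ r : ℝ, 0 < r → volume (V ∩ {x | s x ≤ r}) ≤ ENNReal.ofReal (C' * r) := fun r hr =>
    (measure_mono (inter_subset_inter_left _ inter_subset_left)).trans ((hvol' r hr).trans
      (ENNReal.ofReal_le_ofReal (by gcongr; exact le_max_left _ _)))
  have hlim := tendsto_lintegral_sq_fderiv_dyadicCutoff (μ := volume) hVo.measurableSet hvol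
    (fun x _ => by positivity) (fun x hx => (hsd x hx).differentiableAt one_ne_zero)
    (fun x hx => (fderiv_norm_sq_comp_le (hder' x hx.1).1 (hder' x hx.1).2).trans
      (by gcongr; exact le_max_right _ _))
  set D : ℕ → EuclideanSpace ℝ (Fin n) → ℝ := fun k x => dyadicCutoff k (s x)
  have hDd : ∀ k, ∀ x ∈ V, ContDiffAt ℝ 1 (D k) x := fun k x hx =>
    ((contDiff_dyadicCutoff k).of_le (by simp)).contDiffAt.comp x (hsd x hx)
  have hD : ∀ k x, D k x ∈ Icc (0 : ℝ) 1 := fun k x => dyadicCutoff_mem_Icc k _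
  set ζ : ℕ → EuclideanSpace ℝ (Fin n) → ℝ := fun k x => 1 - χ x * (1 - D k x)
  have hoff : ∀ k, ∀ x ∉ V, ζ k =ᶠ[𝓝 x] fun _ => 1 := fun k x hx => by
    filter_upwards [notMem_tsupport_iff_eventuallyEq.1 fun hc => hx (hχs hc)] with y hy
    simp [ζ, hy]
  refine ⟨Metric.ball p (r / 2), Metric.ball_mem_nhds p (by positivity), ζ, fun k => ?_,
    fun k x => ?_, fun k x hx => ?_, fun x hx => ?_, ?_⟩
  · refine contDiff_iff_contDiffAt.2 fun x => ?_
    by_cases hx : x ∈ V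
    · exact contDiffAt_const.sub (hχd.contDiffAt.mul (contDiffAt_const.sub (hDd k x hx)))
    · exact contDiffAt_const.congr_of_eventuallyEq (hoff k x hx)
  · have h1 : χ x * (1 - D k x) ≤ 1 :=
      mul_le_one₀ χ.le_one (by linarith [(hD k x).2]) (by linarith [(hD k x).1])
    have h2 : 0 ≤ χ x * (1 - D k x) := mul_nonneg χ.nonneg (by linarith [(hD k x).2])
    exact ⟨by simp only [ζ]; linarith, by simp only [ζ]; linarith⟩
  · have hxV : x ∈ V := hrV (Metric.ball_subset_closedBall.trans
      (Metric.closedBall_subset_closedBall (by linarith)) hx.1)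
    have hx0 : F x = 0 := by
      have : x ∈ {x ∈ U | F x = 0} := hSU ▸ ⟨hx.2, hxV.2⟩
      exact this.2
    have hc : ContinuousAt (fun y => (4 : ℝ) ^ (2 * k) * s y) x :=
      continuousAt_const.mul (hsd x hxV).continuousAt
    have hlt : ∀ᶠ y in 𝓝 x, (4 : ℝ) ^ (2 * k) * s y < 1 / 2 :=
      hc.eventually_lt_const (by simp [s, hx0])
    filter_upwards [hlt, Metric.isOpen_ball.mem_nhds hx.1] with y hy hyb
    simp only [ζ, D, dyadicCutoff_eq_zero hy.le,
      χ.one_of_mem_closedBall (Metric.ball_subset_closedBall hyb)]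
    simp
  · by_cases hxV : x ∈ V
    · have hx0 : F x ≠ 0 := fun h0 => hx (by
        have : x ∈ S ∩ U := by rw [hSU]; exact ⟨hxV.2, h0⟩
        exact this.1)
      have hs0 : 0 < s x := by positivity
      have : Tendsto (fun k : ℕ => (4 : ℝ) ^ k * s x) atTop atTop :=
        (tendsto_pow_atTop_atTop_of_one_lt (by norm_num)).atTop_mul_const hs0
      filter_upwards [this.eventually_ge_atTop 1] with k hk
      simp [ζ, D, dyadicCutoff_eq_one hk]
    · exact Eventually.of_forall fun k => (hoff k x hxV).eq_of_nhds
  · have hb : ∀ k, ∫⁻ x, ‖fderiv ℝ (ζ k) x‖ₑ ^ 2 ≤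
        2 * (ENNReal.ofReal G ^ 2 * ENNReal.ofReal (C' * ((4 : ℝ) ^ k)⁻¹)) +
          2 * ∫⁻ x in V, ‖fderiv ℝ (D k) x‖ₑ ^ 2 := fun k => by
      have hm : MeasurableSet (V ∩ {x | s x ≤ ((4 : ℝ) ^ k)⁻¹}) := by
        have hsc : ContinuousOn s V := fun x hx => (hsd x hx).continuousAt.continuousWithinAt
        obtain ⟨u, hu, hus⟩ := continuousOn_iff_isClosed.1 hsc (Iic ((4 : ℝ) ^ k)⁻¹) isClosed_Iic
        have : V ∩ {x | s x ≤ ((4 : ℝ) ^ k)⁻¹} = u ∩ V := by rw [← hus, inter_comm]; rfl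
        rw [this]
        exact hu.measurableSet.inter hVo.measurableSet
      have hpt : ∀ x, ‖fderiv ℝ (ζ k) x‖ₑ ^ 2 ≤
          (V ∩ {x | s x ≤ ((4 : ℝ) ^ k)⁻¹}).indicator (fun _ => 2 * ENNReal.ofReal G ^ 2) x +
            2 * V.indicator (fun x => ‖fderiv ℝ (D k) x‖ₑ ^ 2) x := fun x => by
        by_cases hxV : x ∈ V
        · have hd : fderiv ℝ (ζ k) x =
              -((1 - D k x) • fderiv ℝ χ x) + χ x • fderiv ℝ (D k) x := by
            have h1 := (hDd k x hxV).differentiableAt one_ne_zero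
            have h2 := hχd.differentiable one_ne_zero x
            have h3 : DifferentiableAt ℝ (fun x => 1 - D k x) x := h1.const_sub 1
            simp only [ζ]
            rw [fderiv_const_sub, fderiv_fun_mul h2 h3, fderiv_const_sub]
            module
          rw [hd, indicator_of_mem hxV]
          refine (enorm_sq_add_le _ _).trans ?_
          refine add_le_add ?_ (mul_le_mul' le_rfl ?_)
          · rw [enorm_neg]
            by_cases hxs : s x ≤ ((4 : ℝ) ^ k)⁻¹
            · rw [indicator_of_mem (show x ∈ V ∩ {x | s x ≤ ((4 : ℝ) ^ k)⁻¹} from ⟨hxV, hxs⟩)]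
              refine mul_le_mul' le_rfl ?_
              refine (enorm_smul_sq_le ⟨by linarith [(hD k x).2], by linarith [(hD k x).1]⟩ _).trans
                ?_
              gcongr
              rw [← ofReal_norm]
              exact ENNReal.ofReal_le_ofReal (hG x)
            · have : D k x = 1 := dyadicCutoff_eq_one (by
                have h4 : (0 : ℝ) < 4 ^ k := by positivity
                have := mul_le_mul_of_nonneg_left (not_le.1 hxs).le h4.le
                rwa [mul_inv_cancel₀ h4.ne'] at this)
              rw [this, sub_self, zero_smul, enorm_zero_sq, mul_zero]
              exact zero_le
          · exact enorm_smul_sq_le ⟨χ.nonneg, χ.le_one⟩ _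
        · rw [(hoff k x hxV).fderiv_eq, fderiv_fun_const, Pi.zero_apply, enorm_zero_sq]
          exact zero_le
      refine (lintegral_mono hpt).trans ?_
      rw [lintegral_add_left (measurable_const.indicator hm), lintegral_indicator_const hm,
        lintegral_const_mul' _ _ (by simp), lintegral_indicator hVo.measurableSet, ← mul_assoc]
      gcongr
      exact hvol _ (by positivity)
    refine tendsto_of_tendsto_of_tendsto_of_le_of_le tendsto_const_nhds ?_ (fun k => zero_le) hb
    have h1 : Tendsto (fun k : ℕ => ENNReal.ofReal (C' * ((4 : ℝ) ^ k)⁻¹)) atTop (𝓝 0) := by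
      have : Tendsto (fun k : ℕ => C' * ((4 : ℝ) ^ k)⁻¹) atTop (𝓝 (C' * 0)) :=
        (tendsto_inv_atTop_zero.comp
          (tendsto_pow_atTop_atTop_of_one_lt (by norm_num))).const_mul _
      rw [mul_zero] at this
      simpa [Function.comp_def] using (ENNReal.continuous_ofReal.tendsto 0).comp this
    have h2 := (ENNReal.Tendsto.const_mul (ENNReal.Tendsto.const_mul h1
      (Or.inr (by finiteness : ENNReal.ofReal G ^ 2 ≠ ⊤)))
      (Or.inr (by simp : (2 : ℝ≥0∞) ≠ ⊤))).add
      (ENNReal.Tendsto.const_mul hlim (Or.inr (by simp : (2 : ℝ≥0∞) ≠ ⊤)))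
    simpa using h2

/-- Compact subsets of submanifolds of codimension two have capacity zero. -/
theorem IsSmoothSubmanifold.hasCutoffs {n : ℕ} {S K : Set (EuclideanSpace ℝ (Fin n))}
    (hS : IsSmoothSubmanifold 2 S) (hK : IsCompact K) (hKS : K ⊆ S) : HasCutoffs K S := by
  refine hK.induction_on (p := fun K => HasCutoffs K S) HasCutoffs.empty
    (fun s t hst ht => ht.mono hst le_rfl)
    (fun s t hs ht => (hs.union ht).mono le_rfl (union_self S).le) fun x hx => ?_
  obtain ⟨t, ht, htc⟩ := hS.exists_nhds_hasCutoffs (hKS hx)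
  exact ⟨t ∩ K, inter_mem (mem_nhdsWithin_of_mem_nhds ht) self_mem_nhdsWithin,
    htc.mono (inter_subset_inter_right _ hKS) le_rfl⟩

theorem IsSmoothSubmanifold.measure_eq_zero {n m : ℕ} {S : Set (EuclideanSpace ℝ (Fin n))}
    (hS : IsSmoothSubmanifold 2 S) (hm : n < m + 2) : μHE[m] S = 0 := by
  refine measure_null_of_locally_null _ fun p hp => ?_
  obtain ⟨U, F, hpU, hU, hF, hsurj, hSU⟩ := hS p hp
  obtain ⟨V, hVo, hpV, C, -, -, hnull⟩ := exists_isOpen_volume_tube_le (by simp)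
    ((hF.contDiffAt (hU.mem_nhds hpU)).of_le (by simp)) (hsurj p hpU)
  refine ⟨S ∩ (U ∩ V), inter_mem self_mem_nhdsWithin
    (mem_nhdsWithin_of_mem_nhds ((hU.inter hVo).mem_nhds ⟨hpU, hpV⟩)),
    measure_mono_null (fun x hx => ?_) (hnull m (by simpa using hm))⟩
  have : x ∈ {x ∈ U | F x = 0} := hSU ▸ ⟨hx.1, hx.2.1⟩
  exact ⟨hx.2.2, this.2⟩

end ZeroCapacity

/-! ### The metric as a pull-back of the Euclidean inner product -/

section MetricFrame

open Filter Topology Module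

variable {n : ℕ}

/-- The linear map fixing the radial direction at `x` and multiplying the vectors orthogonal to it
by `a`. At `x = 0` all vectors are multiplied by `a`. -/
noncomputable def radialStretch (a : ℝ) (x : EuclideanSpace ℝ (Fin n)) :
    EuclideanSpace ℝ (Fin n) →ₗ[ℝ] EuclideanSpace ℝ (Fin n) where
  toFun v := a • v + ((1 - a) * inner ℝ (‖x‖⁻¹ • x) v) • (‖x‖⁻¹ • x)
  map_add' v w := by rw [inner_add_right]; module
  map_smul' c v := by rw [inner_smul_right, RingHom.id_apply]; module

theorem radialStretch_apply (a : ℝ) (x v : EuclideanSpace ℝ (Fin n)) :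
    radialStretch a x v = a • v + ((1 - a) * inner ℝ (‖x‖⁻¹ • x) v) • (‖x‖⁻¹ • x) := rfl

theorem inner_radial_self {x : EuclideanSpace ℝ (Fin n)} (hx : x ≠ 0) :
    inner ℝ (‖x‖⁻¹ • x) (‖x‖⁻¹ • x) = (1 : ℝ) := by
  rw [real_inner_self_eq_norm_sq, norm_smul, norm_inv, norm_norm,
    inv_mul_cancel₀ (norm_ne_zero_iff.2 hx), one_pow]

theorem inner_radialStretch_comm (a : ℝ) (x v w : EuclideanSpace ℝ (Fin n)) :
    inner ℝ (radialStretch a x v) w = inner ℝ v (radialStretch a x w) := by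
  simp only [radialStretch_apply, inner_add_left, inner_add_right, real_inner_smul_left,
    inner_smul_right, real_inner_comm v]
  ring

theorem radialStretch_radialStretch (a b : ℝ) (x v : EuclideanSpace ℝ (Fin n)) :
    radialStretch a x (radialStretch b x v) = radialStretch (a * b) x v := by
  by_cases hx : x = 0
  · simp [radialStretch_apply, hx, mul_smul, smul_comm b a v]
  · have h := inner_radial_self hx
    simp only [radialStretch_apply]
    generalize ‖x‖⁻¹ • x = r at *
    simp only [inner_add_right, inner_smul_right, h]
    module

theorem radialStretch_one (x v : EuclideanSpace ℝ (Fin n)) : radialStretch 1 x v = v := by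
  simp [radialStretch_apply]

/-- The map is `a` times the rank-one perturbation of the identity along the radial direction with
determinant `1 + a⁻¹ * (1 - a) = a⁻¹`; the scalar contributes `a ^ (d + 1)`. -/
theorem det_radialStretch {d : ℕ} {a : ℝ} (ha : a ≠ 0) {x : EuclideanSpace ℝ (Fin (d + 1))}
    (hx : x ≠ 0) : LinearMap.det (radialStretch a x) = a ^ d := by
  set r := ‖x‖⁻¹ • x
  have h : radialStretch a x =
      a • LinearMap.transvection ((a⁻¹ * (1 - a)) • innerₗ (EuclideanSpace ℝ (Fin (d + 1))) r) r := by
    refine LinearMap.ext fun v => ?_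
    rw [radialStretch_apply, LinearMap.smul_apply, LinearMap.transvection.apply, smul_add,
      LinearMap.smul_apply, innerₗ_apply_apply, smul_smul a, smul_eq_mul, ← mul_assoc, ← mul_assoc,
      mul_inv_cancel₀ ha, one_mul]
  rw [h, LinearMap.det_smul, LinearMap.transvection.det, LinearMap.smul_apply, innerₗ_apply_apply,
    inner_radial_self hx]
  simp only [finrank_euclideanSpace, Fintype.card_fin, smul_eq_mul]
  field_simp
  ring

namespace ModelSpace

variable (M : ModelSpace)

theorem metric_apply (x v w : EuclideanSpace ℝ (Fin n)) :
    M.metric x v w = inner ℝ v (‖x‖⁻¹ • x) * inner ℝ w (‖x‖⁻¹ • x) +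
        M.angularFactor x ^ 2 *
          (inner ℝ v w - inner ℝ v (‖x‖⁻¹ • x) * inner ℝ w (‖x‖⁻¹ • x)) := rfl

/-- The linear map from the tangent space at `x` with the Riemannian metric to the Euclidean space,
an isometry. -/
noncomputable def frame (x : EuclideanSpace ℝ (Fin n)) :
    EuclideanSpace ℝ (Fin n) →ₗ[ℝ] EuclideanSpace ℝ (Fin n) :=
  radialStretch (M.angularFactor x) x

/-- The frame is self-adjoint, and its square is the stretch by the squared angular factor. At the
pole the radial vector reads as `0` and the factor as `1`, which gives the Euclidean inner product.
-/
theorem metric_eq_inner_frame (x v w : EuclideanSpace ℝ (Fin n)) :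
    M.metric x v w = inner ℝ (M.frame x v) (M.frame x w) := by
  rw [frame, inner_radialStretch_comm, radialStretch_radialStretch, metric_apply,
    radialStretch_apply]
  generalize ‖x‖⁻¹ • x = r
  rw [inner_add_right, inner_smul_right, inner_smul_right, real_inner_comm r w]
  ring

theorem metric_comm (x v w : EuclideanSpace ℝ (Fin n)) : M.metric x v w = M.metric x w v := by
  rw [metric_eq_inner_frame, metric_eq_inner_frame, real_inner_comm]

theorem normAt_eq_norm_frame (x v : EuclideanSpace ℝ (Fin n)) : M.normAt x v = ‖M.frame x v‖ := by
  rw [normAt, metric_eq_inner_frame, real_inner_self_eq_norm_sq, Real.sqrt_sq (norm_nonneg _)]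

/-- This covers both densities: with `T` the identity it is the volume density, with `T` the
inclusion of the tangent hyperplane the area density. -/
theorem sqrt_det_gram_eq_normDet {V : Type*} [NormedAddCommGroup V] [InnerProductSpace ℝ V]
    [FiniteDimensional ℝ V] {ι : Type*} [Fintype ι] [DecidableEq ι] (b : OrthonormalBasis ι ℝ V)
    (x : EuclideanSpace ℝ (Fin n)) (T : V →ₗ[ℝ] EuclideanSpace ℝ (Fin n)) :
    Real.sqrt (Matrix.det (Matrix.of fun i j => M.metric x (T (b i)) (T (b j)))) =
      (M.frame x ∘ₗ T).normDet := by
  have h : (Matrix.of fun i j => M.metric x (T (b i)) (T (b j))) =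
      Matrix.gram ℝ fun i => (M.frame x ∘ₗ T) (b i) := by
    ext i j
    rw [Matrix.of_apply, metric_eq_inner_frame, Matrix.gram_apply]
    rfl
  rw [h, ← LinearMap.normDet_sq_eq_det_gram (M.frame x ∘ₗ T) b]
  exact Real.sqrt_sq (LinearMap.normDet_nonneg _)

theorem volDensity_eq_abs_det (x : EuclideanSpace ℝ (Fin n)) :
    M.volDensity x = |LinearMap.det (M.frame x)| := by
  have := M.sqrt_det_gram_eq_normDet (EuclideanSpace.basisFun (Fin n) ℝ) x LinearMap.id
  rw [LinearMap.comp_id, LinearMap.normDet_eq_abs_det] at this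
  rw [← this, volDensity]
  simp

theorem isOpen_carrier : IsOpen (M.carrier n) := isOpen_lt continuous_enorm continuous_const

theorem angularFactor_pos {x : EuclideanSpace ℝ (Fin n)} (hx : x ∈ M.carrier n) :
    0 < M.angularFactor x := by
  unfold angularFactor
  split_ifs with h
  · exact one_pos
  · exact div_pos (M.pos _ (norm_pos_iff.2 h) (by rw [ofReal_norm]; exact hx)) (norm_pos_iff.2 h)

theorem contDiffAt_angularFactor {x : EuclideanSpace ℝ (Fin n)} (hx : x ≠ 0) :
    ContDiffAt ℝ ∞ (M.angularFactor (n := n)) x := by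
  have h : ContDiffAt ℝ ∞ (fun y : EuclideanSpace ℝ (Fin n) => M.ψ ‖y‖ / ‖y‖) x :=
    (M.smooth.contDiffAt.comp x (contDiffAt_norm ℝ hx)).div (contDiffAt_norm ℝ hx)
      (norm_ne_zero_iff.2 hx)
  refine h.congr_of_eventuallyEq ?_
  filter_upwards [isOpen_ne.mem_nhds hx] with y hy
  exact if_neg hy

theorem ψ_zero : M.ψ 0 = 0 := by
  have := M.odd 0
  rw [neg_zero] at this
  linarith

/-- Off the pole the factor is smooth. At the pole, `ψ(r) / r` is the difference quotient of `ψ` at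
`0`, with limit `ψ'(0) = 1`. Continuity suffices there, because `Ω` avoids the pole. -/
theorem continuous_angularFactor : Continuous (M.angularFactor (n := n)) := by
  refine continuous_iff_continuousAt.2 fun x => ?_
  by_cases hx : x = 0
  · subst hx
    have hd : HasDerivAt M.ψ 1 0 := by
      rw [← M.deriv_zero]
      exact ((M.smooth.differentiable (by simp)) 0).hasDerivAt
    rw [continuousAt_iff_punctured_nhds]
    have h1 : Tendsto (fun y : EuclideanSpace ℝ (Fin n) => ‖y‖) (𝓝[≠] 0) (𝓝[≠] 0) :=
      tendsto_nhdsWithin_iff.2 ⟨by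
        simpa using (continuous_norm (E := EuclideanSpace ℝ (Fin n))).continuousWithinAt.tendsto
          (x := 0) (s := {0}ᶜ), by
        filter_upwards [self_mem_nhdsWithin] with y hy
        exact norm_ne_zero_iff.2 hy⟩
    have h2 := (hasDerivAt_iff_tendsto_slope.1 hd).comp h1
    have h3 : M.angularFactor (0 : EuclideanSpace ℝ (Fin n)) = 1 := if_pos rfl
    rw [h3]
    refine h2.congr' ?_
    filter_upwards [self_mem_nhdsWithin] with y hy
    rw [Function.comp_apply, slope_def_field, M.ψ_zero, sub_zero, sub_zero]
    exact (if_neg hy).symm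
  · exact (M.contDiffAt_angularFactor hx).continuousAt

theorem volDensity_eq {d : ℕ} {x : EuclideanSpace ℝ (Fin (d + 1))}
    (hx : x ∈ M.carrier (d + 1)) : M.volDensity x = M.angularFactor x ^ d := by
  have ha := M.angularFactor_pos hx
  rw [volDensity_eq_abs_det, frame]
  by_cases h0 : x = 0
  · have h1 : M.angularFactor x = 1 := if_pos h0
    have : radialStretch 1 x = LinearMap.id := LinearMap.ext fun v => radialStretch_one x v
    rw [h1, this, LinearMap.det_id, abs_one, one_pow]
  · rw [det_radialStretch ha.ne' h0, abs_of_pos (by positivity)]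

theorem volDensity_pos {d : ℕ} {x : EuclideanSpace ℝ (Fin (d + 1))}
    (hx : x ∈ M.carrier (d + 1)) : 0 < M.volDensity x := by
  rw [M.volDensity_eq hx]
  exact pow_pos (M.angularFactor_pos hx) d

theorem continuousOn_volDensity {d : ℕ} :
    ContinuousOn (M.volDensity (n := d + 1)) (M.carrier (d + 1)) :=
  (M.continuous_angularFactor.pow d).continuousOn.congr fun _ hx => M.volDensity_eq hx

theorem contDiffAt_volDensity {d : ℕ} {x : EuclideanSpace ℝ (Fin (d + 1))}
    (hx : x ∈ M.carrier (d + 1)) (h0 : x ≠ 0) : ContDiffAt ℝ ∞ (M.volDensity (n := d + 1)) x := by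
  refine ((M.contDiffAt_angularFactor h0).pow d).congr_of_eventuallyEq ?_
  filter_upwards [M.isOpen_carrier.mem_nhds hx] with y hy using M.volDensity_eq hy

/-- The frame preserves the radial component, so no angular factor enters. This keeps radial cutoffs
usable near the antipode, where that factor degenerates. -/
theorem abs_inner_radial_le_normAt (x v : EuclideanSpace ℝ (Fin n)) :
    |inner ℝ (‖x‖⁻¹ • x) v| ≤ M.normAt x v := by
  by_cases hx : x = 0
  · simp [hx, normAt_eq_norm_frame]
  have h : inner ℝ (‖x‖⁻¹ • x) (M.frame x v) = inner ℝ (‖x‖⁻¹ • x) v := by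
    rw [frame, radialStretch_apply, inner_add_right, inner_smul_right, inner_smul_right,
      inner_radial_self hx]
    ring
  rw [normAt_eq_norm_frame, ← h]
  refine (abs_real_inner_le_norm _ _).trans ?_
  rw [norm_smul, norm_inv, norm_norm, inv_mul_cancel₀ (norm_ne_zero_iff.2 hx), one_mul]

/-- The inverse of the frame is the stretch by `a⁻¹`, of norm at most `a⁻¹ + |1 - a⁻¹| ≤ 1 + 2 *
a⁻¹`. The constant is bounded on compact subsets of the coordinate ball. -/
theorem norm_le_mul_normAt {x : EuclideanSpace ℝ (Fin n)} (hx : 0 < M.angularFactor x)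
    (v : EuclideanSpace ℝ (Fin n)) : ‖v‖ ≤ (1 + 2 * (M.angularFactor x)⁻¹) * M.normAt x v := by
  set a := M.angularFactor x
  have h : v = a⁻¹ • M.frame x v + ((1 - a⁻¹) * inner ℝ (‖x‖⁻¹ • x) (M.frame x v)) • (‖x‖⁻¹ • x) := by
    rw [← radialStretch_apply, frame, radialStretch_radialStretch, inv_mul_cancel₀ hx.ne',
      radialStretch_one]
  have hr : ‖‖x‖⁻¹ • x‖ ≤ 1 := by
    rw [norm_smul, norm_inv, norm_norm]
    exact inv_mul_le_one
  have ha : 0 < a⁻¹ := inv_pos.2 hx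
  have h1 : |1 - a⁻¹| ≤ 1 + a⁻¹ := abs_le.2 ⟨by linarith, by linarith⟩
  have h2 : |inner ℝ (‖x‖⁻¹ • x) (M.frame x v)| ≤ ‖M.frame x v‖ :=
    (abs_real_inner_le_norm _ _).trans (mul_le_of_le_one_left (norm_nonneg _) hr)
  rw [normAt_eq_norm_frame]
  calc ‖v‖ ≤ a⁻¹ * ‖M.frame x v‖ +
        |1 - a⁻¹| * |inner ℝ (‖x‖⁻¹ • x) (M.frame x v)| * ‖‖x‖⁻¹ • x‖ := by
        conv_lhs => rw [h]
        refine (norm_add_le _ _).trans_eq ?_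
        rw [norm_smul, norm_smul _ (‖x‖⁻¹ • x), norm_mul, Real.norm_of_nonneg ha.le]
        rfl
    _ ≤ a⁻¹ * ‖M.frame x v‖ + (1 + a⁻¹) * ‖M.frame x v‖ * 1 := by gcongr
    _ = _ := by ring

end ModelSpace

end MetricFrame

/-! ### The Riemannian normal and the area density -/

section RiemannianNormal

open Filter Topology Module

namespace ModelSpace

variable (M : ModelSpace) {n : ℕ} {Ω U : Set (EuclideanSpace ℝ (Fin n))}
  {φ : EuclideanSpace ℝ (Fin n) → ℝ} {p : EuclideanSpace ℝ (Fin n)}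

/-- The inverse of the map `frame`. -/
noncomputable def coframe (x : EuclideanSpace ℝ (Fin n)) :
    EuclideanSpace ℝ (Fin n) →ₗ[ℝ] EuclideanSpace ℝ (Fin n) :=
  radialStretch (M.angularFactor x)⁻¹ x

theorem frame_coframe (hp : p ∈ M.carrier n) (v : EuclideanSpace ℝ (Fin n)) :
    M.frame p (M.coframe p v) = v := by
  rw [frame, coframe, radialStretch_radialStretch, mul_inv_cancel₀ (M.angularFactor_pos hp).ne',
    radialStretch_one]

theorem inner_coframe_frame (hp : p ∈ M.carrier n) (v w : EuclideanSpace ℝ (Fin n)) :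
    inner ℝ (M.coframe p v) (M.frame p w) = inner ℝ v w := by
  rw [frame, ← inner_radialStretch_comm, ← frame, frame_coframe M hp]

/-- The dual Riemannian norm of the Euclidean unit normal, as a covector. -/
noncomputable def conormalNorm (Ω : Set (EuclideanSpace ℝ (Fin n)))
    (p : EuclideanSpace ℝ (Fin n)) : ℝ :=
  ‖M.coframe p (euclNormal Ω p)‖

theorem coframe_euclNormal_ne_zero (hp : p ∈ M.carrier n) (h : IsDefiningFunction Ω U φ)
    (hpU : p ∈ U) (h0 : φ p = 0) : M.coframe p (euclNormal Ω p) ≠ 0 := fun hc => by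
  have h1 := M.frame_coframe hp (euclNormal Ω p)
  rw [hc, map_zero] at h1
  have h2 := norm_euclNormal h hpU h0
  rw [← h1, norm_zero] at h2
  exact zero_ne_one h2

theorem conormalNorm_pos (hp : p ∈ M.carrier n) (h : IsDefiningFunction Ω U φ)
    (hpU : p ∈ U) (h0 : φ p = 0) : 0 < M.conormalNorm Ω p :=
  norm_pos_iff.2 (M.coframe_euclNormal_ne_zero hp h hpU h0)

theorem exists_isOutwardUnitNormal (hp : p ∈ M.carrier n) (h : IsDefiningFunction Ω U φ)
    (hpU : p ∈ U) (h0 : φ p = 0) : ∃ ν, M.IsOutwardUnitNormal Ω p ν := by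
  have hN := M.conormalNorm_pos hp h hpU h0
  set N := M.conormalNorm Ω p
  have hφ : 0 < ‖fderiv ℝ φ p‖ := norm_pos_iff.2 (h.fderiv_ne_zero p hpU)
  refine ⟨N⁻¹ • M.coframe p (M.coframe p (euclNormal Ω p)), U, φ, hpU, h, h0, ?_,
    N⁻¹ * ‖fderiv ℝ φ p‖⁻¹, by positivity, fun v => ?_⟩
  · rw [metric_eq_inner_frame, map_smul, M.frame_coframe hp, real_inner_self_eq_norm_sq, norm_smul,
      norm_inv, Real.norm_of_nonneg hN.le]
    change (N⁻¹ * N) ^ 2 = 1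
    rw [inv_mul_cancel₀ hN.ne', one_pow]
  · rw [metric_eq_inner_frame, map_smul, M.frame_coframe hp, real_inner_smul_left,
      M.inner_coframe_frame hp, inner_euclNormal h hpU h0, mul_assoc]

/-- The covector of `ν` is a positive multiple of the Euclidean conormal, and unit length fixes the
multiple. So any choice of unit normal yields the same covector. -/
theorem IsOutwardUnitNormal.metric_eq {ν : EuclideanSpace ℝ (Fin n)} (hp : p ∈ M.carrier n)
    (h : M.IsOutwardUnitNormal Ω p ν) (v : EuclideanSpace ℝ (Fin n)) :
    M.metric p ν v = (M.conormalNorm Ω p)⁻¹ * inner ℝ (euclNormal Ω p) v := by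
  obtain ⟨U, φ, hpU, hφ, h0, h1, c, hc, hν⟩ := h
  set c' := c * ‖fderiv ℝ φ p‖
  have hφ0 : 0 < ‖fderiv ℝ φ p‖ := norm_pos_iff.2 (hφ.fderiv_ne_zero p hpU)
  have hc' : 0 < c' := by positivity
  have hν' : ∀ v, M.metric p ν v = c' * inner ℝ (euclNormal Ω p) v := fun v => by
    rw [hν, inner_euclNormal hφ hpU h0]
    simp only [c']
    field_simp
  have hframe : M.frame p ν = c' • M.coframe p (euclNormal Ω p) := by
    refine ext_inner_right ℝ fun w => ?_
    rw [real_inner_smul_left, ← M.frame_coframe hp w, M.inner_coframe_frame hp, ← hν',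
      metric_eq_inner_frame]
  have hcN : c' * M.conormalNorm Ω p = 1 := by
    have h2 : ‖M.frame p ν‖ ^ 2 = 1 := by
      rw [← real_inner_self_eq_norm_sq, ← metric_eq_inner_frame, h1]
    have h3 := (pow_eq_one_iff_of_nonneg (norm_nonneg _) two_ne_zero).1 h2
    rw [hframe, norm_smul, Real.norm_of_nonneg hc'.le] at h3
    exact h3
  rw [hν', eq_inv_of_mul_eq_one_left hcN]

theorem metric_outwardNormal (hp : p ∈ M.carrier n) (h : IsDefiningFunction Ω U φ)
    (hpU : p ∈ U) (h0 : φ p = 0) (v : EuclideanSpace ℝ (Fin n)) :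
    M.metric p (M.outwardNormal Ω p) v =
      (M.conormalNorm Ω p)⁻¹ * inner ℝ (euclNormal Ω p) v := by
  have hex := M.exists_isOutwardUnitNormal hp h hpU h0
  have : M.IsOutwardUnitNormal Ω p (M.outwardNormal Ω p) := by
    rw [outwardNormal, dif_pos hex]
    exact hex.choose_spec
  exact this.metric_eq M hp v

theorem normalComponent_eq (hp : p ∈ M.carrier n) (h : IsDefiningFunction Ω U φ)
    (hpU : p ∈ U) (h0 : φ p = 0) (X : EuclideanSpace ℝ (Fin n) → EuclideanSpace ℝ (Fin n)) :
    M.normalComponent Ω X p =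
      (M.conormalNorm Ω p)⁻¹ * inner ℝ (euclNormal Ω p) (X p) := by
  rw [normalComponent, metric_comm, M.metric_outwardNormal hp h hpU h0]

theorem tangentPlane_eq (hp : p ∈ M.carrier n) (h : IsDefiningFunction Ω U φ)
    (hpU : p ∈ U) (h0 : φ p = 0) : M.tangentPlane Ω p = (ℝ ∙ euclNormal Ω p)ᗮ := by
  ext v
  rw [tangentPlane, LinearMap.mem_ker, M.metric_outwardNormal hp h hpU h0,
    Submodule.mem_orthogonal_singleton_iff_inner_right,
    mul_eq_zero_iff_left (inv_ne_zero (M.conormalNorm_pos hp h hpU h0).ne')]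

/-- The frame pulls `coframe` of the Euclidean normal back to that normal, so
`normDet_comp_subtype_orthogonal` applies with this vector as `w`. -/
theorem areaDensity_eq (hp : p ∈ M.carrier n) (h : IsDefiningFunction Ω U φ)
    (hpU : p ∈ U) (h0 : φ p = 0) :
    M.areaDensity Ω p = M.volDensity p * M.conormalNorm Ω p := by
  have h1 := M.sqrt_det_gram_eq_normDet (stdOrthonormalBasis ℝ (M.tangentPlane Ω p)) p
    (M.tangentPlane Ω p).subtype
  have h2 := normDet_comp_subtype_orthogonal (norm_euclNormal h hpU h0)
    (M.coframe_euclNormal_ne_zero hp h hpU h0) fun v => M.inner_coframe_frame hp (euclNormal Ω p) v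
  rw [← M.tangentPlane_eq hp h hpU h0] at h2
  rw [M.volDensity_eq_abs_det, conormalNorm, ← h2, ← h1]
  rfl

/-- A regular piece is relatively open in the frontier: inside each chart it contains the entire
frontier. -/
theorem _root_.IsRegularBoundary.measurableSet {Γ : Set (EuclideanSpace ℝ (Fin n))}
    (h : IsRegularBoundary Ω Γ) : MeasurableSet Γ := by
  have hsub := h.subset_frontier
  choose! U φ hpU hφ h0 hU using h
  have : Γ = frontier Ω ∩ ⋃ p ∈ Γ, U p := by
    refine Subset.antisymm (fun p hp => ⟨hsub hp, mem_biUnion hp (hpU p hp)⟩) fun x hx => ?_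
    obtain ⟨p, hp, hx'⟩ := mem_iUnion₂.1 hx.2
    exact hU p hp x hx' (((hφ p hp).mem_frontier_iff hx').1 hx.1)
  rw [this]
  exact isClosed_frontier.measurableSet.inter
    (isOpen_biUnion fun p hp => (hφ p hp).isOpen).measurableSet

theorem _root_.IsRegularBoundary.aemeasurable_conormalNorm
    {Γ : Set (EuclideanSpace ℝ (Fin n))} (h : IsRegularBoundary Ω Γ)
    (μ : Measure (EuclideanSpace ℝ (Fin n))) : AEMeasurable (M.conormalNorm Ω) (μ.restrict Γ) := by
  have hn : AEMeasurable (euclNormal Ω) (μ.restrict Γ) :=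
    h.continuousOn_euclNormal.aemeasurable h.measurableSet
  have ha : Measurable fun x : EuclideanSpace ℝ (Fin n) => (M.angularFactor x)⁻¹ :=
    M.continuous_angularFactor.measurable.inv
  have hr : Measurable fun x : EuclideanSpace ℝ (Fin n) => ‖x‖⁻¹ • x := by fun_prop
  refine AEMeasurable.norm (((ha.aemeasurable.smul hn).add
    (((measurable_const.sub ha).aemeasurable.mul (hr.aemeasurable.inner hn)).smul hr.aemeasurable)))

end ModelSpace

end RiemannianNormal

/-! ### The antipode of the pole has capacity zero -/

section Antipode

open Filter Topology Module

/-- Bernoulli's inequality bounds `R ^ n - (R - δ) ^ n` by `n * R ^ (n - 1) * δ`. If `δ ≥ R` the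
shell is the whole ball, and the bound exceeds its volume because `n ≥ 1`. -/
theorem volume_ball_sdiff_ball_le {n : ℕ} (hn : n ≠ 0) {R δ : ℝ} (hR : 0 < R) (hδ : 0 ≤ δ) :
    volume (Metric.ball (0 : EuclideanSpace ℝ (Fin n)) R \ Metric.ball 0 (R - δ)) ≤
      ENNReal.ofReal (n * R ^ (n - 1) * δ) * volume (Metric.ball (0 : EuclideanSpace ℝ (Fin n)) 1) := by
  have : Nontrivial (EuclideanSpace ℝ (Fin n)) :=
    Module.nontrivial_of_finrank_pos (R := ℝ) (by
      rw [finrank_euclideanSpace, Fintype.card_fin]; omega)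
  have hpow : R ^ (n - 1) * R = R ^ n := by rw [← pow_succ, Nat.sub_add_cancel (by omega)]
  have hn1 : (1 : ℝ) ≤ n := by exact_mod_cast Nat.one_le_iff_ne_zero.2 hn
  rcases le_total δ R with h | h
  · have hb : ENNReal.ofReal ((R - δ) ^ n) *
        volume (Metric.ball (0 : EuclideanSpace ℝ (Fin n)) 1) ≠ ⊤ :=
      ENNReal.mul_ne_top ENNReal.ofReal_ne_top measure_ball_lt_top.ne
    rw [measure_sdiff (Metric.ball_subset_ball (by linarith)) measurableSet_ball.nullMeasurableSet
      measure_ball_lt_top.ne, Measure.addHaar_ball _ _ hR.le,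
      Measure.addHaar_ball _ _ (sub_nonneg.2 h), finrank_euclideanSpace, Fintype.card_fin,
      tsub_le_iff_right, ← add_mul, ← ENNReal.ofReal_add (by positivity)
      (pow_nonneg (sub_nonneg.2 h) n)]
    gcongr
    have h1 := one_add_mul_le_pow (a := -δ / R) (by rw [le_div_iff₀ hR]; linarith) n
    have h2 : (1 + -δ / R) ^ n * R ^ n = (R - δ) ^ n := by
      rw [← mul_pow]; congr 1; field_simp; ring
    have h3 : (1 + n * (-δ / R)) * R ^ n = R ^ n - n * R ^ (n - 1) * δ := by
      rw [← hpow]; field_simp; ring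
    have h4 := mul_le_mul_of_nonneg_right h1 (pow_nonneg hR.le n)
    rw [h2, h3] at h4
    linarith
  · refine (measure_mono sdiff_subset).trans ?_
    rw [Measure.addHaar_ball _ _ hR.le, finrank_euclideanSpace, Fintype.card_fin]
    gcongr
    rw [← hpow, mul_assoc]
    exact (mul_le_mul_of_nonneg_left h (by positivity)).trans
      (le_mul_of_one_le_left (by positivity) hn1)

namespace ModelSpace

variable (M : ModelSpace) {n : ℕ}

theorem ψ_antipode {R : ℝ} (hR : M.radius = ENNReal.ofReal R) : M.ψ R = 0 := by
  have := (M.complete R hR).1 0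
  rw [add_zero, sub_zero] at this
  linarith

theorem mem_carrier_iff {R : ℝ} (hR : M.radius = ENNReal.ofReal R) (h0 : 0 < R)
    {x : EuclideanSpace ℝ (Fin n)} : x ∈ M.carrier n ↔ ‖x‖ < R := by
  change ‖x‖ₑ < M.radius ↔ _
  rw [hR, ← ofReal_norm, ENNReal.ofReal_lt_ofReal_iff h0]

/-- `ψ` vanishes at `0` and `R` and is `L`-Lipschitz on `[0, R]`. For `‖x‖ ≥ R / 2` the zero at `R`
gives the decay and `1 / ‖x‖ ≤ 2 / R`; for `‖x‖ ≤ R / 2` the zero at `0` gives the factor at most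
`L`, while `R - ‖x‖ ≥ R / 2`. -/
theorem exists_angularFactor_le {R : ℝ} (hR : M.radius = ENNReal.ofReal R) (h0 : 0 < R) :
    ∃ L : ℝ, 0 < L ∧ ∀ x ∈ M.carrier n, M.angularFactor x ≤ L * (R - ‖x‖) := by
  obtain ⟨L, hL⟩ := isCompact_Icc.exists_bound_of_continuousOn (s := Icc 0 R)
    (M.smooth.continuous_deriv (by simp)).continuousOn
  have hL1 : 1 ≤ L := by simpa [M.deriv_zero] using hL 0 ⟨le_rfl, h0.le⟩
  have hlip : ∀ s ∈ Icc 0 R, ∀ t ∈ Icc 0 R, ‖M.ψ t - M.ψ s‖ ≤ L * ‖t - s‖ := fun s hs t ht =>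
    (convex_Icc 0 R).norm_image_sub_le_of_norm_deriv_le
      (fun x _ => M.smooth.differentiable (by simp) x) hL hs ht
  refine ⟨2 * L / R, by positivity, fun x hx => ?_⟩
  have hxR : ‖x‖ < R := (M.mem_carrier_iff hR h0).1 hx
  have hsmall : ‖x‖ ≤ R / 2 → L ≤ 2 * L / R * (R - ‖x‖) := fun h => by
    rw [div_mul_eq_mul_div, le_div_iff₀ h0]
    nlinarith
  unfold angularFactor
  split_ifs with hx0
  · exact hL1.trans (hsmall (by rw [hx0, norm_zero]; positivity))
  · have hr : 0 < ‖x‖ := norm_pos_iff.2 hx0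
    rcases le_total ‖x‖ (R / 2) with h | h
    · refine le_trans ?_ (hsmall h)
      rw [div_le_iff₀ hr]
      have := hlip 0 ⟨le_rfl, h0.le⟩ ‖x‖ ⟨hr.le, hxR.le⟩
      rw [M.ψ_zero, sub_zero, sub_zero, norm_norm] at this
      exact (le_abs_self _).trans this
    · have := hlip R ⟨h0.le, le_rfl⟩ ‖x‖ ⟨hr.le, hxR.le⟩
      rw [M.ψ_antipode hR, sub_zero, ← norm_neg (‖x‖ - R), neg_sub,
        Real.norm_of_nonneg (sub_nonneg.2 hxR.le)] at this
      have h1 : M.ψ ‖x‖ ≤ L * (R - ‖x‖) := (le_abs_self _).trans this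
      have h2 : 0 ≤ L * (R - ‖x‖) := mul_nonneg (by linarith) (by linarith)
      rw [div_le_iff₀ hr, div_mul_eq_mul_div, div_mul_eq_mul_div, le_div_iff₀ h0]
      nlinarith

/-- The density is the angular factor to the power `d ≥ 1`; one factor supplies the decay, the
others are bounded by `L * R`. Dimension at least two is needed exactly for this one factor. -/
theorem exists_volDensity_le {d : ℕ} (hd : d ≠ 0) {R : ℝ} (hR : M.radius = ENNReal.ofReal R)
    (h0 : 0 < R) : ∃ A : ℝ, 0 < A ∧ ∀ x ∈ M.carrier (d + 1), M.volDensity x ≤ A * (R - ‖x‖) := by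
  obtain ⟨L, hL0, hL⟩ := M.exists_angularFactor_le (n := d + 1) hR h0
  refine ⟨(L * R) ^ (d - 1) * L, by positivity, fun x hx => ?_⟩
  have ha := (M.angularFactor_pos hx).le
  have h1 : M.angularFactor x ≤ L * R :=
    (hL x hx).trans (mul_le_mul_of_nonneg_left (by linarith [norm_nonneg x]) hL0.le)
  rw [M.volDensity_eq hx]
  calc M.angularFactor x ^ d = M.angularFactor x ^ (d - 1) * M.angularFactor x := by
        rw [← pow_succ, Nat.sub_add_cancel (by omega)]
    _ ≤ (L * R) ^ (d - 1) * (L * (R - ‖x‖)) := by gcongr; exact hL x hx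
    _ = _ := by ring

/-- The volume of the balls of radius `O(√t)` around the antipode of the pole is `O(t)`. -/
theorem exists_vol_sublevel_le {d : ℕ} (hd : d ≠ 0) {R : ℝ} (hR : M.radius = ENNReal.ofReal R)
    (h0 : 0 < R) : ∃ C : ℝ, ∀ t : ℝ, 0 < t →
      M.vol (d + 1) (M.carrier (d + 1) ∩ {x | (R ^ 2 - ‖x‖ ^ 2) ^ 2 ≤ t}) ≤
        ENNReal.ofReal (C * t) := by
  obtain ⟨A, hA0, hA⟩ := M.exists_volDensity_le hd hR h0
  set b := (volume (Metric.ball (0 : EuclideanSpace ℝ (Fin (d + 1))) 1)).toReal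
  have hb : volume (Metric.ball (0 : EuclideanSpace ℝ (Fin (d + 1))) 1) = ENNReal.ofReal b :=
    (ENNReal.ofReal_toReal measure_ball_lt_top.ne).symm
  have hb0 : 0 ≤ b := ENNReal.toReal_nonneg
  refine ⟨A / R * (((d + 1 : ℕ) : ℝ) * R ^ d / R) * b, fun t ht => ?_⟩
  set S := M.carrier (d + 1) ∩ {x | (R ^ 2 - ‖x‖ ^ 2) ^ 2 ≤ t}
  have hSm : MeasurableSet S := M.isOpen_carrier.measurableSet.inter
    (measurableSet_le (by fun_prop) measurable_const)
  -- Since `R² - ‖x‖² = (R - ‖x‖) (R + ‖x‖) ≥ R (R - ‖x‖)`, the sublevel set lies in a shell of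
  -- thickness `√t / R`. There the density is `O(δ)` and the shell has Lebesgue measure `O(δ)`, so
  -- the volume is `O(δ²) = O(t)`.
  set δ := √t / R
  have hδ : 0 ≤ δ := by positivity
  have hSδ : ∀ x ∈ S, R - ‖x‖ ≤ δ := fun x hx => by
    have hxR : ‖x‖ < R := (M.mem_carrier_iff hR h0).1 hx.1
    have h1 : R ^ 2 - ‖x‖ ^ 2 ≤ √t := Real.le_sqrt_of_sq_le hx.2
    rw [le_div_iff₀ h0]
    nlinarith [norm_nonneg x]
  have hsub : S ⊆ Metric.ball 0 R \ Metric.ball 0 (R - δ) := fun x hx => by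
    refine ⟨mem_ball_zero_iff.2 ((M.mem_carrier_iff hR h0).1 hx.1), fun hc => ?_⟩
    have := hSδ x hx
    rw [mem_ball_zero_iff] at hc
    linarith
  have hcar : S ∩ M.carrier (d + 1) = S := inter_eq_left.2 inter_subset_left
  calc M.vol (d + 1) S = ∫⁻ x in S, ENNReal.ofReal (M.volDensity x) := by
        rw [vol, withDensity_apply _ hSm, Measure.restrict_restrict hSm, hcar]
    _ ≤ ∫⁻ _ in S, ENNReal.ofReal (A * δ) := by
        refine setLIntegral_mono measurable_const fun x hx => ENNReal.ofReal_le_ofReal ?_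
        exact (hA x hx.1).trans (mul_le_mul_of_nonneg_left (hSδ x hx) hA0.le)
    _ = ENNReal.ofReal (A * δ) * volume S := setLIntegral_const _ _
    _ ≤ ENNReal.ofReal (A * δ) *
        (ENNReal.ofReal (((d + 1 : ℕ) : ℝ) * R ^ (d + 1 - 1) * δ) * ENNReal.ofReal b) := by
        gcongr
        rw [← hb]
        exact (measure_mono hsub).trans (volume_ball_sdiff_ball_le (by omega) h0 hδ)
    _ = _ := by
        rw [← ENNReal.ofReal_mul (by positivity), ← ENNReal.ofReal_mul (by positivity)]
        congr 1
        have : √t * √t = t := Real.mul_self_sqrt ht.le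
        simp only [δ, Nat.add_sub_cancel]
        field_simp
        nlinarith

/-- Radial cutoff functions at the antipode of the pole, which has capacity zero. -/
theorem exists_antipode_cutoffs {d : ℕ} (hd : d ≠ 0) :
    ∃ η : ℕ → EuclideanSpace ℝ (Fin (d + 1)) → ℝ, (∀ j, ContDiff ℝ 1 (η j)) ∧
      (∀ j x, η j x ∈ Icc (0 : ℝ) 1) ∧
      (∀ j, tsupport (η j) ∩ closure (M.carrier (d + 1)) ⊆ M.carrier (d + 1)) ∧
      (∀ x ∈ M.carrier (d + 1), ∀ᶠ j in atTop, η j x = 1) ∧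
      (∀ j x v, |fderiv ℝ (η j) x v| ≤ ‖fderiv ℝ (η j) x‖ * M.normAt x v) ∧
      Tendsto (fun j => ∫⁻ x in M.carrier (d + 1), ‖fderiv ℝ (η j) x‖ₑ ^ 2 ∂(M.vol (d + 1))) atTop
        (𝓝 0) := by
  by_cases htop : M.radius = ⊤
  · have huniv : M.carrier (d + 1) = univ := eq_univ_of_forall fun x => by
      change ‖x‖ₑ < M.radius
      rw [htop]
      exact enorm_lt_top
    refine ⟨fun _ _ => 1, fun _ => contDiff_const, fun _ _ => by simp, fun _ => ?_, fun _ _ => by simp,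
      fun _ _ _ => by simp, ?_⟩
    · rw [huniv]; exact subset_univ _
    · simp only [fderiv_fun_const, Pi.zero_apply, enorm_zero_sq, lintegral_zero, tendsto_const_nhds]
  set R := M.radius.toReal
  have hR : M.radius = ENNReal.ofReal R := (ENNReal.ofReal_toReal htop).symm
  have h0 : 0 < R := ENNReal.toReal_pos M.radius_pos.ne' htop
  -- The sphere `‖x‖ = R` represents the antipode. This polynomial in `‖x‖²` is smooth also at the
  -- pole and vanishes there like the squared distance to the antipode vanishes at the sphere: to
  -- second order in `R - ‖x‖`, on `‖x‖ = R` only. Its squared gradient is at most `16 R² s` on the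
  -- ball.
  set s : EuclideanSpace ℝ (Fin (d + 1)) → ℝ := fun x => (R ^ 2 - ‖x‖ ^ 2) ^ 2
  have hsc : ContDiff ℝ ∞ s := (contDiff_const.sub (contDiff_norm_sq ℝ)).pow 2
  have hs' : ∀ x, HasFDerivAt s ((-4 * (R ^ 2 - ‖x‖ ^ 2)) • innerSL ℝ x) x := fun x => by
    have h1 : HasFDerivAt (fun x : EuclideanSpace ℝ (Fin (d + 1)) => R ^ 2 - ‖x‖ ^ 2)
        (-(2 • innerSL ℝ x)) x := by
      have := (hasStrictFDerivAt_norm_sq x).hasFDerivAt.const_sub (R ^ 2)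
      exact this
    refine (h1.pow 2).congr_fderiv ?_
    ext v
    simp
    ring
  obtain ⟨C, hC⟩ := M.exists_vol_sublevel_le hd hR h0
  set C' := max C (16 * R ^ 2)
  have hlim := tendsto_lintegral_sq_fderiv_dyadicCutoff (μ := M.vol (d + 1)) (s := s) (C := C')
    M.isOpen_carrier.measurableSet
    (fun t ht => (hC t ht).trans (ENNReal.ofReal_le_ofReal (by gcongr; exact le_max_left _ _)))
    (fun x _ => by positivity) (fun x _ => (hs' x).differentiableAt) (fun x hx => by
      have hxR : ‖x‖ < R := (M.mem_carrier_iff hR h0).1 hx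
      rw [(hs' x).fderiv, norm_smul, mul_pow, innerSL_apply_norm, Real.norm_eq_abs, sq_abs]
      calc (-4 * (R ^ 2 - ‖x‖ ^ 2)) ^ 2 * ‖x‖ ^ 2 ≤ (-4 * (R ^ 2 - ‖x‖ ^ 2)) ^ 2 * R ^ 2 := by
            gcongr
        _ = 16 * R ^ 2 * s x := by simp only [s]; ring
        _ ≤ C' * s x := by gcongr; exact le_max_right _ _)
  refine ⟨fun k x => dyadicCutoff k (s x), fun k => ((contDiff_dyadicCutoff k).comp hsc).of_le
    (by simp), fun k x => dyadicCutoff_mem_Icc k _, fun k x hx => ?_, fun x hx => ?_,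
    fun k x v => ?_, hlim⟩
  · have h1 : tsupport (fun x => dyadicCutoff k (s x)) ⊆ {x | 1 / 2 ≤ 4 ^ (2 * k) * s x} := by
      refine closure_minimal (fun y hy => ?_)
        (isClosed_le continuous_const (continuous_const.mul hsc.continuous))
      by_contra hc
      exact hy (dyadicCutoff_eq_zero (not_le.1 hc).le)
    have h2 : ‖x‖ ≤ R := by
      refine closure_minimal (s := M.carrier (d + 1)) (t := {y | ‖y‖ ≤ R}) (fun y hy => ?_)
        (isClosed_le continuous_norm continuous_const) hx.2
      exact ((M.mem_carrier_iff hR h0).1 hy).le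
    refine (M.mem_carrier_iff hR h0).2 (lt_of_le_of_ne h2 fun hc => ?_)
    have h3 : 1 / 2 ≤ 4 ^ (2 * k) * s x := h1 hx.1
    simp only [s, hc] at h3
    norm_num at h3
  · have hxR : ‖x‖ < R := (M.mem_carrier_iff hR h0).1 hx
    have hs0 : 0 < s x := by
      have : 0 < R ^ 2 - ‖x‖ ^ 2 := by nlinarith [norm_nonneg x]
      positivity
    have : Tendsto (fun k : ℕ => (4 : ℝ) ^ k * s x) atTop atTop :=
      (tendsto_pow_atTop_atTop_of_one_lt (by norm_num)).atTop_mul_const hs0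
    filter_upwards [this.eventually_ge_atTop 1] with k hk using dyadicCutoff_eq_one hk
  · have hfd : fderiv ℝ (fun y => dyadicCutoff k (s y)) x =
        (deriv (dyadicCutoff k) (s x) * (-4 * (R ^ 2 - ‖x‖ ^ 2))) • innerSL ℝ x := by
      rw [mul_smul]
      exact (((contDiff_dyadicCutoff k).differentiable (by simp) (s x)).hasDerivAt.comp_hasFDerivAt x
        (hs' x)).fderiv
    generalize deriv (dyadicCutoff k) (s x) * (-4 * (R ^ 2 - ‖x‖ ^ 2)) = c at hfd
    rw [hfd, smul_apply, innerSL_apply_apply, smul_eq_mul, abs_mul, norm_smul, innerSL_apply_norm,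
      Real.norm_eq_abs, mul_assoc]
    gcongr
    by_cases hx0 : x = 0
    · simp [hx0]
    have h1 := M.abs_inner_radial_le_normAt x v
    rw [real_inner_smul_left, abs_mul, abs_inv, abs_norm] at h1
    calc |inner ℝ x v| = ‖x‖ * (‖x‖⁻¹ * |inner ℝ x v|) := by
          rw [mul_inv_cancel_left₀ (norm_ne_zero_iff.2 hx0)]
      _ ≤ _ := by gcongr

end ModelSpace

end Antipode

/-! ### Passage to the limit in the cutoffs -/

section CutoffLimit

open Filter Topology

variable {α : Type*} [MeasurableSpace α] {μ σ : Measure α} {f h : α → ℝ} {θ : ℕ → α → ℝ}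
  {Θ : α → ℝ} {e : ℕ → ℝ} {e' : ℝ}

/-- The identity shows that the integrals of `θ k * h` converge. Their negative parts are bounded by
that of `h`, hence so are the positive parts, and Fatou's lemma makes `Θ * h` integrable. It then
dominates all `θ k * h`, because `0 ≤ θ k ≤ Θ`. -/
theorem integrable_and_integral_eq_of_tendsto_of_neg_part (hf : Integrable f μ)
    (hh : AEStronglyMeasurable h σ) (hθμ : ∀ k, AEStronglyMeasurable (θ k) μ)
    (hθσ : ∀ k, AEStronglyMeasurable (θ k) σ) (hΘσ : AEStronglyMeasurable Θ σ)
    (hθ0 : ∀ k x, 0 ≤ θ k x) (hθΘ : ∀ k x, θ k x ≤ Θ x) (hΘ1 : ∀ x, Θ x ≤ 1)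
    (hμ : ∀ᵐ x ∂μ, Tendsto (fun k => θ k x) atTop (𝓝 (Θ x)))
    (hσ : ∀ᵐ x ∂σ, Tendsto (fun k => θ k x) atTop (𝓝 (Θ x)))
    (hint : ∀ k, Integrable (fun x => θ k x * h x) σ) (he : Tendsto e atTop (𝓝 e'))
    (hid : ∀ k, ∫ x, θ k x * f x ∂μ + e k = ∫ x, θ k x * h x ∂σ)
    (hneg : ∫⁻ x, ENNReal.ofReal (-h x) ∂σ < ⊤) :
    Integrable (fun x => Θ x * h x) σ ∧ ∫ x, Θ x * f x ∂μ + e' = ∫ x, Θ x * h x ∂σ := by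
  have hΘ0 : ∀ x, 0 ≤ Θ x := fun x => (hθ0 0 x).trans (hθΘ 0 x)
  have h1 : Tendsto (fun k => ∫ x, θ k x * f x ∂μ) atTop (𝓝 (∫ x, Θ x * f x ∂μ)) := by
    refine tendsto_integral_of_dominated_convergence (fun x => |f x|)
      (fun k => (hθμ k).mul hf.aestronglyMeasurable) hf.abs (fun k => ae_of_all _ fun x => ?_) ?_
    · rw [Real.norm_eq_abs, abs_mul, abs_of_nonneg (hθ0 k x)]
      exact mul_le_of_le_one_left (abs_nonneg _) ((hθΘ k x).trans (hΘ1 x))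
    · filter_upwards [hμ] with x hx using hx.mul_const _
  have h2 : Tendsto (fun k => ∫ x, θ k x * h x ∂σ) atTop (𝓝 (∫ x, Θ x * f x ∂μ + e')) :=
    (h1.add he).congr hid
  have hneg' : ∀ g : α → ℝ, (∀ x, 0 ≤ g x) → (∀ x, g x ≤ 1) →
      ∫⁻ x, ENNReal.ofReal (-(g x * h x)) ∂σ ≤ ∫⁻ x, ENNReal.ofReal (-h x) ∂σ := fun g h0 h1 => by
    refine lintegral_mono fun x => ?_
    rw [← mul_neg]
    rcases le_total 0 (-h x) with hx | hx
    · exact ENNReal.ofReal_le_ofReal (mul_le_of_le_one_left hx (h1 x))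
    · rw [ENNReal.ofReal_of_nonpos (mul_nonpos_of_nonneg_of_nonpos (h0 x) hx)]
      exact zero_le
  set N := (∫⁻ x, ENNReal.ofReal (-h x) ∂σ).toReal
  have hpos : ∀ k, ∫⁻ x, ENNReal.ofReal (θ k x * h x) ∂σ ≤
      ENNReal.ofReal (∫ x, θ k x * h x ∂σ + N) := fun k => by
    have hfin : ∫⁻ x, ENNReal.ofReal (θ k x * h x) ∂σ ≠ ⊤ := (hint k).lintegral_lt_top.ne
    rw [← ENNReal.ofReal_toReal hfin]
    refine ENNReal.ofReal_le_ofReal ?_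
    rw [integral_eq_lintegral_pos_part_sub_lintegral_neg_part (hint k)]
    have := ENNReal.toReal_mono hneg.ne
      (hneg' (θ k) (hθ0 k) fun x => (hθΘ k x).trans (hΘ1 x))
    linarith
  have hmeas : AEStronglyMeasurable (fun x => Θ x * h x) σ := hΘσ.mul hh
  have hposΘ : ∫⁻ x, ENNReal.ofReal (Θ x * h x) ∂σ < ⊤ := by
    calc ∫⁻ x, ENNReal.ofReal (Θ x * h x) ∂σ
        = ∫⁻ x, liminf (fun k => ENNReal.ofReal (θ k x * h x)) atTop ∂σ := by
          refine lintegral_congr_ae ?_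
          filter_upwards [hσ] with x hx
          exact ((ENNReal.continuous_ofReal.tendsto _).comp (hx.mul_const (h x))).liminf_eq.symm
      _ ≤ liminf (fun k => ∫⁻ x, ENNReal.ofReal (θ k x * h x) ∂σ) atTop :=
          lintegral_liminf_le' fun k => ((hθσ k).mul hh).aemeasurable.ennreal_ofReal
      _ ≤ liminf (fun k => ENNReal.ofReal (∫ x, θ k x * h x ∂σ + N)) atTop :=
          liminf_le_liminf (Eventually.of_forall hpos)
      _ = ENNReal.ofReal (∫ x, Θ x * f x ∂μ + e' + N) :=
          ((ENNReal.continuous_ofReal.tendsto _).comp (h2.add_const N)).liminf_eq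
      _ < ⊤ := ENNReal.ofReal_lt_top
  have hintΘ : Integrable (fun x => Θ x * h x) σ := by
    refine ⟨hmeas, ?_⟩
    have hle : ∀ x, ‖Θ x * h x‖ₑ ≤ ENNReal.ofReal (Θ x * h x) + ENNReal.ofReal (-(Θ x * h x)) :=
      fun x => by
        rw [← ofReal_norm, Real.norm_eq_abs]
        rcases abs_cases (Θ x * h x) with ⟨h, -⟩ | ⟨h, -⟩ <;> rw [h]
        · exact le_self_add
        · exact le_add_self
    refine (lintegral_mono hle).trans_lt ?_
    rw [lintegral_add_left' hmeas.aemeasurable.ennreal_ofReal]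
    exact ENNReal.add_lt_top.2 ⟨hposΘ, (hneg' Θ hΘ0 hΘ1).trans_lt hneg⟩
  refine ⟨hintΘ, tendsto_nhds_unique h2 ?_⟩
  refine tendsto_integral_of_dominated_convergence (fun x => |Θ x * h x|)
    (fun k => (hθσ k).mul hh) hintΘ.abs (fun k => ae_of_all _ fun x => ?_) ?_
  · rw [Real.norm_eq_abs, abs_mul, abs_mul, abs_of_nonneg (hθ0 k x), abs_of_nonneg (hΘ0 x)]
    exact mul_le_mul_of_nonneg_right (hθΘ k x) (abs_nonneg _)
  · filter_upwards [hσ] with x hx using hx.mul_const _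

/-- Passage to the limit in a divergence identity with cutoff functions `θ k` increasing to `Θ`, if
the flux density `h` has an integral in `[-∞, ∞]`. -/
theorem integrable_and_integral_eq_of_tendsto (hf : Integrable f μ)
    (hh : AEStronglyMeasurable h σ) (hθμ : ∀ k, AEStronglyMeasurable (θ k) μ)
    (hθσ : ∀ k, AEStronglyMeasurable (θ k) σ) (hΘσ : AEStronglyMeasurable Θ σ)
    (hθ0 : ∀ k x, 0 ≤ θ k x) (hθΘ : ∀ k x, θ k x ≤ Θ x) (hΘ1 : ∀ x, Θ x ≤ 1)
    (hμ : ∀ᵐ x ∂μ, Tendsto (fun k => θ k x) atTop (𝓝 (Θ x)))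
    (hσ : ∀ᵐ x ∂σ, Tendsto (fun k => θ k x) atTop (𝓝 (Θ x)))
    (hint : ∀ k, Integrable (fun x => θ k x * h x) σ) (he : Tendsto e atTop (𝓝 e'))
    (hid : ∀ k, ∫ x, θ k x * f x ∂μ + e k = ∫ x, θ k x * h x ∂σ)
    (hflux : ∫⁻ x, ENNReal.ofReal (h x) ∂σ < ⊤ ∨ ∫⁻ x, ENNReal.ofReal (-h x) ∂σ < ⊤) :
    Integrable (fun x => Θ x * h x) σ ∧ ∫ x, Θ x * f x ∂μ + e' = ∫ x, Θ x * h x ∂σ := by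
  rcases hflux with hflux | hflux
  · have := integrable_and_integral_eq_of_tendsto_of_neg_part (f := fun x => -f x)
      (h := fun x => -h x) (e := fun k => -e k) (e' := -e') hf.neg hh.neg hθμ hθσ hΘσ hθ0 hθΘ hΘ1
      hμ hσ (fun k => by simp only [mul_neg]; exact (hint k).neg) he.neg (fun k => by
        simp only [mul_neg, integral_neg]
        linarith [hid k]) (by simpa only [neg_neg] using hflux)
    simp only [mul_neg, integral_neg] at this
    exact ⟨this.1.neg.congr (ae_of_all _ fun x => neg_neg _), by linarith [this.2]⟩
  · exact integrable_and_integral_eq_of_tendsto_of_neg_part hf hh hθμ hθσ hΘσ hθ0 hθΘ hΘ1 hμ hσ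
      hint he hid hflux

/-- The Cauchy–Schwarz inequality, for a sequence of functions tending to `0` in `L²`. -/
theorem tendsto_integral_of_abs_le_mul {E : Type*} [NormedAddCommGroup E] {μ : Measure α}
    {u : α → ℝ} (hu : MemLp u 2 μ) {w : ℕ → α → E} (hw : ∀ k, AEStronglyMeasurable (w k) μ)
    (hlim : Tendsto (fun k => ∫⁻ x, ‖w k x‖ₑ ^ 2 ∂μ) atTop (𝓝 0)) {g : ℕ → α → ℝ}
    (hg : ∀ k, ∀ᵐ x ∂μ, |g k x| ≤ ‖w k x‖ * |u x|) :
    Tendsto (fun k => ∫ x, g k x ∂μ) atTop (𝓝 0) := by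
  have hb : ∀ k, ‖∫ x, g k x ∂μ‖ₑ ≤
      (∫⁻ x, ‖w k x‖ₑ ^ 2 ∂μ) ^ (1 / 2 : ℝ) * (∫⁻ x, ‖u x‖ₑ ^ 2 ∂μ) ^ (1 / 2 : ℝ) := fun k => by
    refine (enorm_integral_le_lintegral_enorm _).trans ?_
    have h1 := ENNReal.lintegral_mul_le_Lp_mul_Lq μ Real.HolderConjugate.two_two (hw k).enorm
      hu.1.enorm
    simp only [ENNReal.rpow_ofNat] at h1
    refine le_trans (lintegral_mono_ae ?_) h1
    filter_upwards [hg k] with x hx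
    rw [Pi.mul_apply, ← enorm_norm, ← enorm_norm (w k x), ← enorm_norm (u x), ← enorm_mul,
      enorm_le_iff_norm_le, norm_norm, norm_mul, norm_norm, norm_norm]
    exact hx
  have hfin : (∫⁻ x, ‖u x‖ₑ ^ 2 ∂μ) ^ (1 / 2 : ℝ) ≠ ⊤ := by
    have := lintegral_rpow_enorm_lt_top_of_eLpNorm_lt_top (by simp) (by simp) hu.2
    simp only [ENNReal.toReal_ofNat, ENNReal.rpow_ofNat] at this
    exact ENNReal.rpow_ne_top_of_nonneg (by norm_num) this.ne
  rw [tendsto_zero_iff_norm_tendsto_zero]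
  have h2 : Tendsto (fun k => ‖∫ x, g k x ∂μ‖ₑ) atTop (𝓝 0) := by
    refine tendsto_of_tendsto_of_tendsto_of_le_of_le tendsto_const_nhds ?_ (fun k => zero_le) hb
    have := ENNReal.Tendsto.mul_const
      (((ENNReal.continuous_rpow_const (y := (1 / 2 : ℝ))).tendsto 0).comp hlim) (Or.inr hfin)
    rwa [ENNReal.zero_rpow_of_pos (by norm_num), zero_mul] at this
  have := (ENNReal.tendsto_toReal ENNReal.zero_ne_top).comp h2
  simpa [Function.comp_def] using this

end CutoffLimit

/-! ### Transfer to the Riemannian metric -/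

section RiemannianDivergenceTheorem

open Filter Topology

theorem integrable_withDensity_ofReal_iff {α : Type*} [MeasurableSpace α] {μ : Measure α} {w : α → ℝ}
    (hw : AEMeasurable w μ) (hw0 : ∀ᵐ x ∂μ, 0 ≤ w x) {g : α → ℝ} :
    Integrable g (μ.withDensity fun x => ENNReal.ofReal (w x)) ↔
      Integrable (fun x => w x * g x) μ := by
  rw [integrable_withDensity_iff_integrable_smul₀' hw.ennreal_ofReal
    (ae_of_all _ fun _ => ENNReal.ofReal_lt_top)]
  refine integrable_congr ?_
  filter_upwards [hw0] with x hx
  rw [ENNReal.toReal_ofReal hx, smul_eq_mul]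

theorem integral_withDensity_ofReal {α : Type*} [MeasurableSpace α] {μ : Measure α} {w : α → ℝ}
    (hw : AEMeasurable w μ) (hw0 : ∀ᵐ x ∂μ, 0 ≤ w x) (g : α → ℝ) :
    ∫ x, g x ∂(μ.withDensity fun x => ENNReal.ofReal (w x)) = ∫ x, w x * g x ∂μ := by
  rw [integral_withDensity_eq_integral_toReal_smul₀ hw.ennreal_ofReal
    (ae_of_all _ fun _ => ENNReal.ofReal_lt_top)]
  refine integral_congr_ae ?_
  filter_upwards [hw0] with x hx
  rw [ENNReal.toReal_ofReal hx, smul_eq_mul]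

namespace ModelSpace

variable (M : ModelSpace) {d : ℕ} {Ω Γ : Set (EuclideanSpace ℝ (Fin (d + 1)))}
  {X : EuclideanSpace ℝ (Fin (d + 1)) → EuclideanSpace ℝ (Fin (d + 1))}

theorem vol_restrict {s : Set (EuclideanSpace ℝ (Fin (d + 1)))} (hs : MeasurableSet s)
    (hsM : s ⊆ M.carrier (d + 1)) : (M.vol (d + 1)).restrict s =
      (volume.restrict s).withDensity fun x => ENNReal.ofReal (M.volDensity x) := by
  rw [vol, restrict_withDensity hs, Measure.restrict_restrict hs, inter_eq_left.2 hsM]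

theorem aemeasurable_volDensity {s : Set (EuclideanSpace ℝ (Fin (d + 1)))} (hs : MeasurableSet s)
    (hsM : s ⊆ M.carrier (d + 1)) (μ : Measure (EuclideanSpace ℝ (Fin (d + 1)))) :
    AEMeasurable (M.volDensity (n := d + 1)) (μ.restrict s) :=
  (M.continuousOn_volDensity.mono hsM).aemeasurable hs

theorem integrable_vol_iff {s : Set (EuclideanSpace ℝ (Fin (d + 1)))} (hs : MeasurableSet s)
    (hsM : s ⊆ M.carrier (d + 1)) {g : EuclideanSpace ℝ (Fin (d + 1)) → ℝ} :
    Integrable g ((M.vol (d + 1)).restrict s) ↔ IntegrableOn (fun x => M.volDensity x * g x) s := by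
  rw [M.vol_restrict hs hsM, integrable_withDensity_ofReal_iff (M.aemeasurable_volDensity hs hsM _)
    (ae_of_all _ fun _ => Real.sqrt_nonneg _), IntegrableOn]

theorem integral_vol {s : Set (EuclideanSpace ℝ (Fin (d + 1)))} (hs : MeasurableSet s)
    (hsM : s ⊆ M.carrier (d + 1)) (g : EuclideanSpace ℝ (Fin (d + 1)) → ℝ) :
    ∫ x, g x ∂((M.vol (d + 1)).restrict s) = ∫ x in s, M.volDensity x * g x := by
  rw [M.vol_restrict hs hsM, integral_withDensity_ofReal (M.aemeasurable_volDensity hs hsM _)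
    (ae_of_all _ fun _ => Real.sqrt_nonneg _)]

theorem surface_eq (hΓ : M.boundary Ω =ᵐ[μHE[d]] Γ) : M.surface Ω =
    (Measure.restrict μHE[d] Γ).withDensity fun p => ENNReal.ofReal (M.areaDensity Ω p) := by
  rw [← Measure.restrict_congr_set hΓ]
  rfl

theorem aemeasurable_areaDensity (hΓ : IsRegularBoundary Ω Γ) (hΓM : Γ ⊆ M.carrier (d + 1)) :
    AEMeasurable (M.areaDensity Ω) (Measure.restrict μHE[d] Γ) := by
  refine ((M.aemeasurable_volDensity hΓ.measurableSet hΓM _).mul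
    (hΓ.aemeasurable_conormalNorm M _)).congr ?_
  filter_upwards [ae_restrict_mem hΓ.measurableSet] with p hp
  obtain ⟨U, φ, hpU, hφ, h0, -⟩ := hΓ p hp
  exact (M.areaDensity_eq (hΓM hp) hφ hpU h0).symm

theorem aestronglyMeasurable_normalComponent (hΓ : IsRegularBoundary Ω Γ)
    (hΓM : Γ ⊆ M.carrier (d + 1)) (hbd : M.boundary Ω =ᵐ[μHE[d]] Γ) (hX : ContinuousOn X Γ) :
    AEStronglyMeasurable (M.normalComponent Ω X) (M.surface Ω) := by
  rw [M.surface_eq hbd]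
  refine AEStronglyMeasurable.mono_ac (withDensity_absolutelyContinuous _ _)
    (AEMeasurable.aestronglyMeasurable ?_)
  refine ((hΓ.aemeasurable_conormalNorm M _).inv.mul
    ((hΓ.continuousOn_euclNormal.inner (𝕜 := ℝ) hX).aemeasurable hΓ.measurableSet)).congr ?_
  filter_upwards [ae_restrict_mem hΓ.measurableSet] with p hp
  obtain ⟨U, φ, hpU, hφ, h0, -⟩ := hΓ p hp
  exact (M.normalComponent_eq (hΓM hp) hφ hpU h0 X).symm

/-- The dual norm of the conormal, a factor of the area density, cancels against the normalization
of `ν`: the flux form depends on the metric only through the volume density. -/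
theorem areaDensity_mul_normalComponent (hΓ : IsRegularBoundary Ω Γ) (hΓM : Γ ⊆ M.carrier (d + 1))
    {p : EuclideanSpace ℝ (Fin (d + 1))} (hp : p ∈ Γ) :
    M.areaDensity Ω p * M.normalComponent Ω X p =
      inner ℝ (euclNormal Ω p) (M.volDensity p • X p) := by
  obtain ⟨U, φ, hpU, hφ, h0, -⟩ := hΓ p hp
  rw [M.areaDensity_eq (hΓM hp) hφ hpU h0, M.normalComponent_eq (hΓM hp) hφ hpU h0,
    inner_smul_right, mul_assoc, mul_inv_cancel_left₀ (M.conormalNorm_pos (hΓM hp) hφ hpU h0).ne']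

theorem volDensity_mul_div {x : EuclideanSpace ℝ (Fin (d + 1))} (hx : x ∈ M.carrier (d + 1)) :
    M.volDensity x * M.div X x = euclDiv (fun y => M.volDensity y • X y) x := by
  rw [div, mul_inv_cancel_left₀ (M.volDensity_pos hx).ne']
  rfl

/-- The divergence theorem for the product of `X` with a cutoff function. -/
theorem integral_cutoff_mul_div (hΩ : IsOpen Ω) (hΩb : Bornology.IsBounded Ω)
    (hΩM : Ω ⊆ M.carrier (d + 1)) (h0 : (0 : EuclideanSpace ℝ (Fin (d + 1))) ∉ Ω)
    (hΓ : IsRegularBoundary Ω Γ) (hΓM : Γ ⊆ M.carrier (d + 1))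
    (hbd : M.boundary Ω =ᵐ[μHE[d]] Γ) (hX : ContDiffOn ℝ 1 X (Ω ∪ Γ))
    (hdiv : IntegrableOn (M.div X) Ω (M.vol (d + 1)))
    {θ : EuclideanSpace ℝ (Fin (d + 1)) → ℝ} (hθ : ContDiff ℝ 1 θ) (hθ1 : ∀ x, θ x ∈ Icc (0 : ℝ) 1)
    (hsupp : tsupport θ ∩ closure Ω ⊆ Ω ∪ Γ) :
    Integrable (fun p => θ p * M.normalComponent Ω X p) (M.surface Ω) ∧
      IntegrableOn (fun x => fderiv ℝ θ x (X x)) Ω (M.vol (d + 1)) ∧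
      ∫ x in Ω, θ x * M.div X x ∂(M.vol (d + 1)) + ∫ x in Ω, fderiv ℝ θ x (X x) ∂(M.vol (d + 1)) =
        ∫ p, θ p * M.normalComponent Ω X p ∂(M.surface Ω) := by
  set Y : EuclideanSpace ℝ (Fin (d + 1)) → EuclideanSpace ℝ (Fin (d + 1)) :=
    fun y => M.volDensity y • X y
  have hΩm := hΩ.measurableSet
  have hYc : ContinuousOn Y (Ω ∪ Γ) :=
    (M.continuousOn_volDensity.mono (union_subset hΩM hΓM)).smul hX.continuousOn
  -- The volume density is known to be smooth only off the pole, which does not belong to `Ω`; on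
  -- `Γ` continuity is enough.
  have hY : ContDiffOn ℝ 1 Y Ω := fun x hx =>
    (((M.contDiffAt_volDensity (hΩM hx) fun hc => h0 (hc ▸ hx)).of_le
      (by simp)).contDiffWithinAt).smul (hX.mono subset_union_left x hx)
  have hdivY : IntegrableOn (euclDiv Y) Ω :=
    (integrableOn_congr_fun (fun x hx => M.volDensity_mul_div (hΩM hx)) hΩm).1
      ((M.integrable_vol_iff hΩm hΩM).1 hdiv)
  obtain ⟨hfi, hid⟩ := hasCutoffDivergence_of_isBounded hΩ hΩb hΓ hYc hY hdivY hθ hsupp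
  have hK : IsCompact (tsupport θ ∩ closure Ω) :=
    hΩb.isCompact_closure.inter_left (isClosed_tsupport θ)
  have hdθ : IntegrableOn (fun x => fderiv ℝ θ x (Y x)) Ω :=
    integrableOn_fderiv_apply hΩ hYc hθ hK hsupp
  have hθdiv : IntegrableOn (fun x => θ x * euclDiv Y x) Ω :=
    hdivY.bdd_mul (c := 1) hθ.continuous.aestronglyMeasurable (ae_of_all _ fun x => by
      rw [Real.norm_of_nonneg (hθ1 x).1]; exact (hθ1 x).2)
  rw [integral_add hθdiv hdθ] at hid
  have e1 : ∀ x, fderiv ℝ θ x (Y x) = M.volDensity x * fderiv ℝ θ x (X x) := fun x => by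
    rw [map_smul, smul_eq_mul]
  have e2 : EqOn (fun x => θ x * euclDiv Y x) (fun x => M.volDensity x * (θ x * M.div X x)) Ω :=
    fun x hx => by
      simp only [← M.volDensity_mul_div (X := X) (hΩM hx), Y]
      ring
  have e3 : ∀ p ∈ Γ, M.areaDensity Ω p * (θ p * M.normalComponent Ω X p) =
      θ p * inner ℝ (euclNormal Ω p) (Y p) := fun p hp => by
    rw [mul_left_comm, M.areaDensity_mul_normalComponent hΓ hΓM hp]
  have hΓf := hΓ.subset_frontier
  have hw := M.aemeasurable_areaDensity hΓ hΓM
  have hw0 : ∀ᵐ p ∂(Measure.restrict μHE[d] Γ), 0 ≤ M.areaDensity Ω p :=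
    ae_of_all _ fun _ => Real.sqrt_nonneg _
  refine ⟨?_, ?_, ?_⟩
  · rw [M.surface_eq hbd, integrable_withDensity_ofReal_iff hw hw0]
    exact (integrableOn_congr_fun e3 hΓ.measurableSet).2 (hfi.mono_set hΓf)
  · rw [IntegrableOn, M.integrable_vol_iff hΩm hΩM]
    simpa only [e1] using hdθ
  · rw [M.surface_eq hbd, integral_withDensity_ofReal hw hw0, M.integral_vol hΩm hΩM,
      M.integral_vol hΩm hΩM, ← setIntegral_congr_fun hΩm e2,
      setIntegral_congr_fun hΓ.measurableSet e3]
    simp only [← e1]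
    rw [hid]
    -- The frontier in `ℝⁿ` may exceed `Γ`, by singular points or by points outside the coordinate
    -- ball, but the cutoff vanishes there.
    refine setIntegral_eq_of_subset_of_forall_sdiff_eq_zero isClosed_frontier.measurableSet hΓf
      fun x hx => ?_
    have : x ∉ tsupport θ := fun hc => by
      rcases hsupp ⟨hc, hx.1.1⟩ with h | h
      · exact hx.1.2 (hΩ.interior_eq.symm ▸ h)
      · exact hx.2 h
    rw [image_eq_zero_of_notMem_tsupport this, zero_mul]

end ModelSpace

end RiemannianDivergenceTheorem

/-! ### Removing the cutoffs at the edges and at the antipode -/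

section SingularBoundary

open Filter Topology

namespace ModelSpace

variable (M : ModelSpace) {d : ℕ} {Ω Γ S : Set (EuclideanSpace ℝ (Fin (d + 1)))}
  {X : EuclideanSpace ℝ (Fin (d + 1)) → EuclideanSpace ℝ (Fin (d + 1))}

/-- The factor `η` confines the integral to a compact part of the coordinate ball. There the
Riemannian norm and volume density are controlled by Euclidean quantities, so vanishing Euclidean
Dirichlet integrals suffice for Cauchy–Schwarz against `|X|`. -/
theorem tendsto_integral_mul_fderiv_apply (hΩ : IsOpen Ω) (hΩM : Ω ⊆ M.carrier (d + 1))
    (hL2 : MemLp (fun x => M.normAt x (X x)) 2 ((M.vol (d + 1)).restrict Ω))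
    {η : EuclideanSpace ℝ (Fin (d + 1)) → ℝ} (hη : Continuous η)
    (hK : IsCompact (tsupport η ∩ closure Ω)) (hKM : tsupport η ∩ closure Ω ⊆ M.carrier (d + 1))
    {ζ : ℕ → EuclideanSpace ℝ (Fin (d + 1)) → ℝ} (hζ : ∀ k, ContDiff ℝ 1 (ζ k))
    (hlim : Tendsto (fun k => ∫⁻ x, ‖fderiv ℝ (ζ k) x‖ₑ ^ 2) atTop (𝓝 0)) :
    Tendsto (fun k => ∫ x in Ω, η x * fderiv ℝ (ζ k) x (X x) ∂(M.vol (d + 1))) atTop (𝓝 0) := by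
  -- The weight absorbs the constant of `norm_le_mul_normAt`, so that the integrand is bounded by
  -- `‖g • ∇ζ‖` times the Riemannian length of `X`.
  set g : EuclideanSpace ℝ (Fin (d + 1)) → ℝ := fun x => η x * (1 + 2 * (M.angularFactor x)⁻¹)
  have hgc : ContinuousOn g (tsupport η ∩ closure Ω) :=
    hη.continuousOn.mul (continuousOn_const.add (continuousOn_const.mul
      (M.continuous_angularFactor.continuousOn.inv₀ fun x hx => (M.angularFactor_pos (hKM hx)).ne')))
  obtain ⟨C₀, hC₀⟩ := hK.exists_bound_of_continuousOn
    ((M.continuousOn_volDensity.mono hKM).mul (hgc.pow 2))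
  set C := max C₀ 0
  have hC : ∀ x ∈ tsupport η ∩ closure Ω, M.volDensity x * g x ^ 2 ≤ C := fun x hx =>
    (le_abs_self _).trans ((hC₀ x hx).trans (le_max_left _ _))
  have hgm : Measurable g :=
    hη.measurable.mul (measurable_const.add (M.continuous_angularFactor.measurable.inv.const_mul 2))
  have hw : ∀ k (μ : Measure (EuclideanSpace ℝ (Fin (d + 1)))),
      AEStronglyMeasurable (fun x => g x • fderiv ℝ (ζ k) x) μ := fun k μ =>
    hgm.aestronglyMeasurable.smul ((hζ k).continuous_fderiv one_ne_zero).aestronglyMeasurable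
  have hbound : ∀ k, ∫⁻ x in Ω, ‖g x • fderiv ℝ (ζ k) x‖ₑ ^ 2 ∂(M.vol (d + 1)) ≤
      ENNReal.ofReal C * ∫⁻ x, ‖fderiv ℝ (ζ k) x‖ₑ ^ 2 := fun k => by
    rw [M.vol_restrict hΩ.measurableSet hΩM, lintegral_withDensity_eq_lintegral_mul₀'
      (M.aemeasurable_volDensity hΩ.measurableSet hΩM _).ennreal_ofReal ((hw k _).enorm.pow_const 2),
      ← lintegral_const_mul' _ _ ENNReal.ofReal_ne_top]
    refine (setLIntegral_mono' hΩ.measurableSet fun x hx => ?_).trans (setLIntegral_le_lintegral _ _)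
    have hpt : M.volDensity x * ‖g x • fderiv ℝ (ζ k) x‖ ^ 2 ≤ C * ‖fderiv ℝ (ζ k) x‖ ^ 2 := by
      rw [norm_smul, mul_pow, Real.norm_eq_abs, sq_abs, ← mul_assoc]
      by_cases hxT : x ∈ tsupport η
      · gcongr
        exact hC x ⟨hxT, subset_closure hx⟩
      · have h0 : g x = 0 := by simp only [g, image_eq_zero_of_notMem_tsupport hxT, zero_mul]
        rw [h0, zero_pow two_ne_zero, mul_zero, zero_mul]
        exact mul_nonneg (le_max_right _ _) (by positivity)
    have := ENNReal.ofReal_le_ofReal hpt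
    rw [ENNReal.ofReal_mul (show 0 ≤ M.volDensity x from Real.sqrt_nonneg _),
      ENNReal.ofReal_mul' (by positivity),
      ENNReal.ofReal_pow (norm_nonneg _), ENNReal.ofReal_pow (norm_nonneg _), ofReal_norm,
      ofReal_norm] at this
    exact this
  refine tendsto_integral_of_abs_le_mul hL2 (fun k => hw k _) ?_ fun k => ?_
  · refine tendsto_of_tendsto_of_tendsto_of_le_of_le tendsto_const_nhds ?_ (fun k => zero_le) hbound
    simpa using ENNReal.Tendsto.const_mul hlim (Or.inr ENNReal.ofReal_ne_top)
  · filter_upwards [ae_restrict_mem hΩ.measurableSet] with x hx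
    have ha := M.angularFactor_pos (hΩM hx)
    have h1 : |fderiv ℝ (ζ k) x (X x)| ≤
        ‖fderiv ℝ (ζ k) x‖ * ((1 + 2 * (M.angularFactor x)⁻¹) * M.normAt x (X x)) :=
      ((fderiv ℝ (ζ k) x).le_opNorm _).trans
        (mul_le_mul_of_nonneg_left (M.norm_le_mul_normAt ha _) (norm_nonneg _))
    have h2 : |M.normAt x (X x)| = M.normAt x (X x) := abs_of_nonneg (Real.sqrt_nonneg _)
    have h3 : |1 + 2 * (M.angularFactor x)⁻¹| = 1 + 2 * (M.angularFactor x)⁻¹ :=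
      abs_of_pos (by positivity)
    rw [h2, abs_mul, norm_smul, Real.norm_eq_abs, abs_mul, h3]
    calc _ ≤ |η x| * _ := mul_le_mul_of_nonneg_left h1 (abs_nonneg _)
      _ = _ := by ring

/-- The divergence theorem for the product of `X` with a cutoff function at the antipode of the
pole, for a domain whose boundary is regular up to a set of capacity zero. -/
theorem integral_radialCutoff_mul_div (hΩ : IsOpen Ω) (hΩb : Bornology.IsBounded Ω)
    (hΩM : Ω ⊆ M.carrier (d + 1)) (h0 : (0 : EuclideanSpace ℝ (Fin (d + 1))) ∉ Ω)
    (hΓ : IsRegularBoundary Ω Γ) (hΓM : Γ ⊆ M.carrier (d + 1))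
    (hbd : M.boundary Ω =ᵐ[μHE[d]] Γ) (hbdS : M.boundary Ω = Γ ∪ S) (hΓS : Disjoint Γ S)
    (hSM : ∃ C, IsClosed C ∧ S = C ∩ M.carrier (d + 1))
    (hS : ∀ K, IsCompact K → K ⊆ S → HasCutoffs K S)
    (hX : ContDiffOn ℝ 1 X (Ω ∪ Γ))
    (hL2 : MemLp (fun x => M.normAt x (X x)) 2 ((M.vol (d + 1)).restrict Ω))
    (hdiv : IntegrableOn (M.div X) Ω (M.vol (d + 1)))
    (hflux : ∫⁻ p, ENNReal.ofReal (M.normalComponent Ω X p) ∂(M.surface Ω) < ⊤ ∨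
      ∫⁻ p, ENNReal.ofReal (-M.normalComponent Ω X p) ∂(M.surface Ω) < ⊤)
    {η : EuclideanSpace ℝ (Fin (d + 1)) → ℝ} (hη : ContDiff ℝ 1 η) (hη1 : ∀ x, η x ∈ Icc (0 : ℝ) 1)
    (hsupp : tsupport η ∩ closure (M.carrier (d + 1)) ⊆ M.carrier (d + 1))
    (hηX : IntegrableOn (fun x => fderiv ℝ η x (X x)) Ω (M.vol (d + 1))) :
    Integrable (fun p => η p * M.normalComponent Ω X p) (M.surface Ω) ∧
      ∫ x in Ω, η x * M.div X x ∂(M.vol (d + 1)) + ∫ x in Ω, fderiv ℝ η x (X x) ∂(M.vol (d + 1)) =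
        ∫ p, η p * M.normalComponent Ω X p ∂(M.surface Ω) := by
  have hTM : tsupport η ∩ closure Ω ⊆ M.carrier (d + 1) := fun x hx =>
    hsupp ⟨hx.1, closure_mono hΩM hx.2⟩
  have hT : IsCompact (tsupport η ∩ closure Ω) :=
    hΩb.isCompact_closure.inter_left (isClosed_tsupport η)
  obtain ⟨C, hC, hSC⟩ := hSM
  have hKS : C ∩ (tsupport η ∩ closure Ω) ⊆ S := fun x hx => hSC ▸ ⟨hx.1, hTM hx.2⟩
  -- Only the part of `S` meeting both the support of `η` and the closure of `Ω` has to be cut off.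
  -- It is compact because `S` is relatively closed.
  obtain ⟨ζ, hζ, hζ1, hζK, hζS, hζlim⟩ := hS _ (hT.inter_left hC) hKS
  have hθ : ∀ k, ContDiff ℝ 1 fun x => η x * ζ k x := fun k => hη.mul (hζ k)
  have hθ1 : ∀ k x, η x * ζ k x ∈ Icc (0 : ℝ) 1 := fun k x =>
    ⟨mul_nonneg (hη1 x).1 (hζ1 k x).1, mul_le_one₀ (hη1 x).2 (hζ1 k x).1 (hζ1 k x).2⟩
  have hθsupp : ∀ k, tsupport (fun x => η x * ζ k x) ∩ closure Ω ⊆ Ω ∪ Γ := fun k x hx => by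
    have hxη : x ∈ tsupport η := tsupport_mul_subset_left hx.1
    have hxM : x ∈ M.carrier (d + 1) := hTM ⟨hxη, hx.2⟩
    by_cases hxΩ : x ∈ Ω
    · exact Or.inl hxΩ
    · rcases hbdS.subset ⟨⟨hx.2, fun hi => hxΩ (interior_subset hi)⟩, hxM⟩ with h | h
      · exact Or.inr h
      · have hxC : x ∈ C := by rw [hSC] at h; exact h.1
        exact absurd (tsupport_mul_subset_right hx.1)
          (notMem_tsupport_iff_eventuallyEq.2 (hζK k x ⟨hxC, hxη, hx.2⟩))
  have hcut := fun k => M.integral_cutoff_mul_div hΩ hΩb hΩM h0 hΓ hΓM hbd hX hdiv (hθ k) (hθ1 k)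
    (hθsupp k)
  have hprod : ∀ k x, fderiv ℝ (fun x => η x * ζ k x) x (X x) =
      η x * fderiv ℝ (ζ k) x (X x) + ζ k x * fderiv ℝ η x (X x) := fun k x => by
    rw [fderiv_fun_mul (hη.differentiable one_ne_zero x) ((hζ k).differentiable one_ne_zero x)]
    rfl
  have hi1 : ∀ k, IntegrableOn (fun x => ζ k x * fderiv ℝ η x (X x)) Ω (M.vol (d + 1)) := fun k =>
    hηX.bdd_mul (c := 1) (hζ k).continuous.aestronglyMeasurable (ae_of_all _ fun x => by
      rw [Real.norm_of_nonneg (hζ1 k x).1]; exact (hζ1 k x).2)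
  have hi2 : ∀ k, IntegrableOn (fun x => η x * fderiv ℝ (ζ k) x (X x)) Ω (M.vol (d + 1)) := fun k =>
    ((hcut k).2.1.sub (hi1 k)).congr (ae_of_all _ fun x => by
      simp only [Pi.sub_apply, hprod]; ring)
  have hΩS : ∀ x ∈ Ω, x ∉ S := fun x hx hxS =>
    (hbdS.superset (Or.inr hxS)).1.2 (hΩ.interior_eq.symm ▸ hx)
  have hev : ∀ x ∉ S, Tendsto (fun k => η x * ζ k x) atTop (𝓝 (η x)) := fun x hx =>
    tendsto_const_nhds.congr' (by filter_upwards [hζS x hx] with k hk; rw [hk, mul_one])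
  -- By the product rule, the term with the gradient of `ζ k` tends to `0` by zero capacity, and the
  -- term with the gradient of `η` converges by domination.
  have he : Tendsto (fun k => ∫ x in Ω, fderiv ℝ (fun x => η x * ζ k x) x (X x) ∂(M.vol (d + 1)))
      atTop (𝓝 (∫ x in Ω, fderiv ℝ η x (X x) ∂(M.vol (d + 1)))) := by
    have h1 := M.tendsto_integral_mul_fderiv_apply hΩ hΩM hL2 hη.continuous hT hTM hζ hζlim
    have h2 : Tendsto (fun k => ∫ x in Ω, ζ k x * fderiv ℝ η x (X x) ∂(M.vol (d + 1)))
        atTop (𝓝 (∫ x in Ω, fderiv ℝ η x (X x) ∂(M.vol (d + 1)))) := by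
      refine tendsto_integral_of_dominated_convergence (fun x => |fderiv ℝ η x (X x)|)
        (fun k => (hi1 k).aestronglyMeasurable) hηX.abs (fun k => ae_of_all _ fun x => ?_) ?_
      · rw [Real.norm_eq_abs, abs_mul, abs_of_nonneg (hζ1 k x).1]
        exact mul_le_of_le_one_left (abs_nonneg _) (hζ1 k x).2
      · filter_upwards [ae_restrict_mem hΩ.measurableSet] with x hx
        refine tendsto_const_nhds.congr' ?_
        filter_upwards [hζS x (hΩS x hx)] with k hk
        rw [hk, one_mul]
    have h3 := h1.add h2
    rw [zero_add] at h3
    refine h3.congr fun k => ?_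
    simp only [hprod]
    exact (integral_add (hi2 k) (hi1 k)).symm
  refine integrable_and_integral_eq_of_tendsto hdiv
    (M.aestronglyMeasurable_normalComponent hΓ hΓM hbd (hX.continuousOn.mono subset_union_right))
    (fun k => (hθ k).continuous.aestronglyMeasurable) (fun k => (hθ k).continuous.aestronglyMeasurable)
    hη.continuous.aestronglyMeasurable (fun k x => (hθ1 k x).1)
    (fun k x => mul_le_of_le_one_right (hη1 x).1 (hζ1 k x).2) (fun x => (hη1 x).2) ?_ ?_
    (fun k => (hcut k).1) he (fun k => (hcut k).2.2) hflux
  · filter_upwards [ae_restrict_mem hΩ.measurableSet] with x hx using hev x (hΩS x hx)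
  · rw [M.surface_eq hbd]
    refine (withDensity_absolutelyContinuous _ _).ae_le ?_
    filter_upwards [ae_restrict_mem hΓ.measurableSet] with x hx using
      hev x (disjoint_left.1 hΓS hx)

/-- With the singular set already removed, the antipodal cutoffs now tend to `1`. Their Dirichlet
integrals vanish in the limit with respect to the Riemannian volume, and radial gradients are paired
with `X` without loss. -/
theorem integral_div_eq_integral_normalComponent (hd : d ≠ 0) (hΩ : IsOpen Ω)
    (hΩb : Bornology.IsBounded Ω)
    (hΩM : Ω ⊆ M.carrier (d + 1)) (h0 : (0 : EuclideanSpace ℝ (Fin (d + 1))) ∉ Ω)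
    (hΓ : IsRegularBoundary Ω Γ) (hΓM : Γ ⊆ M.carrier (d + 1))
    (hbd : M.boundary Ω =ᵐ[μHE[d]] Γ) (hbdS : M.boundary Ω = Γ ∪ S) (hΓS : Disjoint Γ S)
    (hSM : ∃ C, IsClosed C ∧ S = C ∩ M.carrier (d + 1))
    (hS : ∀ K, IsCompact K → K ⊆ S → HasCutoffs K S)
    (hX : ContDiffOn ℝ 1 X (Ω ∪ Γ))
    (hL2 : MemLp (fun x => M.normAt x (X x)) 2 ((M.vol (d + 1)).restrict Ω))
    (hdiv : IntegrableOn (M.div X) Ω (M.vol (d + 1)))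
    (hflux : ∫⁻ p, ENNReal.ofReal (M.normalComponent Ω X p) ∂(M.surface Ω) < ⊤ ∨
      ∫⁻ p, ENNReal.ofReal (-M.normalComponent Ω X p) ∂(M.surface Ω) < ⊤) :
    Integrable (M.normalComponent Ω X) (M.surface Ω) ∧
      ∫ x in Ω, M.div X x ∂(M.vol (d + 1)) = ∫ p, M.normalComponent Ω X p ∂(M.surface Ω) := by
  obtain ⟨η, hη, hη1, hsupp, hev, hrad, hlim⟩ := M.exists_antipode_cutoffs hd
  have hle : ∀ j, ∫⁻ x in Ω, ‖fderiv ℝ (η j) x‖ₑ ^ 2 ∂(M.vol (d + 1)) ≤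
      ∫⁻ x in M.carrier (d + 1), ‖fderiv ℝ (η j) x‖ₑ ^ 2 ∂(M.vol (d + 1)) := fun j =>
    lintegral_mono_set hΩM
  -- Convergence to zero guarantees finite Dirichlet integrals only from some index on, hence the
  -- shift by `j₀`.
  obtain ⟨j₀, hj₀⟩ := eventually_atTop.1 (hlim.eventually_lt_const ENNReal.zero_lt_top)
  have hηm : ∀ j, AEStronglyMeasurable (fderiv ℝ (η j)) ((M.vol (d + 1)).restrict Ω) := fun j =>
    ((hη j).continuous_fderiv one_ne_zero).aestronglyMeasurable
  have hab : ∀ j x, |fderiv ℝ (η j) x (X x)| ≤ ‖fderiv ℝ (η j) x‖ * |M.normAt x (X x)| :=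
    fun j x => (hrad j x _).trans_eq (by rw [abs_of_nonneg (a := M.normAt x (X x))
      (Real.sqrt_nonneg _)])
  have hηX : ∀ j, j₀ ≤ j →
      IntegrableOn (fun x => fderiv ℝ (η j) x (X x)) Ω (M.vol (d + 1)) := fun j hj => by
    have h2 : MemLp (fderiv ℝ (η j)) 2 ((M.vol (d + 1)).restrict Ω) := by
      refine ⟨hηm j, ?_⟩
      rw [eLpNorm_lt_top_iff_lintegral_rpow_enorm_lt_top (by simp) (by simp)]
      simpa using (hle j).trans_lt (hj₀ j hj)
    have h3 : Integrable (fun x => ‖fderiv ℝ (η j) x‖ * M.normAt x (X x))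
        ((M.vol (d + 1)).restrict Ω) := h2.norm.integrable_mul hL2
    refine h3.mono' ?_ (ae_of_all _ fun x => hrad j x _)
    exact (((hη j).continuous_fderiv one_ne_zero).continuousOn.clm_apply
      (hX.continuousOn.mono subset_union_left)).aestronglyMeasurable hΩ.measurableSet
  have hcut := fun j => M.integral_radialCutoff_mul_div hΩ hΩb hΩM h0 hΓ hΓM hbd hbdS hΓS hSM hS hX
    hL2 hdiv hflux (hη (j + j₀)) (hη1 (j + j₀)) (hsupp (j + j₀)) (hηX (j + j₀) (Nat.le_add_left _ _))
  have he : Tendsto (fun j => ∫ x in Ω, fderiv ℝ (η (j + j₀)) x (X x) ∂(M.vol (d + 1))) atTop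
      (𝓝 0) := by
    refine (tendsto_add_atTop_iff_nat (f := fun j => ∫ x in Ω, fderiv ℝ (η j) x (X x)
      ∂(M.vol (d + 1))) j₀).2 ?_
    exact tendsto_integral_of_abs_le_mul hL2 hηm (tendsto_of_tendsto_of_tendsto_of_le_of_le
      tendsto_const_nhds hlim (fun j => zero_le) hle) fun j => ae_of_all _ (hab j)
  have hev' : ∀ x ∈ M.carrier (d + 1), Tendsto (fun j => η (j + j₀) x) atTop (𝓝 1) := fun x hx =>
    (tendsto_add_atTop_iff_nat (f := fun j => η j x) j₀).2
      (tendsto_const_nhds.congr' (by filter_upwards [hev x hx] with j hj using hj.symm))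
  have := integrable_and_integral_eq_of_tendsto (Θ := fun _ => 1) hdiv
    (M.aestronglyMeasurable_normalComponent hΓ hΓM hbd (hX.continuousOn.mono subset_union_right))
    (fun j => (hη (j + j₀)).continuous.aestronglyMeasurable)
    (fun j => (hη (j + j₀)).continuous.aestronglyMeasurable)
    aestronglyMeasurable_const (fun j x => (hη1 (j + j₀) x).1) (fun j x => (hη1 (j + j₀) x).2)
    (fun x => le_rfl) (by
      filter_upwards [ae_restrict_mem hΩ.measurableSet] with x hx using hev' x (hΩM hx))
    (by
      rw [M.surface_eq hbd]
      refine (withDensity_absolutelyContinuous _ _).ae_le ?_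
      filter_upwards [ae_restrict_mem hΓ.measurableSet] with x hx using hev' x (hΓM hx))
    (fun j => (hcut j).1) he (fun j => (hcut j).2) hflux
  simpa using this

end ModelSpace

end SingularBoundary

/-! ### The boundary of an annular sector-like domain -/

section AnnularSector

open Filter Topology

namespace ModelSpace

variable (M : ModelSpace) {n : ℕ} {D : Set (Metric.sphere (0 : EuclideanSpace ℝ (Fin n)) 1)}

theorem cone_subset_carrier : M.cone D ⊆ M.carrier n := by
  rintro x ⟨θ, -, t, ht, htR, rfl⟩
  change ‖t • (θ : EuclideanSpace ℝ (Fin n))‖ₑ < M.radius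
  rwa [← ofReal_norm, norm_smul, norm_eq_of_mem_sphere, mul_one, Real.norm_of_nonneg ht.le]

theorem zero_notMem_cone : (0 : EuclideanSpace ℝ (Fin n)) ∉ M.cone D := by
  rintro ⟨θ, -, t, ht, -, h⟩
  have h1 := congrArg norm h
  rw [norm_zero, norm_smul, norm_eq_of_mem_sphere, mul_one, Real.norm_of_nonneg ht.le] at h1
  exact ht.ne h1

theorem isOpen_cone (hD : IsOpen D) : IsOpen (M.cone D) := by
  obtain ⟨U, hU, rfl⟩ := isOpen_induced_iff.1 hD
  have hset : M.cone ((↑) ⁻¹' U : Set (Metric.sphere (0 : EuclideanSpace ℝ (Fin n)) 1)) =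
      ({0}ᶜ ∩ (fun x : EuclideanSpace ℝ (Fin n) => ‖x‖⁻¹ • x) ⁻¹' U) ∩ M.carrier n := by
    refine Subset.antisymm (fun x hx => ⟨⟨fun h0 => ?_, ?_⟩, M.cone_subset_carrier hx⟩) ?_
    · rw [mem_singleton_iff] at h0
      exact M.zero_notMem_cone (h0 ▸ hx)
    · obtain ⟨θ, hθ, t, ht, -, rfl⟩ := hx
      rw [mem_preimage, norm_smul, norm_eq_of_mem_sphere, mul_one, Real.norm_of_nonneg ht.le,
        smul_smul, inv_mul_cancel₀ ht.ne', one_smul]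
      exact hθ
    · rintro x ⟨⟨h0, hxU⟩, hx⟩
      have hx0 : ‖x‖ ≠ 0 := norm_ne_zero_iff.2 h0
      refine ⟨⟨‖x‖⁻¹ • x, ?_⟩, hxU, ‖x‖, norm_pos_iff.2 h0, ?_, ?_⟩
      · rw [mem_sphere_zero_iff_norm, norm_smul, norm_inv, norm_norm, inv_mul_cancel₀ hx0]
      · rw [ofReal_norm]; exact hx
      · rw [smul_smul, mul_inv_cancel₀ hx0, one_smul]
  rw [hset]
  refine IsOpen.inter (ContinuousOn.isOpen_inter_preimage ?_ isOpen_compl_singleton hU)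
    M.isOpen_carrier
  exact (continuous_norm.continuousOn.inv₀ fun x hx => norm_ne_zero_iff.2 hx).smul continuousOn_id

variable {M} {Ω₁ Ω₂ : Set (EuclideanSpace ℝ (Fin n))}

/-- The boundary of `A` is closed in the coordinate ball, so a limit point of its part in the cone
can be missing only by leaving the cone. As the cone over an open set is open, the edge is
relatively closed. -/
theorem edge_eq_sdiff_cone (A : Set (EuclideanSpace ℝ (Fin n))) :
    M.edge (M.boundary A ∩ M.cone D) =
      closure (M.boundary A ∩ M.cone D) \ M.cone D ∩ M.carrier n := by
  ext x
  constructor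
  · rintro ⟨⟨hx, hxM⟩, hxn⟩
    refine ⟨⟨hx, fun hc => hxn ⟨⟨?_, hxM⟩, hc⟩⟩, hxM⟩
    exact closure_minimal (inter_subset_left.trans inter_subset_left) isClosed_frontier hx
  · rintro ⟨⟨hx, hxc⟩, hxM⟩
    exact ⟨⟨hx, hxM⟩, fun hc => hxc hc.2⟩

namespace IsAnnularSectorLike

theorem annulus_eq (h : M.IsAnnularSectorLike D Ω₁ Ω₂) :
    M.annulus Ω₁ Ω₂ = Ω₁ \ closure Ω₂ := by
  ext x
  refine and_congr_right fun hx => not_congr (and_iff_left ?_)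
  exact M.cone_subset_carrier (h.subset₁ hx)

theorem isOpen_annulus (h : M.IsAnnularSectorLike D Ω₁ Ω₂) : IsOpen (M.annulus Ω₁ Ω₂) := by
  rw [h.annulus_eq]
  exact h.isOpen₁.sdiff isClosed_closure

theorem annulus_subset_cone (h : M.IsAnnularSectorLike D Ω₁ Ω₂) :
    M.annulus Ω₁ Ω₂ ⊆ M.cone D :=
  sdiff_subset.trans h.subset₁

theorem isRegularBoundary (h : M.IsAnnularSectorLike D Ω₁ Ω₂) :
    IsRegularBoundary (M.annulus Ω₁ Ω₂)
      (M.outerPart D Ω₁ ∪ M.lateralPart D Ω₁ Ω₂ ∪ M.innerPart D Ω₂) :=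
  (h.smooth_outer.isRegularBoundary.union h.smooth_lateral.isRegularBoundary).union
    h.smooth_inner.isRegularBoundary

theorem boundary_subset_carrier :
    M.outerPart D Ω₁ ∪ M.lateralPart D Ω₁ Ω₂ ∪ M.innerPart D Ω₂ ⊆ M.carrier n := by
  rintro x ((hx | hx) | hx)
  · exact hx.1.2
  · exact hx.1.2
  · exact hx.1.2

/-- A boundary point outside the lateral part lies, by definition of that part, in the closure of
the outer or inner part, hence in the part itself or in its edge. Conversely, the regular pieces lie
in the closed frontier, and so do their closures. -/
theorem boundary_annulus (h : M.IsAnnularSectorLike D Ω₁ Ω₂) :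
    M.boundary (M.annulus Ω₁ Ω₂) =
      M.outerPart D Ω₁ ∪ M.lateralPart D Ω₁ Ω₂ ∪ M.innerPart D Ω₂ ∪
        (M.edge (M.outerPart D Ω₁) ∪ M.edge (M.innerPart D Ω₂)) := by
  have hfr := h.isRegularBoundary.subset_frontier
  refine Subset.antisymm (fun x hx => ?_) (union_subset (fun x hx =>
    ⟨hfr hx, boundary_subset_carrier hx⟩) ?_)
  · by_cases hl : x ∈ M.lateralPart D Ω₁ Ω₂
    · exact Or.inl (Or.inl (Or.inr hl))
    · by_cases ho : x ∈ M.outerPart D Ω₁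
      · exact Or.inl (Or.inl (Or.inl ho))
      · by_cases hi : x ∈ M.innerPart D Ω₂
        · exact Or.inl (Or.inr hi)
        · refine Or.inr ?_
          have : x ∈ M.closureIn (M.outerPart D Ω₁) ∪ M.closureIn (M.innerPart D Ω₂) := by
            by_contra hc
            exact hl ⟨hx, hc⟩
          exact this.imp (fun hc => ⟨hc, ho⟩) fun hc => ⟨hc, hi⟩
  · rintro x (⟨hx, -⟩ | ⟨hx, -⟩)
    · exact ⟨closure_minimal ((subset_union_left.trans subset_union_left).trans hfr)
        isClosed_frontier hx.1, hx.2⟩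
    · exact ⟨closure_minimal (subset_union_right.trans hfr) isClosed_frontier hx.1, hx.2⟩

theorem disjoint_boundary_edges :
    Disjoint (M.outerPart D Ω₁ ∪ M.lateralPart D Ω₁ Ω₂ ∪ M.innerPart D Ω₂)
      (M.edge (M.outerPart D Ω₁) ∪ M.edge (M.innerPart D Ω₂)) := by
  have hcone : ∀ x ∈ M.edge (M.outerPart D Ω₁) ∪ M.edge (M.innerPart D Ω₂), x ∉ M.cone D := by
    rintro x (hx | hx)
    · exact ((edge_eq_sdiff_cone Ω₁).subset hx).1.2
    · exact ((edge_eq_sdiff_cone Ω₂).subset hx).1.2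
  refine disjoint_left.2 ?_
  rintro x ((hx | hx) | hx) hxe
  · exact hcone x hxe hx.2
  · exact hx.2 (hxe.imp (fun he => he.1) fun he => he.1)
  · exact hcone x hxe hx.2

theorem exists_isClosed_edges (h : M.IsAnnularSectorLike D Ω₁ Ω₂) :
    ∃ C, IsClosed C ∧ M.edge (M.outerPart D Ω₁) ∪ M.edge (M.innerPart D Ω₂) =
      C ∩ M.carrier n := by
  have hc := M.isOpen_cone h.isOpen_directions
  refine ⟨closure (M.outerPart D Ω₁) \ M.cone D ∪ closure (M.innerPart D Ω₂) \ M.cone D,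
    (isClosed_closure.sdiff hc).union (isClosed_closure.sdiff hc), ?_⟩
  rw [union_inter_distrib_right]
  exact congrArg₂ _ (edge_eq_sdiff_cone Ω₁) (edge_eq_sdiff_cone Ω₂)

/-- The compact set splits along the two edges into pieces which stay compact because each edge is
relatively closed. -/
theorem hasCutoffs_edges (h : M.IsAnnularSectorLike D Ω₁ Ω₂)
    {K : Set (EuclideanSpace ℝ (Fin n))} (hK : IsCompact K)
    (hKS : K ⊆ M.edge (M.outerPart D Ω₁) ∪ M.edge (M.innerPart D Ω₂)) :
    HasCutoffs K (M.edge (M.outerPart D Ω₁) ∪ M.edge (M.innerPart D Ω₂)) := by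
  have hc := M.isOpen_cone h.isOpen_directions
  have hKM : K ⊆ M.carrier n := fun x hx => (hKS hx).elim (fun he => he.1.2) fun he => he.1.2
  have h1 := h.edge_outer.hasCutoffs (hK.inter_right (isClosed_closure.sdiff hc))
    fun x hx => (edge_eq_sdiff_cone (M := M) Ω₁).superset ⟨hx.2, hKM hx.1⟩
  have h2 := h.edge_inner.hasCutoffs (hK.inter_right (isClosed_closure.sdiff hc))
    fun x hx => (edge_eq_sdiff_cone (M := M) Ω₂).superset ⟨hx.2, hKM hx.1⟩
  refine (h1.union h2).mono (fun x hx => ?_) le_rfl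
  exact (hKS hx).imp (fun he => ⟨hx, ((edge_eq_sdiff_cone Ω₁).subset he).1⟩)
    fun he => ⟨hx, ((edge_eq_sdiff_cone Ω₂).subset he).1⟩

theorem boundary_ae_eq {m : ℕ} (hm : n < m + 2) (h : M.IsAnnularSectorLike D Ω₁ Ω₂) :
    M.boundary (M.annulus Ω₁ Ω₂) =ᵐ[μHE[m]]
      (M.outerPart D Ω₁ ∪ M.lateralPart D Ω₁ Ω₂ ∪ M.innerPart D Ω₂ :
        Set (EuclideanSpace ℝ (Fin n))) := by
  rw [h.boundary_annulus]
  exact union_ae_eq_left_of_ae_eq_empty (ae_eq_empty.2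
    (measure_union_null (h.edge_outer.measure_eq_zero hm) (h.edge_inner.measure_eq_zero hm)))

theorem disjoint_outerPart_lateralPart :
    Disjoint (M.outerPart D Ω₁) (M.lateralPart D Ω₁ Ω₂) :=
  disjoint_left.2 fun _ hx hx' => hx'.2 (Or.inl ⟨subset_closure hx, hx.1.2⟩)

/-- The inner part lies in the closure of `Ω₂` within the cone, hence in the open set `Ω₁`, which
contains none of its own boundary points. -/
theorem disjoint_innerPart (h : M.IsAnnularSectorLike D Ω₁ Ω₂) :
    Disjoint (M.outerPart D Ω₁ ∪ M.lateralPart D Ω₁ Ω₂) (M.innerPart D Ω₂) := by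
  refine disjoint_left.2 ?_
  rintro x (hx | hx) hx'
  · refine hx.1.1.2 (h.isOpen₁.interior_eq.symm ▸ ?_)
    exact h.closure_subset ⟨⟨hx'.1.1.1, hx'.1.2⟩, hx'.2⟩
  · exact hx.2 (Or.inr ⟨subset_closure hx', hx'.1.2⟩)

end IsAnnularSectorLike

end ModelSpace

end AnnularSector

/-! ### The divergence theorem -/

theorem theorem2p2 (M : ModelSpace) (n : ℕ) (hn : 2 ≤ n)
    (D : Set (Metric.sphere (0 : EuclideanSpace ℝ (Fin n)) 1))
    (Ω₁ Ω₂ Ω Γ₀ Γ₁ Γ₂ : Set (EuclideanSpace ℝ (Fin n)))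
    (hΩ : Ω = M.annulus Ω₁ Ω₂)
    (hΓ₀ : Γ₀ = M.outerPart D Ω₁)
    (hΓ₁ : Γ₁ = M.lateralPart D Ω₁ Ω₂)
    (hΓ₂ : Γ₂ = M.innerPart D Ω₂)
    (hdom : M.IsAnnularSectorLike D Ω₁ Ω₂)
    (X : EuclideanSpace ℝ (Fin n) → EuclideanSpace ℝ (Fin n))
    (hC1 : ContDiffOn ℝ 1 X (Ω ∪ Γ₀ ∪ Γ₁ ∪ Γ₂))
    (hL2 : MemLp (fun x => M.normAt x (X x)) 2 ((M.vol n).restrict Ω))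
    (hdiv : IntegrableOn (M.div X) Ω (M.vol n))
    -- the integral of `⟨X, ν⟩` over `∂Ω` exists in `[-∞, ∞]`
    (hflux : ∫⁻ p, ENNReal.ofReal (M.normalComponent Ω X p) ∂(M.surface Ω) < ⊤ ∨
      ∫⁻ p, ENNReal.ofReal (-M.normalComponent Ω X p) ∂(M.surface Ω) < ⊤) :
    Integrable (M.normalComponent Ω X) (M.surface Ω) ∧
    ∫ x in Ω, M.div X x ∂(M.vol n) = ∫ p, M.normalComponent Ω X p ∂(M.surface Ω) ∧
    ∫ p, M.normalComponent Ω X p ∂(M.surface Ω) =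
      ∫ p in Γ₀, M.normalComponent Ω X p ∂(M.surface Ω) +
      ∫ p in Γ₁, M.normalComponent Ω X p ∂(M.surface Ω) +
      ∫ p in Γ₂, M.normalComponent Ω X p ∂(M.surface Ω) := by
  obtain ⟨d, rfl⟩ : ∃ d, n = d + 1 := ⟨n - 1, by omega⟩
  subst hΩ hΓ₀ hΓ₁ hΓ₂
  have hΓ := hdom.isRegularBoundary
  have hΓM := ModelSpace.IsAnnularSectorLike.boundary_subset_carrier (M := M) (D := D) (Ω₁ := Ω₁)
    (Ω₂ := Ω₂)
  have hbd := hdom.boundary_ae_eq (m := d) (by omega)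
  obtain ⟨hint, heq⟩ := M.integral_div_eq_integral_normalComponent (by omega) hdom.isOpen_annulus
    (hdom.isBounded₁.subset sdiff_subset)
    (hdom.annulus_subset_cone.trans M.cone_subset_carrier)
    (fun h0 => M.zero_notMem_cone (hdom.annulus_subset_cone h0)) hΓ hΓM hbd hdom.boundary_annulus
    ModelSpace.IsAnnularSectorLike.disjoint_boundary_edges hdom.exists_isClosed_edges
    (fun K hK hKS => hdom.hasCutoffs_edges hK hKS)
    (by simpa only [union_assoc] using hC1) hL2 hdiv hflux
  refine ⟨hint, heq, ?_⟩
  have hm₀ := hdom.smooth_outer.isRegularBoundary.measurableSet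
  have hm₁ := hdom.smooth_lateral.isRegularBoundary.measurableSet
  have hm₂ := hdom.smooth_inner.isRegularBoundary.measurableSet
  rw [← setIntegral_union ModelSpace.IsAnnularSectorLike.disjoint_outerPart_lateralPart hm₁
    hint.integrableOn hint.integrableOn,
    ← setIntegral_union hdom.disjoint_innerPart hm₂ hint.integrableOn hint.integrableOn]
  -- The edges are null, so the surface measure is carried by the three regular pieces.
  have hrestrict : (M.surface (M.annulus Ω₁ Ω₂)).restrict
      (M.outerPart D Ω₁ ∪ M.lateralPart D Ω₁ Ω₂ ∪ M.innerPart D Ω₂) =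
        M.surface (M.annulus Ω₁ Ω₂) := by
    rw [M.surface_eq hbd, restrict_withDensity hΓ.measurableSet,
      Measure.restrict_restrict hΓ.measurableSet, inter_self]
  rw [hrestrict]
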